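/- Let $n\ge 2$. A convex body in $\mathbb{R}^n$ is a nonempty compact convex set; it has constant width $1$ if $h(K,u)+h(K,-u)=1$ for all unit vectors $u$, where $h(K,u)=\max_{y\in K}\langle y,u\rangle$. Let $\mathcal{W}^n_1$ be the space of convex bodies of constant width $1$ in $\mathbb{R}^n$ with the Hausdorff metric. Let $x$ be a smooth boundary point of $K\in\mathcal{W}^n_1$, that is, a boundary point with exactly one outer unit normal vector $u$, and let $t$ be a unit vector orthogonal to $u$. For a relative boundary point $z$ of the planar section $K\cap(x+\mathrm{lin}\{u,t\})$ with $\langle z-x,t\rangle>0$, let $r(z)$ be the radius of the circle through $x$ and $z$ with centre on the ray $\{x-\lambda u:\lambda\ge 0\}$ (with $r(z)=\infty$ if there is no such circle). If $\liminf_{z\to x}r(z)=\limsup_{z\to x}r(z)$, the common value in $[0,\infty]$ is called the radius of curvature of $K$ at $x$ in direction $t$. We say that all radii of curvature of $K$ at $x$ are equal to $\varrho$ if $x$ is a smooth boundary point of $K$ and, for every unit vector $t$ orthogonal to the outer unit normal vector at $x$, the radius of curvature of $K$ at $x$ in direction $t$ exists and is equal to $\varrho$. Theorem. There is a comeagre subset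 of $\mathcal{W}^n_1$ such that every $K$ in it has the following two properties. (1) For $\mathcal{H}^{n-1}$-almost all $x\in\mathrm{bd}\,K$, all radii of curvature of $K$ at $x$ are equal to $1$. (2) The set of the points $x\in\mathrm{bd}\,K$ at which all radii of curvature of $K$ are equal to $0$ is uncountable and dense in $\mathrm{bd}\,K$. -/

import Mathlib

open Filter Topology MeasureTheory
open scoped ENNReal NNReal

noncomputable section

namespace ConstantWidth

variable {V : Type*} [NormedAddCommGroup V] [InnerProductSpace ℝ V]

/-- The support function `h(K, u) = max {⟪y, u⟫ : y ∈ K}` of a convex body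
(the supremum is a maximum, since `K` is nonempty and compact). -/
def supportFn (K : ConvexBody V) (u : V) : ℝ :=
  sSup ((fun y : V => inner ℝ y u) '' (K : Set V))

/-- `K` is of constant width `d`: `h(K, u) + h(K, -u) = d` for all unit vectors `u`. -/
def HasConstantWidth (K : ConvexBody V) (d : ℝ) : Prop :=
  ∀ u : V, ‖u‖ = 1 → supportFn K u + supportFn K (-u) = d

variable (V) in
/-- The space of convex bodies of constant width `1`, with the Hausdorff metric inherited from
`ConvexBody V`. -/
abbrev ConstantWidthOne : Type _ := {K : ConvexBody V // HasConstantWidth K 1}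

/-- `u` is an outer unit normal vector of the set `K` at its point `x`. -/
def IsOuterUnitNormal (K : Set V) (x u : V) : Prop :=
  x ∈ K ∧ ‖u‖ = 1 ∧ ∀ y ∈ K, inner ℝ (y - x) u ≤ 0

/-- The radius of the circle with centre on the ray `{x - ρ u : ρ ≥ 0}` that passes through `x`
and `z` (for `z ≠ x` there is at most one such circle); it is `∞` if there is no such circle. -/
def circleRadius (x u z : V) : ℝ≥0∞ :=
  ⨅ (ρ : ℝ≥0) (_ : dist z (x - (ρ : ℝ) • u) = ρ), (ρ : ℝ≥0∞)

/-- The open half-plane `{x + l u + m t : m > 0}` of the plane `x + lin {u, t}`. -/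
def openHalfPlane (x u t : V) : Set V :=
  {z | ∃ l m : ℝ, 0 < m ∧ z = x + l • u + m • t}

/-- The filter `z → x`, where `z` is in the relative boundary of the planar convex set `S`
and in the open half-plane of points that lie in direction `t` from `x`. -/
def boundaryFilter (S : Set V) (x u t : V) : Filter V :=
  𝓝[openHalfPlane x u t ∩ intrinsicFrontier ℝ S] x

/-- The lower radius of curvature at `(x, u)` in direction `t` of a two-dimensional convex body `S`
that lies in the plane `x + lin {u, t}`. -/
def planarLowerRadius (S : Set V) (x u t : V) : ℝ≥0∞ :=
  liminf (circleRadius x u) (boundaryFilter S x u t)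

/-- The upper radius of curvature at `(x, u)` in direction `t` of a two-dimensional convex body `S`
that lies in the plane `x + lin {u, t}`. -/
def planarUpperRadius (S : Set V) (x u t : V) : ℝ≥0∞ :=
  limsup (circleRadius x u) (boundaryFilter S x u t)

/-- The section of `K` by the plane `x + lin {u, t}`. -/
def planeSection (K : Set V) (x u t : V) : Set V :=
  K ∩ (AffineSubspace.mk' x (Submodule.span ℝ {u, t}) : Set V)

/-- The (sectional) radius of curvature of `K` at the support element `(x, u)` in direction `t`
exists and is equal to `ρ`: the lower and the upper radius of curvature of the planar section
are both equal to `ρ`. -/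
def HasRadiusOfCurvature (K : Set V) (x u t : V) (ρ : ℝ≥0∞) : Prop :=
  planarLowerRadius (planeSection K x u t) x u t = ρ ∧
    planarUpperRadius (planeSection K x u t) x u t = ρ

/-- `x` is a smooth boundary point of `K` (there is exactly one outer unit normal vector `u` of `K`
at `x`), and for every unit vector `t` orthogonal to `u`, the radius of curvature of `K` at `x`
in direction `t` exists and is equal to `ρ`. -/
def AllRadiiOfCurvatureEq (K : Set V) (x : V) (ρ : ℝ≥0∞) : Prop :=
  x ∈ frontier K ∧ ∃ u : V, IsOuterUnitNormal K x u ∧ (∀ v : V, IsOuterUnitNormal K x v → v = u) ∧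
    ∀ t : V, ‖t‖ = 1 → inner ℝ t u = 0 → HasRadiusOfCurvature K x u t ρ

/-- Explicit value of the radius used in the definition of osculating circles. -/
theorem circleRadius_eq {x u z : V} (hu : ‖u‖ = 1) (hz : z ≠ x) :
    circleRadius x u z =
      ENNReal.ofReal (‖z - x‖ ^ 2) / ENNReal.ofReal (2 * inner ℝ (x - z) u) := by
  have hpos : 0 < ‖z - x‖ ^ 2 := by
    have := norm_pos_iff.2 (sub_ne_zero.2 hz)
    positivity
  have key : ∀ ρ : ℝ≥0, dist z (x - (ρ : ℝ) • u) = ρ ↔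
      ‖z - x‖ ^ 2 = ρ * (2 * inner ℝ (x - z) u) := by
    intro ρ
    have e : z - (x - (ρ : ℝ) • u) = (z - x) + (ρ : ℝ) • u := by abel
    have n : ‖(z - x) + (ρ : ℝ) • u‖ ^ 2 =
        ‖z - x‖ ^ 2 - ρ * (2 * inner ℝ (x - z) u) + (ρ : ℝ) ^ 2 := by
      rw [norm_add_sq_real, norm_smul, hu, inner_smul_right, ← neg_sub x z, inner_neg_left]
      simp
      ring
    rw [dist_eq_norm, e, ← sq_eq_sq₀ (norm_nonneg _) ρ.coe_nonneg, n]
    constructor <;> intro h <;> linarith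
  unfold circleRadius
  simp only [key]
  by_cases hc : 0 < 2 * inner ℝ (x - z) u
  · rw [← ENNReal.ofReal_div_of_pos hc]
    apply le_antisymm
    · refine iInf₂_le (Real.toNNReal (‖z - x‖ ^ 2 / (2 * inner ℝ (x - z) u))) ?_
      rw [Real.coe_toNNReal _ (by positivity)]
      rw [div_mul_cancel₀ _ hc.ne']
    · refine le_iInf₂ fun ρ h => ?_
      rw [h, mul_div_assoc, div_self hc.ne', mul_one, ENNReal.ofReal_coe_nnreal]
  · rw [ENNReal.ofReal_of_nonpos (not_lt.1 hc),
      ENNReal.div_zero (ENNReal.ofReal_pos.2 hpos).ne']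
    refine iInf₂_eq_top.2 fun ρ h => ?_
    have := mul_nonpos_of_nonneg_of_nonpos ρ.2 (not_lt.1 hc)
    exact absurd h (by change (ρ : ℝ) * _ ≤ 0 at this; linarith)

end ConstantWidth

end

open Filter Topology MeasureTheory
open scoped ENNReal NNReal

noncomputable section

namespace ConstantWidth

variable {V : Type*} [NormedAddCommGroup V] [InnerProductSpace ℝ V]

/-! ### Support functions -/

/-! A body of constant width 1 amounts to a sublinear function h with h(u) + h(-u) = |u|. Each
direction u has a single support point x(u), which is the gradient of h at u; the map x is Lipschitz
on unit vectors, and x(u) = x(-u) + u. So on vectors orthogonal to a unit vector u, the second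
derivatives of h at u and at -u add up to the identity: radii of curvature at opposite points add up
to 1. If the derivative of w ↦ x(-w) vanishes at u (`IsStationary`) and the body is smooth, then all
radii are 1 at x(u) and all are 0 at x(-u) (`allRadiiOfCurvatureEq_one`,
`allRadiiOfCurvatureEq_zero`). It remains to show that in a typical body the stationary directions
account for almost all boundary points.

This is a Baire argument. The second derivative of h in a direction t, as an element of L¹ of an
annulus, is a pointwise limit of second differences, which depend continuously on the body. So a
typical K is a point of continuity of this assignment (`eventually_residual_continuousAt_hess`). On
the other hand, to the support function of a smooth, strongly convex body near K one can add the
oscillation N⁻² a cos(NΦ + θ) minus its reflection. This is uniformly small, but its second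
derivative in direction t, about -a (∂Φ/∂t)² cos(NΦ + θ) plus the reflected term, is not. Take a
proportional to the product of the principal radii at u, and Φ with differential Hess h(-u)(·, t);
then convexity survives both at u and at -u (`exists_perturbed_body`,
`exists_oscillating_perturbations`). Continuity at K forces a · Hess h(-u)(t, t)² = 0 almost
everywhere: for almost every u, either some principal radius vanishes at u, or u is stationary
(`eventually_residual_ae_det_eq_zero_or_isStationary`).

The first alternative costs nothing: there x has deficient rank, so by Sard's lemma the support
points in non-stationary directions form a null set (`hausdorffMeasure_nonstationary_eq_zero`),
which gives (1). Every boundary patch has positive measure, so every open set of directions contains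
uncountably many stationary u. Typical bodies are smooth (`eventually_residual_isSmooth`), so u ↦
x(-u) is injective on unit vectors, and the points x(-u) with u stationary give (2). -/

theorem inner_le_supportFn (K : ConvexBody V) {y : V} (hy : y ∈ (K : Set V)) (u : V) :
    inner ℝ y u ≤ supportFn K u := by
  refine le_csSup ?_ ⟨y, hy, rfl⟩
  exact (K.isCompact.image (by fun_prop)).bddAbove

theorem exists_inner_eq_supportFn (K : ConvexBody V) (u : V) :
    ∃ y ∈ (K : Set V), inner ℝ y u = supportFn K u :=
  (K.isCompact.image (f := fun y : V => inner ℝ y u) (by fun_prop)).sSup_mem (K.nonempty.image _)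

theorem supportFn_le (K : ConvexBody V) {u : V} {c : ℝ} (h : ∀ y ∈ (K : Set V), inner ℝ y u ≤ c) :
    supportFn K u ≤ c := by
  obtain ⟨y, hy, e⟩ := exists_inner_eq_supportFn K u
  exact e ▸ h y hy

theorem supportFn_smul (K : ConvexBody V) {c : ℝ} (hc : 0 ≤ c) (u : V) :
    supportFn K (c • u) = c * supportFn K u := by
  apply le_antisymm
  · refine supportFn_le K fun y hy => ?_
    rw [inner_smul_right]
    exact mul_le_mul_of_nonneg_left (inner_le_supportFn K hy u) hc
  · obtain ⟨y, hy, e⟩ := exists_inner_eq_supportFn K u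
    rw [← e, ← inner_smul_right]
    exact inner_le_supportFn K hy _

theorem supportFn_add_le (K : ConvexBody V) (u v : V) :
    supportFn K (u + v) ≤ supportFn K u + supportFn K v := by
  refine supportFn_le K fun y hy => ?_
  rw [inner_add_right]
  exact add_le_add (inner_le_supportFn K hy u) (inner_le_supportFn K hy v)

theorem HasConstantWidth.supportFn_add_neg {K : ConvexBody V} (hK : HasConstantWidth K 1) (u : V) :
    supportFn K u + supportFn K (-u) = ‖u‖ := by
  rcases eq_or_ne u 0 with rfl | hu
  · have := supportFn_smul K le_rfl (0 : V)
    simp at this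
    simp [this]
  · have h1 := hK (‖u‖⁻¹ • u) (norm_smul_inv_norm hu)
    have hp : 0 < ‖u‖ := norm_pos_iff.2 hu
    rw [← smul_neg, supportFn_smul K (by positivity), supportFn_smul K (by positivity)] at h1
    field_simp at h1
    linarith

theorem supportFn_sub_le (K L : ConvexBody V) (u : V) :
    supportFn K u - supportFn L u ≤ dist K L * ‖u‖ := by
  rw [sub_le_iff_le_add]
  refine supportFn_le K fun y hy => ?_
  obtain ⟨z, hz, e⟩ := L.isCompact.exists_infDist_eq_dist L.nonempty y
  have h1 : Metric.infDist y (L : Set V) ≤ dist K L := by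
    rw [← ConvexBody.hausdorffDist_coe]
    exact Metric.infDist_le_hausdorffDist_of_mem hy ConvexBody.hausdorffEDist_ne_top
  have h2 := inner_le_supportFn L hz u
  have h3 : inner ℝ (y - z) u ≤ dist K L * ‖u‖ := by
    refine (real_inner_le_norm _ _).trans ?_
    gcongr
    rw [← dist_eq_norm, ← e]; exact h1
  rw [inner_sub_left] at h3
  linarith

theorem abs_supportFn_sub_le (K L : ConvexBody V) (u : V) :
    |supportFn K u - supportFn L u| ≤ dist K L * ‖u‖ := by
  rw [abs_le]
  have h1 := supportFn_sub_le K L u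
  have h2 := supportFn_sub_le L K u
  rw [dist_comm] at h2
  constructor <;> linarith

/-! ### Convex bodies from sublinear functions; Hausdorff distance through support functions -/

section FiniteDimensional

variable [FiniteDimensional ℝ V]

theorem exists_inner_lt_of_notMem {s : Set V} (hs : Convex ℝ s) (hc : IsClosed s)
    {x : V} (hx : x ∉ s) : ∃ u : V, ∃ c : ℝ, (∀ y ∈ s, inner ℝ y u < c) ∧ c < inner ℝ x u := by
  obtain ⟨f, c, h1, h2⟩ := geometric_hahn_banach_closed_point hs hc hx
  refine ⟨(InnerProductSpace.toDual ℝ V).symm f, c, fun y hy => ?_, ?_⟩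
  · rw [real_inner_comm, InnerProductSpace.toDual_symm_apply]; exact h1 y hy
  · rw [real_inner_comm, InnerProductSpace.toDual_symm_apply]; exact h2

theorem mem_of_inner_le_supportFn (K : ConvexBody V) {x : V}
    (h : ∀ u, inner ℝ x u ≤ supportFn K u) : x ∈ (K : Set V) := by
  by_contra hx
  obtain ⟨u, c, h1, h2⟩ := exists_inner_lt_of_notMem K.convex K.isClosed hx
  obtain ⟨y, hy, e⟩ := exists_inner_eq_supportFn K u
  linarith [h u, h1 y hy]

/-- Every sublinear function is the support function of a convex body. -/
theorem exists_supportFn_eq (h : V → ℝ) (h_smul : ∀ c : ℝ, 0 < c → ∀ u, h (c • u) = c * h u)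
    (h_add : ∀ u v, h (u + v) ≤ h u + h v) : ∃ K : ConvexBody V, supportFn K = h := by
  have h0 : h 0 = 0 := by
    have := h_smul 2 two_pos 0
    rw [smul_zero] at this
    linarith
  have key : ∀ u, ∃ x : V, inner ℝ x u = h u ∧ ∀ w, inner ℝ x w ≤ h w := by
    intro u
    by_cases hu : u = 0
    · obtain ⟨g, -, hg2⟩ := exists_extension_of_le_sublinear (⟨⊥, 0⟩ : V →ₗ.[ℝ] ℝ) h h_smul h_add
        (by rintro ⟨x, hx⟩; simp at hx; subst hx; simp [h0])
      refine ⟨(InnerProductSpace.toDual ℝ V).symm (LinearMap.toContinuousLinearMap g), ?_, ?_⟩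
      · simp [hu, h0]
      · intro w; simpa using hg2 w
    · obtain ⟨g, hg1, hg2⟩ := exists_extension_of_le_sublinear
        (LinearPMap.mkSpanSingleton u (h u) hu) h h_smul h_add (by
          rintro ⟨x, hx⟩
          obtain ⟨c, rfl⟩ := Submodule.mem_span_singleton.1 hx
          rw [LinearPMap.mkSpanSingleton'_apply]
          rcases lt_trichotomy c 0 with hc | rfl | hc
          · have h1 := h_smul (-c) (by linarith) u
            have h2 := h_add (c • u) ((-c) • u)
            rw [← add_smul, add_neg_cancel, zero_smul, h0, h1] at h2
            simp only [smul_eq_mul, RingHom.id_apply]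
            linarith
          · simp [h0]
          · exact (h_smul c hc u).ge)
      refine ⟨(InnerProductSpace.toDual ℝ V).symm (LinearMap.toContinuousLinearMap g), ?_, ?_⟩
      · rw [InnerProductSpace.toDual_symm_apply]
        have := hg1 ⟨u, Submodule.mem_span_singleton_self u⟩
        rw [LinearPMap.mkSpanSingleton_apply] at this
        simpa using this
      · intro w; simpa using hg2 w
  have hb : ∃ R : ℝ, ∀ u, ‖u‖ = 1 → h u ≤ R := by
    have hc : ConvexOn ℝ Set.univ h := by
      refine ⟨convex_univ, fun x _ y _ a b ha hb _ => ?_⟩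
      have hs : ∀ c : ℝ, 0 ≤ c → ∀ u, h (c • u) = c * h u := by
        intro c hc u
        rcases hc.eq_or_lt with rfl | hc
        · simp [h0]
        · exact h_smul c hc u
      simpa [hs a ha, hs b hb] using h_add (a • x) (b • y)
    have hcont : Continuous h := by
      simpa [continuousOn_univ] using hc.continuousOn isOpen_univ
    obtain ⟨R, hR⟩ := ((isCompact_sphere (0 : V) 1).image hcont).bddAbove
    exact ⟨R, fun u hu => hR ⟨u, by simpa using hu, rfl⟩⟩
  obtain ⟨R, hR⟩ := hb
  have hclosed : IsClosed {x : V | ∀ w, inner ℝ x w ≤ h w} := by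
    simp only [Set.ofPred_forall]
    exact isClosed_iInter fun w => isClosed_le (by fun_prop) continuous_const
  refine ⟨⟨{x : V | ∀ w, inner ℝ x w ≤ h w}, ?_, ?_, ?_⟩, ?_⟩
  · intro x hx y hy a b ha hb hab w
    rw [inner_add_left, real_inner_smul_left, real_inner_smul_left]
    calc a * inner ℝ x w + b * inner ℝ y w ≤ a * h w + b * h w := by
          gcongr
          · exact hx w
          · exact hy w
      _ = h w := by rw [← add_mul, hab, one_mul]
  · refine Metric.isCompact_of_isClosed_isBounded hclosed ?_
    refine (Metric.isBounded_closedBall (x := (0 : V)) (r := max R 0)).subset fun x hx => ?_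
    rw [mem_closedBall_zero_iff]
    rcases eq_or_ne x 0 with rfl | hx0
    · simp
    · have h1 := hx (‖x‖⁻¹ • x)
      have h2 := hR (‖x‖⁻¹ • x) (norm_smul_inv_norm hx0)
      rw [inner_smul_right, real_inner_self_eq_norm_sq] at h1
      have : 0 < ‖x‖ := norm_pos_iff.2 hx0
      have e : ‖x‖⁻¹ * ‖x‖ ^ 2 = ‖x‖ := by field_simp
      exact le_max_of_le_left (by linarith)
  · obtain ⟨x, -, hx⟩ := key 0
    exact ⟨x, hx⟩
  · funext u
    obtain ⟨x, hx1, hx2⟩ := key u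
    apply le_antisymm
    · exact supportFn_le _ fun y hy => hy u
    · rw [← hx1]
      exact inner_le_supportFn _ (show x ∈ ((⟨{x : V | ∀ w, inner ℝ x w ≤ h w}, _, _, _⟩ :
        ConvexBody V) : Set V) from hx2) u

/-- A sublinear function of constant width `1` is the support function of an element of
`ConstantWidthOne V`. -/
theorem exists_constantWidthOne (h : V → ℝ) (h_smul : ∀ c : ℝ, 0 < c → ∀ u, h (c • u) = c * h u)
    (h_add : ∀ u v, h (u + v) ≤ h u + h v) (h_neg : ∀ u, h u + h (-u) = ‖u‖) :
    ∃ K : ConstantWidthOne V, supportFn K.1 = h := by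
  obtain ⟨K, hK⟩ := exists_supportFn_eq h h_smul h_add
  exact ⟨⟨K, fun u hu => by rw [hK, h_neg, hu]⟩, hK⟩

/-- A point `x` further than `r` from `L` could be separated from the closed `r`-thickening of `L`.
That set is convex, and its support function is at least that of `L` plus `r * ‖u‖`. -/
theorem exists_dist_le_of_supportFn_le (K L : ConvexBody V) {r : ℝ} (hr : 0 ≤ r)
    (h : ∀ u, supportFn K u ≤ supportFn L u + r * ‖u‖) {x : V} (hx : x ∈ (K : Set V)) :
    ∃ y ∈ (L : Set V), dist x y ≤ r := by
  obtain ⟨y, hy, e⟩ := L.isCompact.exists_infDist_eq_dist L.nonempty x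
  refine ⟨y, hy, ?_⟩
  rw [← e]
  by_contra hlt
  push Not at hlt
  have hx' : x ∉ Metric.cthickening r (L : Set V) := fun hm => by
    rw [Metric.mem_cthickening_iff] at hm
    have := ENNReal.toReal_mono ENNReal.ofReal_ne_top hm
    rw [ENNReal.toReal_ofReal hr] at this
    exact absurd this (not_le.2 hlt)
  obtain ⟨u, c, h1, h2⟩ := exists_inner_lt_of_notMem (L.convex.cthickening r)
    Metric.isClosed_cthickening hx'
  obtain ⟨z, hz, e2⟩ := exists_inner_eq_supportFn L u
  have h4 := h u
  have h5 := inner_le_supportFn K hx u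
  rcases eq_or_ne u 0 with rfl | hu
  · have := h1 z (Metric.self_subset_cthickening _ hz)
    simp at this h2
    linarith
  · have hm : z + (r * ‖u‖⁻¹) • u ∈ Metric.cthickening r (L : Set V) := by
      refine Metric.mem_cthickening_of_dist_le _ z _ _ hz ?_
      have : 0 < ‖u‖ := norm_pos_iff.2 hu
      rw [dist_eq_norm, add_sub_cancel_left, norm_smul, Real.norm_of_nonneg (by positivity)]
      field_simp
      rfl
    have h6 := h1 _ hm
    have : 0 < ‖u‖ := norm_pos_iff.2 hu
    rw [inner_add_left, real_inner_smul_left, real_inner_self_eq_norm_sq, e2] at h6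
    have e3 : r * ‖u‖⁻¹ * ‖u‖ ^ 2 = r * ‖u‖ := by field_simp
    linarith

theorem dist_le_of_abs_supportFn_sub_le (K L : ConvexBody V) {r : ℝ} (hr : 0 ≤ r)
    (h : ∀ u, |supportFn K u - supportFn L u| ≤ r * ‖u‖) : dist K L ≤ r := by
  rw [← ConvexBody.hausdorffDist_coe]
  refine Metric.hausdorffDist_le_of_mem_dist hr (fun x hx => ?_) (fun x hx => ?_)
  · exact exists_dist_le_of_supportFn_le K L hr (fun u => by linarith [(abs_le.1 (h u)).2]) hx
  · exact exists_dist_le_of_supportFn_le L K hr (fun u => by linarith [(abs_le.1 (h u)).1]) hx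

end FiniteDimensional

/-! ### Support points of bodies of constant width -/

/-- A point of `K` in which the linear functional `⟪·, u⟫` attains its maximum. -/
def supportPt (K : ConvexBody V) (u : V) : V := (exists_inner_eq_supportFn K u).choose

theorem supportPt_mem (K : ConvexBody V) (u : V) : supportPt K u ∈ (K : Set V) :=
  (exists_inner_eq_supportFn K u).choose_spec.1

theorem inner_supportPt (K : ConvexBody V) (u : V) : inner ℝ (supportPt K u) u = supportFn K u :=
  (exists_inner_eq_supportFn K u).choose_spec.2

theorem inner_supportPt_sub_nonneg (K : ConvexBody V) (u : V) {z : V} (hz : z ∈ (K : Set V)) :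
    0 ≤ inner ℝ (supportPt K u - z) u := by
  rw [inner_sub_left, inner_supportPt]
  linarith [inner_le_supportFn K hz u]

/-- The width in direction `a - b` dominates `⟪a - b, a - b⟫`. -/
theorem norm_sub_le_one (K : ConstantWidthOne V) {a b : V} (ha : a ∈ (K.1 : Set V))
    (hb : b ∈ (K.1 : Set V)) : ‖a - b‖ ≤ 1 := by
  have h1 := inner_le_supportFn K.1 ha (a - b)
  have h2 := inner_le_supportFn K.1 hb (-(a - b))
  have h3 := K.2.supportFn_add_neg (a - b)
  rw [inner_neg_right] at h2
  have h4 : inner ℝ (a - b) (a - b) ≤ ‖a - b‖ := by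
    rw [inner_sub_left]
    linarith
  rw [real_inner_self_eq_norm_sq] at h4
  nlinarith [norm_nonneg (a - b)]

/-- With `z` the chosen support point for `-u`, the vector `y - z` has length at most 1 and
component 1 along the normalized `u`, so it equals the normalized `u`. As `z` does not depend on
`y`, support points are unique. -/
theorem eq_supportPt_neg_add (K : ConstantWidthOne V) {u y : V} (hu : u ≠ 0)
    (hy : y ∈ (K.1 : Set V)) (e : inner ℝ y u = supportFn K.1 u) :
    y = supportPt K.1 (-u) + ‖u‖⁻¹ • u := by
  have hp : 0 < ‖u‖ := norm_pos_iff.2 hu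
  set z := supportPt K.1 (-u) with hz
  have h1 : inner ℝ (y - z) u = ‖u‖ := by
    have := inner_supportPt K.1 (-u)
    rw [inner_neg_right] at this
    rw [inner_sub_left, e, ← K.2.supportFn_add_neg u, ← this, ← hz]
    ring
  have hn : ‖‖u‖⁻¹ • u‖ = 1 := norm_smul_inv_norm hu
  have h2 : ‖(y - z) - ‖u‖⁻¹ • u‖ ^ 2 ≤ 0 := by
    rw [norm_sub_sq_real, inner_smul_right, h1, hn, inv_mul_cancel₀ hp.ne']
    have := norm_sub_le_one K hy (supportPt_mem K.1 (-u))
    rw [← hz] at this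
    nlinarith [norm_nonneg (y - z)]
  have h3 : (y - z) - ‖u‖⁻¹ • u = 0 := by
    rw [← norm_eq_zero]
    exact pow_eq_zero_iff two_ne_zero |>.1 (le_antisymm h2 (by positivity))
  rw [← sub_eq_zero, ← h3]
  abel

theorem supportPt_eq_neg_add (K : ConstantWidthOne V) {u : V} (hu : u ≠ 0) :
    supportPt K.1 u = supportPt K.1 (-u) + ‖u‖⁻¹ • u :=
  eq_supportPt_neg_add K hu (supportPt_mem _ _) (inner_supportPt _ _)

theorem eq_supportPt (K : ConstantWidthOne V) {u y : V} (hu : u ≠ 0)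
    (hy : y ∈ (K.1 : Set V)) (e : inner ℝ y u = supportFn K.1 u) : y = supportPt K.1 u :=
  (eq_supportPt_neg_add K hu hy e).trans (supportPt_eq_neg_add K hu).symm

theorem supportPt_smul (K : ConstantWidthOne V) {u : V} (hu : u ≠ 0) {c : ℝ} (hc : 0 < c) :
    supportPt K.1 (c • u) = supportPt K.1 u := by
  refine eq_supportPt K hu (supportPt_mem _ _) ?_
  have h1 := inner_supportPt K.1 (c • u)
  rw [inner_smul_right, supportFn_smul _ hc.le] at h1
  exact mul_left_cancel₀ hc.ne' h1

/-- The difference of the support points is that of the opposite support points plus `u - w`. The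
former has nonpositive product with `u`, because `supportPt K (-u)` is extremal for `-u`. -/
theorem inner_supportPt_sub_le (K : ConstantWidthOne V) {u w : V} (hu : ‖u‖ = 1) (hw : ‖w‖ = 1) :
    inner ℝ (supportPt K.1 u - supportPt K.1 w) u ≤ ‖u - w‖ ^ 2 / 2 := by
  have hu0 : u ≠ 0 := norm_ne_zero_iff.1 (by rw [hu]; exact one_ne_zero)
  have hw0 : w ≠ 0 := norm_ne_zero_iff.1 (by rw [hw]; exact one_ne_zero)
  have h1 := inner_supportPt_sub_nonneg K.1 (-u) (supportPt_mem K.1 (-w))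
  have e1 := supportPt_eq_neg_add K hu0
  have e2 := supportPt_eq_neg_add K hw0
  rw [hu, inv_one, one_smul] at e1
  rw [hw, inv_one, one_smul] at e2
  have e3 : supportPt K.1 u - supportPt K.1 w
      = (supportPt K.1 (-u) - supportPt K.1 (-w)) + (u - w) := by
    rw [e1, e2]; abel
  rw [inner_neg_right] at h1
  have h2 : inner ℝ (u - w) u = ‖u - w‖ ^ 2 / 2 := by
    rw [norm_sub_sq_real, hu, hw, inner_sub_left, real_inner_self_eq_norm_sq, hu,
      real_inner_comm w u]
    ring
  rw [e3, inner_add_left, h2]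
  linarith

/-- Let `d` be the difference of the support points. The diameter bound `‖d + w‖ ≤ 1` gives `‖d‖² ≤
-2⟪d, w⟫`, and `inner_supportPt_sub_le` bounds the right side by `‖u - w‖²`. -/
theorem norm_supportPt_sub_le (K : ConstantWidthOne V) {u w : V} (hu : ‖u‖ = 1) (hw : ‖w‖ = 1) :
    ‖supportPt K.1 u - supportPt K.1 w‖ ≤ ‖u - w‖ := by
  have hw0 : w ≠ 0 := norm_ne_zero_iff.1 (by rw [hw]; exact one_ne_zero)
  have e2 := supportPt_eq_neg_add K hw0
  rw [hw, inv_one, one_smul] at e2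
  have h1 := norm_sub_le_one K (supportPt_mem K.1 u) (supportPt_mem K.1 (-w))
  have e3 : supportPt K.1 u - supportPt K.1 (-w) = (supportPt K.1 u - supportPt K.1 w) + w := by
    rw [e2]; abel
  rw [e3] at h1
  have h2 : ‖(supportPt K.1 u - supportPt K.1 w) + w‖ ^ 2 ≤ 1 := by
    have := norm_nonneg ((supportPt K.1 u - supportPt K.1 w) + w)
    nlinarith
  rw [norm_add_sq_real, hw] at h2
  have h3 := inner_supportPt_sub_le K hw hu
  rw [← neg_sub, inner_neg_left, norm_sub_rev] at h3
  refine le_of_sq_le_sq ?_ (norm_nonneg _)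
  linarith

theorem norm_normalize_sub_le {u w : V} (hu : u ≠ 0) (hw : w ≠ 0) :
    ‖‖u‖⁻¹ • u - ‖w‖⁻¹ • w‖ ≤ 2 * ‖u‖⁻¹ * ‖u - w‖ := by
  have hp : 0 < ‖u‖ := norm_pos_iff.2 hu
  have hq : 0 < ‖w‖ := norm_pos_iff.2 hw
  have e : ‖u‖⁻¹ • u - ‖w‖⁻¹ • w = ‖u‖⁻¹ • (u - w) + (‖u‖⁻¹ - ‖w‖⁻¹) • w := by
    rw [smul_sub, sub_smul]; abel
  have e2 : ‖(‖u‖⁻¹ - ‖w‖⁻¹) • w‖ = ‖u‖⁻¹ * |‖w‖ - ‖u‖| := by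
    rw [norm_smul, Real.norm_eq_abs, inv_sub_inv hp.ne' hq.ne', abs_div, abs_of_pos (mul_pos hp hq)]
    field_simp
  have h3 : |‖w‖ - ‖u‖| ≤ ‖u - w‖ := by
    rw [norm_sub_rev]
    exact abs_norm_sub_norm_le w u
  calc _ ≤ ‖‖u‖⁻¹ • (u - w)‖ + ‖(‖u‖⁻¹ - ‖w‖⁻¹) • w‖ := by rw [e]; exact norm_add_le _ _
    _ ≤ ‖u‖⁻¹ * ‖u - w‖ + ‖u‖⁻¹ * ‖u - w‖ := by
      rw [e2, norm_smul, Real.norm_of_nonneg (by positivity)]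
      gcongr
    _ = _ := by ring

theorem norm_supportPt_sub_le' (K : ConstantWidthOne V) {u w : V} (hu : u ≠ 0) (hw : w ≠ 0) :
    ‖supportPt K.1 u - supportPt K.1 w‖ ≤ 2 * ‖u‖⁻¹ * ‖u - w‖ := by
  have hp : 0 < ‖u‖ := norm_pos_iff.2 hu
  have hq : 0 < ‖w‖ := norm_pos_iff.2 hw
  rw [← supportPt_smul K hu (inv_pos.2 hp), ← supportPt_smul K hw (inv_pos.2 hq)]
  exact (norm_supportPt_sub_le K (norm_smul_inv_norm hu) (norm_smul_inv_norm hw)).trans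
    (norm_normalize_sub_le hu hw)

theorem lipschitzOnWith_supportPt (K : ConstantWidthOne V) :
    LipschitzOnWith 4 (supportPt K.1) {u | 1 / 2 < ‖u‖} := by
  refine LipschitzOnWith.of_dist_le_mul fun u hu w hw => ?_
  simp only [Set.mem_ofPred_eq] at hu hw
  have hp : 0 < ‖u‖ := by linarith
  rw [dist_eq_norm, dist_eq_norm]
  refine (norm_supportPt_sub_le' K (norm_pos_iff.1 hp)
    (norm_pos_iff.1 (by linarith))).trans ?_
  gcongr
  have : ‖u‖⁻¹ ≤ 2 := by
    rw [inv_le_comm₀ hp two_pos]; linarith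
  simp only [NNReal.coe_ofNat]
  linarith

/-- The error of the linear approximation is `⟪x(w) - x(u), w⟫`, where x denotes the support point.
It lies between 0 and `⟪x(w) - x(u), w - u⟫`, which is quadratic by the Lipschitz estimate. -/
theorem hasFDerivAt_supportFn (K : ConstantWidthOne V) {u : V} (hu : u ≠ 0) :
    HasFDerivAt (supportFn K.1) (innerSL ℝ (supportPt K.1 u)) u := by
  have hp : 0 < ‖u‖ := norm_pos_iff.2 hu
  rw [hasFDerivAt_iff_isLittleO]
  have hb : ∀ᶠ w in 𝓝 u, ‖supportFn K.1 w - supportFn K.1 u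
      - innerSL ℝ (supportPt K.1 u) (w - u)‖ ≤ 2 * ‖u‖⁻¹ * ‖‖w - u‖ ^ 2‖ := by
    filter_upwards [isOpen_ne.mem_nhds hu] with w hw
    have h1 := inner_supportPt_sub_nonneg K.1 w (supportPt_mem K.1 u)
    have h2 := norm_supportPt_sub_le' K hu hw
    have h3 := inner_supportPt_sub_nonneg K.1 u (supportPt_mem K.1 w)
    have h4 : inner ℝ (supportPt K.1 w - supportPt K.1 u) (w - u) ≤ 2 * ‖u‖⁻¹ * ‖w - u‖ ^ 2 := by
      refine (real_inner_le_norm _ _).trans ?_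
      rw [norm_sub_rev (supportPt K.1 w)]
      rw [norm_sub_rev u] at h2
      nlinarith [norm_nonneg (w - u)]
    have e : supportFn K.1 w - supportFn K.1 u - innerSL ℝ (supportPt K.1 u) (w - u)
        = inner ℝ (supportPt K.1 w - supportPt K.1 u) w := by
      rw [innerSL_apply_apply, inner_sub_right, inner_sub_left, inner_supportPt, inner_supportPt]
      ring
    rw [e, Real.norm_of_nonneg h1, Real.norm_of_nonneg (by positivity)]
    rw [inner_sub_right] at h4
    rw [← neg_sub, inner_neg_left] at h3
    linarith
  refine (Asymptotics.IsBigO.of_bound _ hb).trans_isLittleO ?_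
  exact Asymptotics.isLittleO_pow_sub_sub u one_lt_two

theorem fderiv_supportFn (K : ConstantWidthOne V) {u : V} (hu : u ≠ 0) :
    fderiv ℝ (supportFn K.1) u = innerSL ℝ (supportPt K.1 u) :=
  (hasFDerivAt_supportFn K hu).fderiv

theorem continuousOn_supportPt (K : ConstantWidthOne V) :
    ContinuousOn (supportPt K.1) (Metric.sphere 0 1) :=
  (lipschitzOnWith_supportPt K).continuousOn.mono fun u hu => by
    simp only [mem_sphere_zero_iff_norm] at hu
    simp only [Set.mem_ofPred_eq, hu]; norm_num

/-! ### Boundary points and circles of curvature -/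

/-- All boundary points of `K` are smooth. -/
def IsSmooth (K : ConstantWidthOne V) : Prop :=
  ∀ u v : V, ‖u‖ = 1 → ‖v‖ = 1 → supportPt K.1 u = supportPt K.1 v → u = v

/-- The reverse support point map `w ↦ supportPt K (-w)` has vanishing derivative at `u`. -/
def IsStationary (K : ConstantWidthOne V) (u : V) : Prop :=
  HasFDerivAt (fun w => supportPt K.1 (-w)) (0 : V →L[ℝ] V) u

theorem ne_zero_of_norm_eq_one {E : Type*} [NormedAddCommGroup E] {u : E} (hu : ‖u‖ = 1) : u ≠ 0 :=
  norm_ne_zero_iff.1 (by rw [hu]; exact one_ne_zero)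

theorem supportPt_eq_neg_add_of_norm_eq_one (K : ConstantWidthOne V) {u : V} (hu : ‖u‖ = 1) :
    supportPt K.1 u = supportPt K.1 (-u) + u := by
  have := supportPt_eq_neg_add K (ne_zero_of_norm_eq_one hu)
  rwa [hu, inv_one, one_smul] at this

theorem isOuterUnitNormal_iff (K : ConstantWidthOne V) {x u : V} :
    IsOuterUnitNormal (K.1 : Set V) x u ↔ ‖u‖ = 1 ∧ x = supportPt K.1 u := by
  constructor
  · rintro ⟨hx, hu, h⟩
    refine ⟨hu, eq_supportPt K (ne_zero_of_norm_eq_one hu) hx ?_⟩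
    refine le_antisymm (inner_le_supportFn K.1 hx u) (supportFn_le K.1 fun y hy => ?_)
    have := h y hy
    rw [inner_sub_left] at this
    linarith
  · rintro ⟨hu, rfl⟩
    refine ⟨supportPt_mem _ _, hu, fun y hy => ?_⟩
    have := inner_supportPt_sub_nonneg K.1 u hy
    rw [← neg_sub, inner_neg_left]
    linarith

theorem supportPt_mem_frontier (K : ConstantWidthOne V) {u : V} (hu : ‖u‖ = 1) :
    supportPt K.1 u ∈ frontier (K.1 : Set V) := by
  rw [frontier, K.1.isClosed.closure_eq]
  refine ⟨supportPt_mem _ _, fun h => ?_⟩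
  obtain ⟨r, hr, hb⟩ := Metric.mem_nhds_iff.1 (mem_interior_iff_mem_nhds.1 h)
  have h1 : supportPt K.1 u + (r / 2) • u ∈ (K.1 : Set V) := by
    apply hb
    rw [Metric.mem_ball, dist_eq_norm, add_sub_cancel_left, norm_smul, hu,
      Real.norm_of_nonneg (by positivity)]
    linarith
  have h2 := inner_supportPt_sub_nonneg K.1 u h1
  rw [sub_add_cancel_left, inner_neg_left, real_inner_smul_left, real_inner_self_eq_norm_sq, hu] at h2
  linarith

section FiniteDimensional

variable [FiniteDimensional ℝ V]

/-- By compactness of the sphere the gap in the strict inequality has a positive minimum, which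
serves as the radius of a ball around `x` inside `K`. -/
theorem mem_interior_of_inner_lt [Nontrivial V] (K : ConstantWidthOne V) {x : V}
    (h : ∀ u, ‖u‖ = 1 → inner ℝ x u < supportFn K.1 u) : x ∈ interior (K.1 : Set V) := by
  have hc : ContinuousOn (fun u => supportFn K.1 u - inner ℝ x u) (Metric.sphere 0 1) := by
    refine ContinuousOn.sub (fun u hu => ?_) (by fun_prop)
    have hu : ‖u‖ = 1 := by simpa using hu
    exact (hasFDerivAt_supportFn K
      (ne_zero_of_norm_eq_one hu)).continuousAt.continuousWithinAt
  obtain ⟨u₀, hu₀, hmin⟩ := (isCompact_sphere (0 : V) 1).exists_isMinOn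
    (NormedSpace.sphere_nonempty.2 zero_le_one) hc
  have hu₀ : ‖u₀‖ = 1 := by simpa using hu₀
  set m := supportFn K.1 u₀ - inner ℝ x u₀ with hm
  have hmpos : 0 < m := sub_pos.2 (h u₀ hu₀)
  have hm2 : ∀ u, ‖u‖ = 1 → m ≤ supportFn K.1 u - inner ℝ x u := fun u hu =>
    hmin (by simpa using hu)
  rw [mem_interior_iff_mem_nhds]
  refine mem_of_superset (Metric.ball_mem_nhds x hmpos) fun z hz => ?_
  refine mem_of_inner_le_supportFn K.1 fun u => ?_
  rcases eq_or_ne u 0 with rfl | hu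
  · have := supportFn_smul K.1 le_rfl (0 : V)
    simp at this
    simp [this]
  · have hp : 0 < ‖u‖ := norm_pos_iff.2 hu
    have h1 := hm2 (‖u‖⁻¹ • u) (norm_smul_inv_norm hu)
    have h2 : inner ℝ (z - x) (‖u‖⁻¹ • u) ≤ m := by
      refine (real_inner_le_norm _ _).trans ?_
      have hn : ‖‖u‖⁻¹ • u‖ = 1 := norm_smul_inv_norm hu
      rw [hn, mul_one, ← dist_eq_norm]
      exact (Metric.mem_ball.1 hz).le
    rw [inner_sub_left] at h2
    rw [supportFn_smul _ (by positivity)] at h1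
    have h3 : inner ℝ z (‖u‖⁻¹ • u) ≤ ‖u‖⁻¹ * supportFn K.1 u := by linarith
    rw [inner_smul_right] at h3
    exact le_of_mul_le_mul_left h3 (by positivity)

theorem exists_eq_supportPt_of_mem_frontier [Nontrivial V] (K : ConstantWidthOne V) {x : V}
    (hx : x ∈ frontier (K.1 : Set V)) : ∃ u, ‖u‖ = 1 ∧ x = supportPt K.1 u := by
  rw [frontier, K.1.isClosed.closure_eq] at hx
  by_contra hcon
  push Not at hcon
  refine hx.2 (mem_interior_of_inner_lt K fun u hu => ?_)
  refine lt_of_le_of_ne (inner_le_supportFn K.1 hx.1 u) fun e => ?_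
  exact hcon u hu (eq_supportPt K (ne_zero_of_norm_eq_one hu) hx.1 e)

/-- The point is the midpoint of the chord between the support points for `u` and `-u`. If it were
extremal in some direction, both ends of the chord would be, against uniqueness. -/
theorem supportPt_sub_half_mem_interior [Nontrivial V] (K : ConstantWidthOne V) {u : V}
    (hu : ‖u‖ = 1) : supportPt K.1 u - (1 / 2 : ℝ) • u ∈ interior (K.1 : Set V) := by
  refine mem_interior_of_inner_lt K fun w hw => ?_
  have e := supportPt_eq_neg_add_of_norm_eq_one K hu
  have h1 := inner_le_supportFn K.1 (supportPt_mem K.1 u) w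
  have h2 := inner_le_supportFn K.1 (supportPt_mem K.1 (-u)) w
  have e1 : inner ℝ (supportPt K.1 u - (1 / 2 : ℝ) • u) w
      = (inner ℝ (supportPt K.1 u) w + inner ℝ (supportPt K.1 (-u)) w) / 2 := by
    rw [e, inner_sub_left, inner_add_left, real_inner_smul_left]
    ring
  rw [e1]
  by_contra hcon
  have h3 : inner ℝ (supportPt K.1 u) w = supportFn K.1 w := by linarith
  have h4 : inner ℝ (supportPt K.1 (-u)) w = supportFn K.1 w := by linarith
  have hw0 := ne_zero_of_norm_eq_one hw
  have h5 := eq_supportPt K hw0 (supportPt_mem K.1 u) h3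
  have h6 := eq_supportPt K hw0 (supportPt_mem K.1 (-u)) h4
  rw [h5, h6] at e
  exact ne_zero_of_norm_eq_one hu (left_eq_add.1 e)

/-- Near a boundary point with normal `u`, the lines parallel to `u` leave `K` near that point. -/
theorem exists_top_point [Nontrivial V] (K : ConstantWidthOne V) {u : V} (hu : ‖u‖ = 1) {ε : ℝ}
    (hε : 0 < ε) : ∃ δ > 0, ∀ v : V, inner ℝ v u = 0 → ‖v‖ < δ → ∃ l : ℝ,
      supportPt K.1 u + v + l • u ∈ (K.1 : Set V) ∧
      (∀ l', l < l' → supportPt K.1 u + v + l' • u ∉ (K.1 : Set V)) ∧ ‖v + l • u‖ < ε := by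
  set x := supportPt K.1 u with hxdef
  obtain ⟨r, hr, hb⟩ := Metric.mem_nhds_iff.1
    (mem_interior_iff_mem_nhds.1 (supportPt_sub_half_mem_interior K hu))
  rw [← hxdef] at hb
  set s := min 1 ε with hs
  have hs0 : 0 < s := lt_min one_pos hε
  have hs1 : s ≤ 1 := min_le_left _ _
  have hsε : s ≤ ε := min_le_right _ _
  have hsup : ∀ v : V, inner ℝ v u = 0 → ∀ l : ℝ, x + v + l • u ∈ (K.1 : Set V) → l ≤ 0 := by
    intro v hv l hl
    have := inner_supportPt_sub_nonneg K.1 u hl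
    rw [← hxdef, show x - (x + v + l • u) = -(v + l • u) by abel, inner_neg_left, inner_add_left, hv,
      real_inner_smul_left, real_inner_self_eq_norm_sq, hu] at this
    linarith
  refine ⟨min (s * r) (ε / 2), by positivity, fun v hv hvδ => ?_⟩
  have hv1 : ‖v‖ < s * r := hvδ.trans_le (min_le_left _ _)
  have hv2 : ‖v‖ < ε / 2 := hvδ.trans_le (min_le_right _ _)
  -- This is the combination, with weights `1 - s` and `s`, of `x` and the point `x - u / 2 + s⁻¹
  -- v`, which lies in the ball of radius `r` inside `K`.
  have hmem : x + v + (-(s / 2)) • u ∈ (K.1 : Set V) := by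
    have h1 : x - (1 / 2 : ℝ) • u + s⁻¹ • v ∈ (K.1 : Set V) := by
      apply hb
      rw [Metric.mem_ball, dist_eq_norm, add_sub_cancel_left, norm_smul,
        Real.norm_of_nonneg (by positivity), inv_mul_lt_iff₀ hs0]
      exact hv1
    have h2 := K.1.convex (supportPt_mem K.1 u) h1 (sub_nonneg.2 hs1) hs0.le (by ring)
    convert h2 using 1
    rw [← hxdef, smul_add, smul_smul, mul_inv_cancel₀ hs0.ne', one_smul, smul_sub, smul_smul,
      sub_smul, one_smul, neg_smul, mul_one_div]
    abel
  have hcomp : IsCompact (Set.Icc (-(s / 2)) 0 ∩ {l : ℝ | x + v + l • u ∈ (K.1 : Set V)}) :=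
    isCompact_Icc.inter_right (K.1.isClosed.preimage (by fun_prop))
  obtain ⟨l, ⟨hl1, hl2⟩, hmax⟩ := hcomp.exists_isGreatest
    ⟨-(s / 2), ⟨le_rfl, by linarith⟩, hmem⟩
  refine ⟨l, hl2, fun l' hl' hK => ?_, ?_⟩
  · exact absurd (hmax ⟨⟨hl1.1.trans hl'.le, hsup v hv l' hK⟩, hK⟩) (not_le.2 hl')
  · have : ‖l • u‖ ≤ ε / 2 := by
      rw [norm_smul, hu, mul_one, Real.norm_eq_abs, abs_le]
      constructor <;> linarith [hl1.1, hl1.2]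
    exact (norm_add_le _ _).trans_lt (by linarith)

end FiniteDimensional

/-- The affine span of the section lies in the plane, so a point interior to `K` is interior to the
section relative to that span. -/
theorem intrinsicFrontier_planeSection_subset (K : Set V) (hK : IsClosed K) (x u t : V) :
    intrinsicFrontier ℝ (planeSection K x u t) ⊆ frontier K := by
  have hcl : IsClosed (planeSection K x u t) := by
    refine hK.inter ?_
    have : FiniteDimensional ℝ (AffineSubspace.mk' x (Submodule.span ℝ {u, t})).direction := by
      rw [AffineSubspace.direction_mk']
      exact FiniteDimensional.span_of_finite ℝ (Set.toFinite _)
    exact AffineSubspace.closed_of_finiteDimensional _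
  intro z hz
  rw [frontier, hK.closure_eq]
  have hzS : z ∈ planeSection K x u t := by
    have := intrinsicFrontier_subset_intrinsicClosure hz
    exact hcl.closure_eq ▸ intrinsicClosure_subset_closure this
  refine ⟨hzS.1, fun hint => ?_⟩
  have hspan : affineSpan ℝ (planeSection K x u t) ≤ AffineSubspace.mk' x (Submodule.span ℝ {u, t}) :=
    affineSpan_le.2 Set.inter_subset_right
  have : z ∈ intrinsicInterior ℝ (planeSection K x u t) := by
    refine mem_intrinsicInterior.2 ⟨⟨z, subset_affineSpan ℝ _ hzS⟩, ?_, rfl⟩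
    rw [mem_interior_iff_mem_nhds]
    have h1 : (Subtype.val : affineSpan ℝ (planeSection K x u t) → V) ⁻¹' (interior K) ∈
        𝓝 (⟨z, subset_affineSpan ℝ _ hzS⟩ : affineSpan ℝ (planeSection K x u t)) :=
      continuous_subtype_val.continuousAt.preimage_mem_nhds (isOpen_interior.mem_nhds hint)
    filter_upwards [h1] with p hp
    exact ⟨interior_subset hp, hspan p.2⟩
  rw [← intrinsicClosure_sdiff_intrinsicFrontier] at this
  exact this.2 hz

/-- Writing `u` as a difference of points of `S` puts it in the direction of the affine span, so an
intrinsic interior point could be pushed a little along `u` within `S`. -/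
theorem mem_intrinsicFrontier_of_top {S : Set V} {z u p q : V} (hz : z ∈ S) (hp : p ∈ S)
    (hq : q ∈ S) (hu : u = p - q) (htop : ∀ l : ℝ, 0 < l → z + l • u ∉ S) :
    z ∈ intrinsicFrontier ℝ S := by
  rw [← intrinsicClosure_sdiff_intrinsicInterior]
  refine ⟨subset_intrinsicClosure hz, fun hint => ?_⟩
  obtain ⟨y, hy, rfl⟩ := mem_intrinsicInterior.1 hint
  have hmem : ∀ l : ℝ, (y : V) + l • u ∈ affineSpan ℝ S := by
    intro l
    have hd : l • u ∈ (affineSpan ℝ S).direction := by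
      refine Submodule.smul_mem _ _ ?_
      rw [hu]
      exact AffineSubspace.vsub_mem_direction (subset_affineSpan ℝ _ hp) (subset_affineSpan ℝ _ hq)
    have := AffineSubspace.vadd_mem_of_mem_direction hd y.2
    rwa [vadd_eq_add, add_comm] at this
  let f : ℝ → affineSpan ℝ S := fun l => ⟨(y : V) + l • u, hmem l⟩
  have hf : Continuous f := by fun_prop
  have hf0 : f 0 = y := by simp [f]
  have h1 : f ⁻¹' (interior (Subtype.val ⁻¹' S)) ∈ 𝓝 (0 : ℝ) :=
    hf.continuousAt.preimage_mem_nhds (isOpen_interior.mem_nhds (by rwa [hf0]))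
  have h2 : ∃ᶠ l in 𝓝[>] (0 : ℝ), 0 < l := (eventually_mem_nhdsWithin (s := Set.Ioi (0 : ℝ))).frequently
  obtain ⟨l, hl, hl'⟩ := (h2.and_eventually (nhdsWithin_le_nhds h1)).exists
  exact htop l hl (interior_subset hl' : f l ∈ Subtype.val ⁻¹' S)

/-- Along a trivial filter the liminf would be `∞` and the limsup 0, so no radius of curvature could
exist. The required boundary points are the top points of lines parallel to `u` over small multiples
of `t`. -/
theorem neBot_boundaryFilter [FiniteDimensional ℝ V] [Nontrivial V] (K : ConstantWidthOne V)
    {u t : V} (hu : ‖u‖ = 1) (ht : ‖t‖ = 1) (htu : inner ℝ t u = 0) :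
    (boundaryFilter (planeSection (K.1 : Set V) (supportPt K.1 u) u t)
      (supportPt K.1 u) u t).NeBot := by
  set x := supportPt K.1 u with hx
  rw [boundaryFilter, ← mem_closure_iff_nhdsWithin_neBot, Metric.mem_closure_iff]
  intro ε hε
  obtain ⟨δ, hδ, H⟩ := exists_top_point K hu hε
  obtain ⟨l, h1, h2, h3⟩ := H ((δ / 2) • t) (by rw [real_inner_smul_left, htu, mul_zero])
    (by rw [norm_smul, ht, Real.norm_of_nonneg (by positivity)]; linarith)
  rw [← hx] at h1 h2
  have hplane : ∀ a b : ℝ, x + a • t + b • u ∈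
      (AffineSubspace.mk' x (Submodule.span ℝ {u, t}) : Set V) := by
    intro a b
    rw [SetLike.mem_coe, AffineSubspace.mem_mk', vsub_eq_sub,
      show x + a • t + b • u - x = b • u + a • t by abel]
    exact Submodule.mem_span_pair.2 ⟨b, a, rfl⟩
  refine ⟨x + (δ / 2) • t + l • u, ⟨⟨l, δ / 2, by positivity, by abel⟩, ?_⟩, ?_⟩
  · refine mem_intrinsicFrontier_of_top (p := x) (q := supportPt K.1 (-u)) (u := u)
      ⟨h1, hplane _ _⟩ ⟨supportPt_mem _ _, ?_⟩ ⟨supportPt_mem _ _, ?_⟩ ?_ ?_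
    · simp
    · have := hplane 0 (-1)
      rw [hx, supportPt_eq_neg_add_of_norm_eq_one K hu] at this
      rw [hx, supportPt_eq_neg_add_of_norm_eq_one K hu]
      simpa using this
    · rw [hx, supportPt_eq_neg_add_of_norm_eq_one K hu]; abel
    · intro a ha hmem
      refine h2 (l + a) (by linarith) ?_
      rw [add_smul, ← add_assoc]
      exact hmem.1
  · rw [dist_eq_norm, show x - (x + (δ / 2) • t + l • u) = -((δ / 2) • t + l • u) by abel, norm_neg]
    exact h3

theorem ofReal_le_circleRadius {x u z : V} (hu : ‖u‖ = 1) (hz : z ≠ x) {c : ℝ} (hc : 0 ≤ c)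
    (h : c * (2 * inner ℝ (x - z) u) ≤ ‖z - x‖ ^ 2) : ENNReal.ofReal c ≤ circleRadius x u z := by
  have hp : 0 < ‖z - x‖ := norm_pos_iff.2 (sub_ne_zero.2 hz)
  rw [circleRadius_eq hu hz, ENNReal.le_div_iff_mul_le
    (Or.inr (ENNReal.ofReal_pos.2 (by positivity)).ne') (Or.inr ENNReal.ofReal_ne_top),
    ← ENNReal.ofReal_mul hc]
  exact ENNReal.ofReal_le_ofReal h

theorem circleRadius_le_ofReal {x u z : V} (hu : ‖u‖ = 1) (hz : z ≠ x) {c : ℝ} (hc : 0 ≤ c)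
    (h : ‖z - x‖ ^ 2 ≤ c * (2 * inner ℝ (x - z) u)) : circleRadius x u z ≤ ENNReal.ofReal c := by
  rw [circleRadius_eq hu hz]
  refine ENNReal.div_le_of_le_mul ?_
  rw [← ENNReal.ofReal_mul hc]
  exact ENNReal.ofReal_le_ofReal h

/-- One limit along the whole boundary serves all `t` at once: the boundary filters of all the
planar sections are finer. -/
theorem allRadiiOfCurvatureEq_of_tendsto [FiniteDimensional ℝ V] [Nontrivial V]
    {K : ConstantWidthOne V} (hK : IsSmooth K) {u : V} (hu : ‖u‖ = 1) {ρ : ℝ≥0∞}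
    (h : Tendsto (circleRadius (supportPt K.1 u) u)
      (𝓝[frontier (K.1 : Set V) \ {supportPt K.1 u}] (supportPt K.1 u)) (𝓝 ρ)) :
    AllRadiiOfCurvatureEq (K.1 : Set V) (supportPt K.1 u) ρ := by
  refine ⟨supportPt_mem_frontier K hu, u, (isOuterUnitNormal_iff K).2 ⟨hu, rfl⟩, ?_, ?_⟩
  · intro v hv
    obtain ⟨hv1, hv2⟩ := (isOuterUnitNormal_iff K).1 hv
    exact hK v u hv1 hu hv2.symm
  · intro t ht htu
    have hne := neBot_boundaryFilter K hu ht htu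
    have hle : boundaryFilter (planeSection (K.1 : Set V) (supportPt K.1 u) u t)
        (supportPt K.1 u) u t ≤
        𝓝[frontier (K.1 : Set V) \ {supportPt K.1 u}] (supportPt K.1 u) := by
      refine nhdsWithin_mono _ ?_
      rintro z ⟨⟨l, m, hm, rfl⟩, hz⟩
      refine ⟨intrinsicFrontier_planeSection_subset _ K.1.isClosed _ _ _ hz, fun e => ?_⟩
      have e1 : l • u + m • t = 0 := by
        rw [Set.mem_singleton_iff, add_assoc] at e
        exact add_eq_left.1 e
      have e2 := congrArg (fun p => inner ℝ t p) e1
      simp only [inner_add_right, inner_smul_right, htu, real_inner_self_eq_norm_sq, ht,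
        inner_zero_right] at e2
      linarith
    exact ⟨(h.mono_left hle).liminf_eq, (h.mono_left hle).limsup_eq⟩

/-- The normals outside the interior of `N` form a compact set, whose image is compact and, by
smoothness, misses the support point of `u`. -/
theorem IsSmooth.eventually_normal_mem [FiniteDimensional ℝ V] {K : ConstantWidthOne V}
    (hK : IsSmooth K) {u : V} (hu : ‖u‖ = 1) {N : Set V} (hN : N ∈ 𝓝 u) :
    ∀ᶠ z in 𝓝 (supportPt K.1 u), ∀ w, ‖w‖ = 1 → z = supportPt K.1 w → w ∈ N := by
  have hcomp : IsCompact (supportPt K.1 '' (Metric.sphere 0 1 \ interior N)) :=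
    ((isCompact_sphere (0 : V) 1).diff isOpen_interior).image_of_continuousOn
      ((continuousOn_supportPt K).mono Set.sdiff_subset)
  have hnot : supportPt K.1 u ∈ (supportPt K.1 '' (Metric.sphere 0 1 \ interior N))ᶜ := by
    rintro ⟨w, ⟨hw1, hw2⟩, e⟩
    have : w = u := hK w u (by simpa using hw1) hu e
    exact hw2 (this ▸ mem_interior_iff_mem_nhds.2 hN)
  filter_upwards [hcomp.isClosed.isOpen_compl.mem_nhds hnot] with z hz w hw e
  by_contra hcon
  exact hz ⟨w, ⟨by simpa using hw, fun hi => hcon (interior_subset hi)⟩, e.symm⟩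

/-- All radii of curvature are `1` at the support point in a stationary direction. -/
theorem allRadiiOfCurvatureEq_one [FiniteDimensional ℝ V] [Nontrivial V] {K : ConstantWidthOne V}
    (hK : IsSmooth K) {u : V} (hu : ‖u‖ = 1) (hs : IsStationary K u) :
    AllRadiiOfCurvatureEq (K.1 : Set V) (supportPt K.1 u) 1 := by
  refine allRadiiOfCurvatureEq_of_tendsto hK hu ?_
  rw [tendsto_order]
  constructor
  · intro a ha
    obtain ⟨c, hac, hc1⟩ := ENNReal.lt_iff_exists_nnreal_btwn.1 ha
    have hc1 : (c : ℝ) < 1 := by exact_mod_cast hc1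
    -- With this choice `c = 1 - 2η ≤ (1 - η)²`, which pays for the loss in the lower bound `(1 - η)
    -- ‖w - u‖` for the distance of the support points.
    set η : ℝ := (1 - c) / 2 with hη
    have hη0 : 0 < η := by rw [hη]; linarith
    have hev : ∀ᶠ w in 𝓝 u, ‖supportPt K.1 (-w) - supportPt K.1 (-u)‖ ≤ η * ‖w - u‖ := by
      have := (hasFDerivAt_iff_isLittleO.1 hs).def hη0
      simpa using this
    filter_upwards [nhdsWithin_le_nhds (hK.eventually_normal_mem hu hev), self_mem_nhdsWithin]
      with z hz ⟨hzf, hzx⟩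
    obtain ⟨w, hw, rfl⟩ := exists_eq_supportPt_of_mem_frontier K hzf
    have h1 : ‖supportPt K.1 (-w) - supportPt K.1 (-u)‖ ≤ η * ‖w - u‖ := hz w hw rfl
    refine hac.trans_le ?_
    rw [← ENNReal.ofReal_coe_nnreal]
    refine ofReal_le_circleRadius hu hzx c.2 ?_
    have h2 := inner_supportPt_sub_le K hu hw
    rw [norm_sub_rev] at h2
    have e : supportPt K.1 w - supportPt K.1 u
        = (w - u) + (supportPt K.1 (-w) - supportPt K.1 (-u)) := by
      rw [supportPt_eq_neg_add_of_norm_eq_one K hu, supportPt_eq_neg_add_of_norm_eq_one K hw]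
      abel
    have h3 : (1 - η) * ‖w - u‖ ≤ ‖supportPt K.1 w - supportPt K.1 u‖ := by
      rw [e]
      have := norm_sub_le_norm_add (w - u) (supportPt K.1 (-w) - supportPt K.1 (-u))
      linarith
    have hη1 : η ≤ 1 / 2 := by rw [hη]; linarith [c.2]
    have h4 : ((1 - η) * ‖w - u‖) ^ 2 ≤ ‖supportPt K.1 w - supportPt K.1 u‖ ^ 2 :=
      pow_le_pow_left₀ (mul_nonneg (by linarith) (norm_nonneg _)) h3 2
    have h5 : (c : ℝ) = 1 - 2 * η := by rw [hη]; ring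
    have h6 : (c : ℝ) * (2 * inner ℝ (supportPt K.1 u - supportPt K.1 w) u) ≤ c * ‖w - u‖ ^ 2 :=
      mul_le_mul_of_nonneg_left (by linarith) c.2
    have h7 : (c : ℝ) * ‖w - u‖ ^ 2 ≤ ((1 - η) * ‖w - u‖) ^ 2 := by
      rw [mul_pow, h5]
      exact mul_le_mul_of_nonneg_right (by nlinarith) (by positivity)
    linarith
  -- The upper bound needs no stationarity: `K` lies in the unit ball around `supportPt K (-u) =
  -- supportPt K u - u`.
  · intro a ha
    filter_upwards [self_mem_nhdsWithin] with z ⟨hzf, hzx⟩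
    refine lt_of_le_of_lt ?_ ha
    rw [← ENNReal.ofReal_one]
    refine circleRadius_le_ofReal hu hzx zero_le_one ?_
    have hzK : z ∈ (K.1 : Set V) := by
      have := frontier_subset_closure hzf
      rwa [K.1.isClosed.closure_eq] at this
    have h1 := norm_sub_le_one K hzK (supportPt_mem K.1 (-u))
    have e : z - supportPt K.1 (-u) = (z - supportPt K.1 u) + u := by
      rw [supportPt_eq_neg_add_of_norm_eq_one K hu]; abel
    rw [e] at h1
    have h2 : ‖(z - supportPt K.1 u) + u‖ ^ 2 ≤ 1 := pow_le_one₀ (norm_nonneg _) h1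
    rw [norm_add_sq_real, hu] at h2
    rw [← neg_sub z, inner_neg_left]
    linarith

/-- All radii of curvature are `0` at the support point opposite to a stationary direction. -/
theorem allRadiiOfCurvatureEq_zero [FiniteDimensional ℝ V] [Nontrivial V] {K : ConstantWidthOne V}
    (hK : IsSmooth K) {u : V} (hu : ‖u‖ = 1) (hs : IsStationary K u) :
    AllRadiiOfCurvatureEq (K.1 : Set V) (supportPt K.1 (-u)) 0 := by
  have hnu : ‖-u‖ = 1 := by rwa [norm_neg]
  refine allRadiiOfCurvatureEq_of_tendsto hK hnu ?_
  set y := supportPt K.1 (-u) with hy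
  rw [ENNReal.tendsto_nhds_zero]
  intro a ha
  obtain ⟨c, hc0, hca⟩ := ENNReal.lt_iff_exists_nnreal_btwn.1 ha
  have hc0 : (0 : ℝ) < c := by exact_mod_cast hc0
  set η : ℝ := c / 2 with hη
  have hη0 : 0 < η := by rw [hη]; linarith
  have hev : ∀ᶠ w in 𝓝 u, ‖supportPt K.1 (-w) - y‖ ≤ η * ‖w - u‖ := by
    have := (hasFDerivAt_iff_isLittleO.1 hs).def hη0
    simpa using this
  obtain ⟨r, hr, hball⟩ := Metric.eventually_nhds_iff.1 hev
  have hnear : ∀ᶠ z in 𝓝 y, ‖y - z‖ < 2 * η * r := by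
    filter_upwards [Metric.ball_mem_nhds y (show 0 < 2 * η * r by positivity)] with z hz
    rwa [Metric.mem_ball, dist_comm, dist_eq_norm] at hz
  filter_upwards [nhdsWithin_le_nhds hnear, self_mem_nhdsWithin] with z hz ⟨hzf, hzx⟩
  refine le_trans ?_ hca.le
  rw [← ENNReal.ofReal_coe_nnreal]
  refine circleRadius_le_ofReal hnu hzx c.2 ?_
  have hzK : z ∈ (K.1 : Set V) := by
    have := frontier_subset_closure hzf
    rwa [K.1.isClosed.closure_eq] at this
  have hpos : 0 < ‖y - z‖ := norm_pos_iff.2 (sub_ne_zero.2 (Ne.symm hzx))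
  -- With `p` the unit vector along `y - z`, testing `z` against the direction `u + s p` yields `⟪y
  -- - z, u⟫ ≤ η s² - s ‖y - z‖`. This `s` minimizes the right side.
  set s : ℝ := ‖y - z‖ / (2 * η) with hsdef
  have hs0 : 0 < s := by positivity
  have hsr : s < r := by
    rw [hsdef, div_lt_iff₀ (by positivity)]; linarith
  set p : V := ‖y - z‖⁻¹ • (y - z) with hp
  have hpn : ‖p‖ = 1 := norm_smul_inv_norm (norm_pos_iff.1 hpos)
  set w : V := u + s • p with hw
  have hwu : ‖w - u‖ = s := by
    rw [hw, add_sub_cancel_left, norm_smul, hpn, mul_one, Real.norm_of_nonneg hs0.le]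
  have h1 : ‖supportPt K.1 (-w) - y‖ ≤ η * ‖w - u‖ := hball (by rw [dist_eq_norm, hwu]; exact hsr)
  have h2 := inner_supportPt_sub_nonneg K.1 (-w) hzK
  have h3 := inner_supportPt_sub_nonneg K.1 (-u) (supportPt_mem K.1 (-w))
  rw [← hy] at h3
  have h4 : inner ℝ (y - supportPt K.1 (-w)) (w - u) ≤ η * s ^ 2 := by
    refine (real_inner_le_norm _ _).trans ?_
    rw [norm_sub_rev, hwu]
    rw [hwu] at h1
    nlinarith
  have h5 : inner ℝ (y - z) w ≤ η * s ^ 2 := by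
    have e : inner ℝ (y - z) w = inner ℝ (y - supportPt K.1 (-w)) (w - u)
        + inner ℝ (y - supportPt K.1 (-w)) u + inner ℝ (supportPt K.1 (-w) - z) w := by
      rw [← inner_add_right, sub_add_cancel, ← inner_add_left, sub_add_sub_cancel]
    rw [inner_neg_right] at h2 h3
    linarith
  have h6 : inner ℝ (y - z) w = inner ℝ (y - z) u + s * ‖y - z‖ := by
    rw [hw, inner_add_right, inner_smul_right, hp, inner_smul_right, real_inner_self_eq_norm_sq]
    field_simp
  have h7 : ‖y - z‖ = 2 * η * s := by rw [hsdef]; field_simp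
  rw [inner_neg_right, norm_sub_rev z y]
  have h8 : inner ℝ (y - z) u ≤ - (η * s ^ 2) := by
    rw [h6, h7] at h5; linarith
  have h9 : (c : ℝ) = 2 * η := by rw [hη]; ring
  rw [h9, h7]
  nlinarith

/-! ### Typical bodies are smooth -/

theorem exists_abs_supportFn_le (K : ConvexBody V) : ∃ R : ℝ, 0 ≤ R ∧ ∀ u, |supportFn K u| ≤ R * ‖u‖ := by
  obtain ⟨R, hR⟩ := K.isCompact.isBounded.exists_norm_le
  obtain ⟨y₀, hy₀⟩ := K.nonempty
  have hR0 : 0 ≤ R := (norm_nonneg y₀).trans (hR y₀ hy₀)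
  refine ⟨R, hR0, fun u => ?_⟩
  obtain ⟨y, hy, e⟩ := exists_inner_eq_supportFn K u
  rw [← e]
  exact (abs_real_inner_le_norm y u).trans (mul_le_mul_of_nonneg_right (hR y hy) (norm_nonneg u))

theorem exists_lipschitz_supportFn (K : ConvexBody V) :
    ∃ R : ℝ, 0 ≤ R ∧ ∀ u v, |supportFn K u - supportFn K v| ≤ R * ‖u - v‖ := by
  obtain ⟨R, hR0, hR⟩ := exists_abs_supportFn_le K
  refine ⟨R, hR0, fun u v => ?_⟩
  have h1 := supportFn_add_le K v (u - v)
  have h2 := supportFn_add_le K u (v - u)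
  rw [add_sub_cancel] at h1 h2
  have h3 := (abs_le.1 (hR (u - v))).2
  have h4 := (abs_le.1 (hR (v - u))).2
  rw [norm_sub_rev v u] at h4
  rw [abs_le]
  constructor <;> linarith

theorem continuous_supportFn (K : ConvexBody V) : Continuous (supportFn K) := by
  obtain ⟨R, hR0, hR⟩ := exists_lipschitz_supportFn K
  have : LipschitzWith ⟨R, hR0⟩ (supportFn K) := LipschitzWith.of_dist_le_mul fun u v => by
    rw [Real.dist_eq, dist_eq_norm]; exact hR u v
  exact this.continuous

/-- If two normals share a support point, the support function is additive on them. -/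
theorem IsSmooth.of_supportFn_add_lt {K : ConstantWidthOne V}
    (h : ∀ u v : V, ‖u‖ = 1 → ‖v‖ = 1 → u ≠ v →
      supportFn K.1 (u + v) < supportFn K.1 u + supportFn K.1 v) : IsSmooth K := by
  intro u v hu hv e
  by_contra hne
  have h1 := h u v hu hv hne
  have h2 := inner_le_supportFn K.1 (supportPt_mem K.1 u) (u + v)
  rw [inner_add_right, inner_supportPt, e, inner_supportPt] at h2
  linarith

theorem norm_add_lt_two {u v : V} (hu : ‖u‖ = 1) (hv : ‖v‖ = 1) (hne : u ≠ v) : ‖u + v‖ < 2 := by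
  have h1 := parallelogram_law_with_norm ℝ u v
  have h2 : 0 < ‖u - v‖ := norm_pos_iff.2 (sub_ne_zero.2 hne)
  rw [hu, hv] at h1
  nlinarith [norm_nonneg (u + v)]

section FiniteDimensional

variable [FiniteDimensional ℝ V]

/-- The mixture of a body of constant width with a ball. -/
theorem exists_mix (K : ConstantWidthOne V) {δ : ℝ} (h0 : 0 ≤ δ) (h1 : δ ≤ 1) :
    ∃ L : ConstantWidthOne V, supportFn L.1 = fun u => (1 - δ) * supportFn K.1 u + δ / 2 * ‖u‖ := by
  refine exists_constantWidthOne _ (fun c hc u => ?_) (fun u v => ?_) (fun u => ?_)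
  · rw [supportFn_smul _ hc.le, norm_smul, Real.norm_of_nonneg hc.le]; ring
  · have h2 := mul_le_mul_of_nonneg_left (supportFn_add_le K.1 u v) (sub_nonneg.2 h1)
    have h3 := mul_le_mul_of_nonneg_left (norm_add_le u v) (show 0 ≤ δ / 2 by linarith)
    linarith
  · rw [norm_neg, ← K.2.supportFn_add_neg u]; ring

theorem exists_mix_dist_lt (K : ConstantWidthOne V) {ε : ℝ} (hε : 0 < ε) :
    ∃ δ : ℝ, 0 < δ ∧ δ < 1 ∧ ∃ L : ConstantWidthOne V, dist L K < ε ∧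
      supportFn L.1 = fun u => (1 - δ) * supportFn K.1 u + δ / 2 * ‖u‖ := by
  obtain ⟨R, hR0, hR⟩ := exists_abs_supportFn_le K.1
  set δ : ℝ := min (1 / 2) (ε / (2 * (R + 1))) with hδ
  have hδ0 : 0 < δ := lt_min (by norm_num) (by positivity)
  have hδ1 : δ ≤ 1 / 2 := min_le_left _ _
  have hδ2 : δ ≤ ε / (2 * (R + 1)) := min_le_right _ _
  obtain ⟨L, hL⟩ := exists_mix K hδ0.le (by linarith)
  refine ⟨δ, hδ0, by linarith, L, ?_, hL⟩
  have : dist L.1 K.1 ≤ δ * (R + 1) := by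
    refine dist_le_of_abs_supportFn_sub_le _ _ (by positivity) fun u => ?_
    have e : supportFn L.1 u - supportFn K.1 u = δ * (‖u‖ / 2 - supportFn K.1 u) := by
      rw [hL]; ring
    rw [e, abs_mul, abs_of_pos hδ0, mul_assoc]
    refine mul_le_mul_of_nonneg_left ?_ hδ0.le
    have h1 := abs_sub (‖u‖ / 2) (supportFn K.1 u)
    rw [abs_of_nonneg (by positivity : 0 ≤ ‖u‖ / 2)] at h1
    linarith [hR u, norm_nonneg u]
  rw [Subtype.dist_eq]
  have h2 : δ * (R + 1) ≤ ε / 2 := by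
    rw [le_div_iff₀ (by positivity)] at hδ2; linarith
  linarith

/-- The pairs at distance at least `r` form a compact set, so the strict inequality has a margin `m`
there. Passing to another body changes the three terms by at most four times the distance in total.
-/
theorem isOpen_setOf_supportFn_add_lt (r : ℝ) :
    IsOpen {K : ConstantWidthOne V | ∀ u v : V, ‖u‖ = 1 → ‖v‖ = 1 → r ≤ ‖u - v‖ →
      supportFn K.1 (u + v) < supportFn K.1 u + supportFn K.1 v} := by
  rw [Metric.isOpen_iff]
  intro K hK
  set C : Set (V × V) := (Metric.sphere 0 1 ×ˢ Metric.sphere 0 1) ∩ {p | r ≤ ‖p.1 - p.2‖} with hC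
  have hCc : IsCompact C := ((isCompact_sphere 0 1).prod (isCompact_sphere 0 1)).inter_right
    (isClosed_le continuous_const (by fun_prop))
  have hmem : ∀ u v : V, ‖u‖ = 1 → ‖v‖ = 1 → r ≤ ‖u - v‖ → (u, v) ∈ C := by
    intro u v hu hv huv
    exact ⟨⟨by simpa using hu, by simpa using hv⟩, huv⟩
  rcases C.eq_empty_or_nonempty with he | hne
  · refine ⟨1, one_pos, fun L _ u v hu hv huv => ?_⟩
    exact absurd (hmem u v hu hv huv) (by rw [he]; exact Set.notMem_empty _)
  have hcont := continuous_supportFn K.1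
  obtain ⟨⟨u₀, v₀⟩, ⟨⟨hu₀, hv₀⟩, huv₀⟩, hmin⟩ := hCc.exists_isMinOn hne
    (f := fun p => supportFn K.1 p.1 + supportFn K.1 p.2 - supportFn K.1 (p.1 + p.2))
    (by fun_prop)
  set m := supportFn K.1 u₀ + supportFn K.1 v₀ - supportFn K.1 (u₀ + v₀) with hm
  have hm0 : 0 < m := sub_pos.2 (hK u₀ v₀ (by simpa using hu₀) (by simpa using hv₀) huv₀)
  refine ⟨m / 4, by positivity, fun L hL u v hu hv huv => ?_⟩
  have h1 : m ≤ supportFn K.1 u + supportFn K.1 v - supportFn K.1 (u + v) :=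
    hmin (hmem u v hu hv huv)
  rw [Metric.mem_ball, Subtype.dist_eq] at hL
  have h2 := (abs_le.1 (abs_supportFn_sub_le L.1 K.1 u)).1
  have h3 := (abs_le.1 (abs_supportFn_sub_le L.1 K.1 v)).1
  have h4 := (abs_le.1 (abs_supportFn_sub_le L.1 K.1 (u + v))).2
  have h5 : dist L.1 K.1 * ‖u + v‖ ≤ dist L.1 K.1 * 2 := by
    refine mul_le_mul_of_nonneg_left ((norm_add_le u v).trans ?_) dist_nonneg
    rw [hu, hv]; norm_num
  rw [hu] at h2
  rw [hv] at h3
  linarith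

/-- Mixing in a ball adds a multiple of the norm, which is strictly subadditive on distinct unit
vectors; this gives density. The thresholds `1 / (k + 1)` exhaust all pairs of distinct vectors. -/
theorem eventually_residual_isSmooth : ∀ᶠ K in residual (ConstantWidthOne V), IsSmooth K := by
  have key : ∀ k : ℕ, ∀ᶠ K in residual (ConstantWidthOne V),
      ∀ u v : V, ‖u‖ = 1 → ‖v‖ = 1 → 1 / ((k : ℝ) + 1) ≤ ‖u - v‖ →
      supportFn K.1 (u + v) < supportFn K.1 u + supportFn K.1 v := by
    intro k
    refine residual_of_dense_open (isOpen_setOf_supportFn_add_lt _) ?_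
    rw [Metric.dense_iff]
    intro K r hr
    obtain ⟨δ, hδ0, hδ1, L, hLK, hL⟩ := exists_mix_dist_lt K hr
    refine ⟨L, hLK, fun u v hu hv huv => ?_⟩
    have hne : u ≠ v := by
      rintro rfl
      rw [sub_self, norm_zero] at huv
      exact absurd huv (not_le.2 (by positivity))
    have h1 := norm_add_lt_two hu hv hne
    have h2 := mul_le_mul_of_nonneg_left (supportFn_add_le K.1 u v) (sub_nonneg.2 hδ1.le)
    rw [hL]
    simp only [hu, hv]
    nlinarith
  filter_upwards [eventually_countable_forall.2 key] with K hK
  refine IsSmooth.of_supportFn_add_lt fun u v hu hv hne => ?_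
  obtain ⟨k, hk⟩ := exists_nat_one_div_lt (norm_pos_iff.2 (sub_ne_zero.2 hne))
  exact hK k u v hu hv hk.le

end FiniteDimensional

/-! ### Points of continuity of limits of continuous maps -/

/-- Baire's argument for functions of the first class: for each `j` the closed sets `C j m` cover
the space, their frontiers are nowhere dense, and a point outside all frontiers lies in the interior
of some `C j m` for every `j`. -/
theorem eventually_residual_of_cauchy {X : Type*} [TopologicalSpace X] {d : ℕ → ℕ → X → ℝ}
    (hd : ∀ k l, Continuous (d k l))
    (h : ∀ x, ∀ ε > 0, ∃ m, ∀ k ≥ m, ∀ l ≥ m, d k l x ≤ ε) :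
    ∀ᶠ x in residual X, ∀ ε > 0, ∃ m, ∀ᶠ y in 𝓝 x, ∀ k ≥ m, ∀ l ≥ m, d k l y ≤ ε := by
  let C : ℕ → ℕ → Set X := fun j m => {x | ∀ k ≥ m, ∀ l ≥ m, d k l x ≤ 1 / ((j : ℝ) + 1)}
  have hC : ∀ j m, IsClosed (C j m) := fun j m => by
    simp only [C, Set.ofPred_forall]
    exact isClosed_iInter fun k => isClosed_iInter fun _ => isClosed_iInter fun l =>
      isClosed_iInter fun _ => isClosed_le (hd k l) continuous_const
  have key : ∀ j m, ∀ᶠ x in residual X, x ∈ (frontier (C j m))ᶜ := fun j m =>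
    residual_of_dense_open isClosed_frontier.isOpen_compl
      (interior_eq_empty_iff_dense_compl.1 (interior_frontier (hC j m)))
  filter_upwards [eventually_countable_forall.2 fun j => eventually_countable_forall.2 (key j)]
    with x hx ε hε
  obtain ⟨j, hj⟩ := exists_nat_one_div_lt hε
  obtain ⟨m, hm⟩ := h x (1 / ((j : ℝ) + 1)) (by positivity)
  have hint : x ∈ interior (C j m) := by
    by_contra hcon
    refine hx j m ?_
    rw [frontier, (hC j m).closure_eq]
    exact ⟨hm, hcon⟩
  refine ⟨m, ?_⟩
  filter_upwards [mem_interior_iff_mem_nhds.1 hint] with y hy k hk l hl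
  exact (hy k hk l hl).trans hj.le

/-! ### Second differences and second derivatives -/

/-- The second derivative of `f` as a bilinear form. -/
def hess (f : V → ℝ) (u : V) : V →L[ℝ] V →L[ℝ] ℝ := fderiv ℝ (fderiv ℝ f) u

/-- Normalized second differences of `f` in direction `t`. -/
def secondDiff (f : V → ℝ) (t : V) (k : ℕ) (u : V) : ℝ :=
  ((k : ℝ) + 1) ^ 2 * (f (u + ((k : ℝ) + 1)⁻¹ • t) + f (u - ((k : ℝ) + 1)⁻¹ • t) - 2 * f u)

/-- The first derivative is only assumed differentiable at the single point `u`, so the remainder is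
estimated by the mean value inequality for the second difference as a function of the step length.
-/
theorem abs_second_difference_le {f : V → ℝ} {u t : V} {ε : ℝ} (hε : 0 < ε)
    (hf : ∀ᶠ w in 𝓝 u, DifferentiableAt ℝ f w) (hf2 : DifferentiableAt ℝ (fderiv ℝ f) u) :
    ∀ᶠ s in 𝓝[>] (0 : ℝ), |f (u + s • t) + f (u - s • t) - 2 * f u - s ^ 2 * hess f u t t|
      ≤ ε * s ^ 2 := by
  -- The derivative in the step length has two error terms, each at most `ε' * s * (‖t‖ + 1) ^ 2`;
  -- together they make `ε * s`.
  set ε' := ε / (2 * (‖t‖ + 1) ^ 2) with hε'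
  have hε'0 : 0 < ε' := by positivity
  have h1 := (hasFDerivAt_iff_isLittleO.1 hf2.hasFDerivAt).def hε'0
  obtain ⟨r, hr, hball⟩ := Metric.eventually_nhds_iff.1 (h1.and hf)
  have hsmall : ∀ᶠ s in 𝓝[>] (0 : ℝ), s * (‖t‖ + 1) < r := by
    have : Tendsto (fun s : ℝ => s * (‖t‖ + 1)) (𝓝[>] 0) (𝓝 0) := by
      have h : Tendsto (fun s : ℝ => s * (‖t‖ + 1)) (𝓝 0) (𝓝 (0 * (‖t‖ + 1))) :=
        (continuous_id.mul continuous_const).tendsto 0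
      rw [zero_mul] at h
      exact h.mono_left nhdsWithin_le_nhds
    exact this.eventually_lt_const hr
  filter_upwards [hsmall, self_mem_nhdsWithin] with s hs hs0
  have hs0 : 0 < s := hs0
  set φ : ℝ → ℝ := fun σ => f (u + σ • t) + f (u - σ • t) - 2 * f u - σ ^ 2 * hess f u t t with hφ
  set φ' : ℝ → ℝ := fun σ => fderiv ℝ f (u + σ • t) t - fderiv ℝ f (u - σ • t) t
    - 2 * σ * hess f u t t with hφ'
  have hd1 : ∀ σ ∈ Set.Icc 0 s, dist (u + σ • t) u < r ∧ dist (u - σ • t) u < r := by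
    intro σ hσ
    have : ‖σ • t‖ < r := by
      rw [norm_smul, Real.norm_of_nonneg hσ.1]
      have h2 : σ * ‖t‖ ≤ s * (‖t‖ + 1) :=
        mul_le_mul hσ.2 (by linarith) (norm_nonneg _) hs0.le
      linarith
    constructor
    · rwa [dist_eq_norm, add_sub_cancel_left]
    · rwa [dist_eq_norm, sub_sub_cancel_left, norm_neg]
  have hderiv : ∀ σ ∈ Set.Icc 0 s, HasDerivWithinAt φ (φ' σ) (Set.Icc 0 s) σ := by
    intro σ hσ
    have ha : HasDerivAt (fun σ : ℝ => f (u + σ • t)) (fderiv ℝ f (u + σ • t) t) σ := by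
      have := (hball (hd1 σ hσ).1).2.hasFDerivAt
      refine this.comp_hasDerivAt σ ?_
      simpa using ((hasDerivAt_id σ).smul_const t).const_add u
    have hb : HasDerivAt (fun σ : ℝ => f (u - σ • t)) (-fderiv ℝ f (u - σ • t) t) σ := by
      have := (hball (hd1 σ hσ).2).2.hasFDerivAt
      rw [← map_neg]
      refine this.comp_hasDerivAt σ ?_
      simpa using ((hasDerivAt_id σ).smul_const t).const_sub u
    have hc : HasDerivAt (fun σ : ℝ => σ ^ 2 * hess f u t t) (2 * σ * hess f u t t) σ := by
      simpa using (hasDerivAt_pow 2 σ).mul_const (hess f u t t)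
    have := ((ha.add hb).sub_const (2 * f u)).sub hc
    rw [← sub_eq_add_neg] at this
    exact this.hasDerivWithinAt
  have hbound : ∀ σ ∈ Set.Icc 0 s, ‖φ' σ‖ ≤ ε * s := by
    intro σ hσ
    have e1 := (hball (hd1 σ hσ).1).1
    have e2 := (hball (hd1 σ hσ).2).1
    rw [add_sub_cancel_left] at e1
    rw [sub_sub_cancel_left, norm_neg] at e2
    set P := fderiv ℝ f (u + σ • t) - fderiv ℝ f u - fderiv ℝ (fderiv ℝ f) u (σ • t)
    set N := fderiv ℝ f (u - σ • t) - fderiv ℝ f u - fderiv ℝ (fderiv ℝ f) u (-(σ • t))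
    have e : φ' σ = P t - N t := by
      simp only [hφ', P, N, hess, map_neg, map_smul, sub_apply,
        neg_apply, smul_apply, smul_eq_mul]
      ring
    have hn : ‖σ • t‖ ≤ s * (‖t‖ + 1) := by
      rw [norm_smul, Real.norm_of_nonneg hσ.1]
      exact mul_le_mul hσ.2 (by linarith) (norm_nonneg _) hs0.le
    have hP : ‖P t‖ ≤ ε' * (s * (‖t‖ + 1)) * (‖t‖ + 1) := by
      refine (P.le_opNorm t).trans ?_
      exact mul_le_mul (e1.trans (mul_le_mul_of_nonneg_left hn hε'0.le)) (by linarith)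
        (norm_nonneg _) (by positivity)
    have hN : ‖N t‖ ≤ ε' * (s * (‖t‖ + 1)) * (‖t‖ + 1) := by
      refine (N.le_opNorm t).trans ?_
      exact mul_le_mul (e2.trans (mul_le_mul_of_nonneg_left hn hε'0.le)) (by linarith)
        (norm_nonneg _) (by positivity)
    rw [e]
    refine (norm_sub_le _ _).trans ((add_le_add hP hN).trans (le_of_eq ?_))
    rw [hε']
    field_simp
    ring
  have := (convex_Icc 0 s).norm_image_sub_le_of_norm_hasDerivWithin_le hderiv hbound
    (Set.left_mem_Icc.2 hs0.le) (Set.right_mem_Icc.2 hs0.le)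
  have h0 : φ 0 = 0 := by simp [hφ]; ring
  rw [h0, sub_zero, sub_zero, Real.norm_of_nonneg hs0.le, Real.norm_eq_abs] at this
  calc _ = |φ s| := rfl
    _ ≤ ε * s * s := this
    _ = ε * s ^ 2 := by ring

theorem tendsto_secondDiff {f : V → ℝ} {u : V} (t : V)
    (hf : ∀ᶠ w in 𝓝 u, DifferentiableAt ℝ f w) (hf2 : DifferentiableAt ℝ (fderiv ℝ f) u) :
    Tendsto (fun k => secondDiff f t k u) atTop (𝓝 (hess f u t t)) := by
  rw [Metric.tendsto_atTop']
  intro ε hε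
  have h1 := abs_second_difference_le (t := t) (half_pos hε) hf hf2
  have h2 : Tendsto (fun k : ℕ => ((k : ℝ) + 1)⁻¹) atTop (𝓝[>] 0) := by
    rw [tendsto_nhdsWithin_iff]
    refine ⟨?_, Eventually.of_forall fun k => by simp only [Set.mem_Ioi]; positivity⟩
    simpa using tendsto_one_div_add_atTop_nhds_zero_nat (𝕜 := ℝ)
  obtain ⟨m, hm⟩ := eventually_atTop.1 (h2.eventually h1)
  refine ⟨m, fun k hk => ?_⟩
  have h3 := hm k hk.le
  have hp : (0 : ℝ) < (k : ℝ) + 1 := by positivity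
  rw [Real.dist_eq]
  have e : secondDiff f t k u - hess f u t t = ((k : ℝ) + 1) ^ 2 *
      (f (u + ((k : ℝ) + 1)⁻¹ • t) + f (u - ((k : ℝ) + 1)⁻¹ • t) - 2 * f u
        - ((k : ℝ) + 1)⁻¹ ^ 2 * hess f u t t) := by
    rw [secondDiff]; field_simp
  rw [e, abs_mul, abs_of_pos (by positivity)]
  calc _ ≤ ((k : ℝ) + 1) ^ 2 * (ε / 2 * ((k : ℝ) + 1)⁻¹ ^ 2) := by gcongr
    _ = ε / 2 := by field_simp
    _ < ε := by linarith

/-! ### Second derivatives of support functions -/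

theorem norm_add_norm_sub_le (u v : V) (hu : u ≠ 0) :
    ‖u + v‖ + ‖u - v‖ - 2 * ‖u‖ ≤ ‖v‖ ^ 2 / ‖u‖ := by
  have hp : 0 < ‖u‖ := norm_pos_iff.2 hu
  have h1 := parallelogram_law_with_norm ℝ u v
  have h2 : (‖u + v‖ + ‖u - v‖) ^ 2 ≤ (2 * ‖u‖ + ‖v‖ ^ 2 / ‖u‖) ^ 2 := by
    have e : (2 * ‖u‖ + ‖v‖ ^ 2 / ‖u‖) ^ 2
        = 4 * ‖u‖ ^ 2 + 4 * ‖v‖ ^ 2 + (‖v‖ ^ 2 / ‖u‖) ^ 2 := by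
      field_simp
      ring
    rw [e]
    nlinarith [sq_nonneg (‖u + v‖ - ‖u - v‖), sq_nonneg (‖v‖ ^ 2 / ‖u‖)]
  have h3 := le_of_sq_le_sq h2 (by positivity)
  linarith

theorem secondDiff_nonneg (K : ConvexBody V) (t : V) (k : ℕ) (u : V) :
    0 ≤ secondDiff (supportFn K) t k u := by
  refine mul_nonneg (by positivity) ?_
  have h1 := supportFn_add_le K (u + ((k : ℝ) + 1)⁻¹ • t) (u - ((k : ℝ) + 1)⁻¹ • t)
  rw [add_add_sub_cancel, ← two_smul ℝ u, supportFn_smul K zero_le_two] at h1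
  linarith

/-- The second differences at `u` and `-u` add up to that of the norm, and the one at `-u` is
nonnegative. -/
theorem secondDiff_le (K : ConstantWidthOne V) (t : V) (k : ℕ) {u : V} (hu : u ≠ 0) :
    secondDiff (supportFn K.1) t k u ≤ ‖t‖ ^ 2 / ‖u‖ := by
  have h1 := secondDiff_nonneg K.1 t k (-u)
  have h2 := norm_add_norm_sub_le u (((k : ℝ) + 1)⁻¹ • t) hu
  have e1 := K.2.supportFn_add_neg (u + ((k : ℝ) + 1)⁻¹ • t)
  have e2 := K.2.supportFn_add_neg (u - ((k : ℝ) + 1)⁻¹ • t)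
  have e3 := K.2.supportFn_add_neg u
  rw [neg_add, ← sub_eq_add_neg] at e1
  rw [neg_sub', sub_neg_eq_add] at e2
  have e4 : secondDiff (supportFn K.1) t k u + secondDiff (supportFn K.1) t k (-u)
      = ((k : ℝ) + 1) ^ 2 * (‖u + ((k : ℝ) + 1)⁻¹ • t‖ + ‖u - ((k : ℝ) + 1)⁻¹ • t‖ - 2 * ‖u‖) := by
    rw [secondDiff, secondDiff, ← e1, ← e2, ← e3]
    ring
  have h3 := mul_le_mul_of_nonneg_left h2 (sq_nonneg ((k : ℝ) + 1))
  rw [← e4, norm_smul, Real.norm_of_nonneg (by positivity)] at h3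
  have e5 : ((k : ℝ) + 1) ^ 2 * ((((k : ℝ) + 1)⁻¹ * ‖t‖) ^ 2 / ‖u‖) = ‖t‖ ^ 2 / ‖u‖ := by
    field_simp
  linarith

theorem eventually_differentiableAt_supportFn (K : ConstantWidthOne V) {u : V} (hu : u ≠ 0) :
    ∀ᶠ w in 𝓝 u, DifferentiableAt ℝ (supportFn K.1) w := by
  filter_upwards [isOpen_ne.mem_nhds hu] with w hw
  exact (hasFDerivAt_supportFn K hw).differentiableAt

/-- The closed annulus of radii `1` and `2`. -/
def annulus (V : Type*) [NormedAddCommGroup V] : Set V := {u | 1 ≤ ‖u‖ ∧ ‖u‖ ≤ 2}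

theorem ne_zero_of_mem_annulus {V : Type*} [NormedAddCommGroup V] {u : V} (hu : u ∈ annulus V) : u ≠ 0 :=
  norm_pos_iff.1 (one_pos.trans_le hu.1)

theorem isClosed_annulus {V : Type*} [NormedAddCommGroup V] : IsClosed (annulus V) :=
  (isClosed_le continuous_const continuous_norm).inter
    (isClosed_le continuous_norm continuous_const)

/-- For each fixed `k` the second difference is Lipschitz in the body. The constant grows like `k²`,
so continuity in the body does not pass to the second derivative everywhere. -/
theorem abs_secondDiff_sub_le (K L : ConvexBody V) (t : V) (k : ℕ) {u : V} (hu : u ∈ annulus V) :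
    |secondDiff (supportFn K) t k u - secondDiff (supportFn L) t k u|
      ≤ ((k : ℝ) + 1) ^ 2 * (8 + 2 * ‖t‖) * dist K L := by
  have hp : (0 : ℝ) < (k : ℝ) + 1 := by positivity
  set τ := ((k : ℝ) + 1)⁻¹ • t with hτ
  have hτn : ‖τ‖ ≤ ‖t‖ := by
    rw [hτ, norm_smul, Real.norm_of_nonneg (by positivity)]
    refine mul_le_of_le_one_left (norm_nonneg _) (inv_le_one_of_one_le₀ ?_)
    linarith [(Nat.cast_nonneg k : (0 : ℝ) ≤ k)]
  have h1 := abs_supportFn_sub_le K L (u + τ)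
  have h2 := abs_supportFn_sub_le K L (u - τ)
  have h3 := abs_supportFn_sub_le K L u
  have hd : 0 ≤ dist K L := dist_nonneg
  have h4 : dist K L * ‖u + τ‖ ≤ dist K L * (2 + ‖t‖) :=
    mul_le_mul_of_nonneg_left ((norm_add_le _ _).trans (add_le_add hu.2 hτn)) hd
  have h5 : dist K L * ‖u - τ‖ ≤ dist K L * (2 + ‖t‖) :=
    mul_le_mul_of_nonneg_left ((norm_sub_le _ _).trans (add_le_add hu.2 hτn)) hd
  have h6 : dist K L * ‖u‖ ≤ dist K L * 2 := mul_le_mul_of_nonneg_left hu.2 hd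
  rw [secondDiff, secondDiff, ← mul_sub, abs_mul, abs_of_pos (by positivity), mul_assoc]
  refine mul_le_mul_of_nonneg_left ?_ (by positivity)
  rw [abs_le] at *
  constructor <;> linarith [h1.1, h1.2, h2.1, h2.2, h3.1, h3.2]

theorem continuous_secondDiff (K : ConvexBody V) (t : V) (k : ℕ) :
    Continuous (secondDiff (supportFn K) t k) := by
  have := continuous_supportFn K
  unfold secondDiff
  fun_prop

section Measure

variable [FiniteDimensional ℝ V] [MeasurableSpace V] [BorelSpace V]

omit [MeasurableSpace V] [BorelSpace V] in
theorem isCompact_annulus : IsCompact (annulus V) :=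
  (isCompact_closedBall (0 : V) 2).of_isClosed_subset isClosed_annulus fun u hu => by
    rw [mem_closedBall_zero_iff]; exact hu.2

instance isFiniteMeasure_restrict_annulus :
    IsFiniteMeasure ((volume : Measure V).restrict (annulus V)) :=
  isFiniteMeasure_restrict.2 isCompact_annulus.measure_lt_top.ne

theorem ae_restrict_annulus_mem :
    ∀ᵐ u ∂((volume : Measure V).restrict (annulus V)), u ∈ annulus V :=
  ae_restrict_mem isClosed_annulus.measurableSet

theorem ae_differentiableAt_supportPt (K : ConstantWidthOne V) :
    ∀ᵐ u ∂((volume : Measure V).restrict (annulus V)), DifferentiableAt ℝ (supportPt K.1) u := by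
  have h1 := (lipschitzOnWith_supportPt K).ae_differentiableWithinAt_of_mem (μ := volume)
  filter_upwards [ae_restrict_of_ae h1, ae_restrict_annulus_mem] with u hu hu2
  have hmem : (1 / 2 : ℝ) < ‖u‖ := by linarith [hu2.1]
  exact (hu hmem).differentiableAt
    ((isOpen_lt continuous_const continuous_norm).mem_nhds hmem)

omit [FiniteDimensional ℝ V] [MeasurableSpace V] [BorelSpace V] in
theorem hasFDerivAt_fderiv_supportFn (K : ConstantWidthOne V) {u : V} (hu : u ≠ 0) {A : V →L[ℝ] V}
    (h : HasFDerivAt (supportPt K.1) A u) :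
    HasFDerivAt (fderiv ℝ (supportFn K.1)) ((innerSL ℝ).comp A) u := by
  have h1 : HasFDerivAt (fun w => innerSL ℝ (supportPt K.1 w)) ((innerSL ℝ).comp A) u :=
    (innerSL ℝ).hasFDerivAt.comp u h
  refine h1.congr_of_eventuallyEq ?_
  filter_upwards [isOpen_ne.mem_nhds hu] with w hw
  exact fderiv_supportFn K hw

omit [FiniteDimensional ℝ V] [MeasurableSpace V] [BorelSpace V] in
theorem hess_supportFn (K : ConstantWidthOne V) {u : V} (hu : u ≠ 0) {A : V →L[ℝ] V}
    (h : HasFDerivAt (supportPt K.1) A u) (s t : V) :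
    hess (supportFn K.1) u s t = inner ℝ (A s) t := by
  rw [hess, (hasFDerivAt_fderiv_supportFn K hu h).fderiv]
  rfl

theorem ae_differentiableAt_fderiv_supportFn (K : ConstantWidthOne V) :
    ∀ᵐ u ∂((volume : Measure V).restrict (annulus V)),
      DifferentiableAt ℝ (fderiv ℝ (supportFn K.1)) u := by
  filter_upwards [ae_differentiableAt_supportPt K, ae_restrict_annulus_mem] with u hu hu2
  exact (hasFDerivAt_fderiv_supportFn K (ne_zero_of_mem_annulus hu2)
    hu.hasFDerivAt).differentiableAt

theorem ae_tendsto_secondDiff (K : ConstantWidthOne V) (t : V) :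
    ∀ᵐ u ∂((volume : Measure V).restrict (annulus V)),
      Tendsto (fun k => secondDiff (supportFn K.1) t k u) atTop (𝓝 (hess (supportFn K.1) u t t)) := by
  filter_upwards [ae_differentiableAt_fderiv_supportFn K, ae_restrict_annulus_mem] with u hu hu2
  exact tendsto_secondDiff t (eventually_differentiableAt_supportFn K (ne_zero_of_mem_annulus hu2)) hu

theorem integrable_secondDiff (K : ConvexBody V) (t : V) (k : ℕ) :
    Integrable (secondDiff (supportFn K) t k) (volume.restrict (annulus V)) :=
  (continuous_secondDiff K t k).continuousOn.integrableOn_compact isCompact_annulus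

omit [FiniteDimensional ℝ V] [MeasurableSpace V] [BorelSpace V] in
theorem abs_secondDiff_le (K : ConstantWidthOne V) (t : V) (k : ℕ) {u : V} (hu : u ∈ annulus V) :
    |secondDiff (supportFn K.1) t k u| ≤ ‖t‖ ^ 2 := by
  rw [abs_of_nonneg (secondDiff_nonneg K.1 t k u)]
  exact (secondDiff_le K t k (ne_zero_of_mem_annulus hu)).trans (div_le_self (by positivity) hu.1)

theorem integrable_hess (K : ConstantWidthOne V) (t : V) :
    Integrable (fun u => hess (supportFn K.1) u t t) (volume.restrict (annulus V)) := by
  refine Integrable.of_bound (C := ‖t‖ ^ 2) ?_ ?_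
  · exact aestronglyMeasurable_of_tendsto_ae atTop
      (fun k => (integrable_secondDiff K.1 t k).aestronglyMeasurable) (ae_tendsto_secondDiff K t)
  · filter_upwards [ae_tendsto_secondDiff K t, ae_restrict_annulus_mem] with u hu hu2
    exact le_of_tendsto hu.norm (Eventually.of_forall fun k => abs_secondDiff_le K t k hu2)

theorem tendsto_integral_abs_secondDiff_sub (K : ConstantWidthOne V) (t : V) {g : V → ℝ}
    (hg : Integrable g (volume.restrict (annulus V))) :
    Tendsto (fun k => ∫ u in annulus V, |g u - secondDiff (supportFn K.1) t k u|) atTop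
      (𝓝 (∫ u in annulus V, |g u - hess (supportFn K.1) u t t|)) := by
  refine tendsto_integral_of_dominated_convergence (fun u => |g u| + ‖t‖ ^ 2) (fun k => ?_) ?_
    (fun k => ?_) ?_
  · exact (hg.sub (integrable_secondDiff K.1 t k)).abs.aestronglyMeasurable
  · exact hg.abs.add (integrable_const _)
  · filter_upwards [ae_restrict_annulus_mem] with u hu
    rw [Real.norm_eq_abs, abs_abs]
    exact (abs_sub _ _).trans (add_le_add le_rfl (abs_secondDiff_le K t k hu))
  · filter_upwards [ae_tendsto_secondDiff K t] with u hu
    exact (hu.const_sub (g u)).abs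

theorem integral_abs_secondDiff_sub_le (K L : ConstantWidthOne V) (t : V) (k : ℕ) :
    ∫ u in annulus V, |secondDiff (supportFn K.1) t k u - secondDiff (supportFn L.1) t k u|
      ≤ volume.real (annulus V) * (((k : ℝ) + 1) ^ 2 * (8 + 2 * ‖t‖)) * dist K L := by
  have h1 : ∫ u in annulus V, |secondDiff (supportFn K.1) t k u - secondDiff (supportFn L.1) t k u|
      ≤ ∫ _u in annulus V, ((k : ℝ) + 1) ^ 2 * (8 + 2 * ‖t‖) * dist K L := by
    refine integral_mono_ae ?_ (integrable_const _) ?_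
    · exact ((integrable_secondDiff K.1 t k).sub (integrable_secondDiff L.1 t k)).abs
    · filter_upwards [ae_restrict_annulus_mem] with u hu
      exact abs_secondDiff_sub_le K.1 L.1 t k hu
  rw [setIntegral_const, smul_eq_mul] at h1
  linarith

/-- For a typical body `K`, the map that assigns to a body of constant width the second derivative
in direction `t` of its support function, considered as a map to `L¹`, is continuous at `K`. -/
theorem eventually_residual_continuousAt_hess (t : V) :
    ∀ᶠ K in residual (ConstantWidthOne V), ∀ ε > 0, ∃ η > 0, ∀ K₁ K₂ : ConstantWidthOne V,
      dist K₁ K < η → dist K₂ K < η →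
      ∫ u in annulus V, |hess (supportFn K₁.1) u t t - hess (supportFn K₂.1) u t t| ≤ ε := by
  let d : ℕ → ℕ → ConstantWidthOne V → ℝ := fun k l K =>
    ∫ u in annulus V, |secondDiff (supportFn K.1) t k u - secondDiff (supportFn K.1) t l u|
  have htri : ∀ f g p q : V → ℝ, Integrable f (volume.restrict (annulus V)) →
      Integrable g (volume.restrict (annulus V)) → Integrable p (volume.restrict (annulus V)) →
      Integrable q (volume.restrict (annulus V)) →
      ∫ u in annulus V, |f u - g u| ≤ (∫ u in annulus V, |f u - p u|)
        + (∫ u in annulus V, |p u - q u|) + ∫ u in annulus V, |q u - g u| := by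
    intro f g p q hf hg hp hq
    have habs : ∀ f g : V → ℝ, Integrable f (volume.restrict (annulus V)) →
        Integrable g (volume.restrict (annulus V)) →
        Integrable (fun u => |f u - g u|) (volume.restrict (annulus V)) :=
      fun f g hf hg => (hf.sub hg).abs
    have h2 : Integrable (fun u => |f u - p u| + |p u - q u|) (volume.restrict (annulus V)) :=
      (habs f p hf hp).add (habs p q hp hq)
    rw [← integral_add (habs f p hf hp) (habs p q hp hq), ← integral_add h2 (habs q g hq hg)]
    refine integral_mono (habs f g hf hg) (h2.add (habs q g hq hg)) fun u => ?_
    calc |f u - g u| = |(f u - p u) + (p u - q u) + (q u - g u)| := by ring_nf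
      _ ≤ _ := abs_add_three _ _ _
  have hI := fun (K : ConstantWidthOne V) k => integrable_secondDiff K.1 t k
  have hcomm : ∀ f g : V → ℝ, ∫ u in annulus V, |f u - g u| = ∫ u in annulus V, |g u - f u| :=
    fun f g => by simp only [abs_sub_comm]
  have hd : ∀ k l, Continuous (d k l) := by
    intro k l
    set C := volume.real (annulus V) * (((k : ℝ) + 1) ^ 2 * (8 + 2 * ‖t‖))
      + volume.real (annulus V) * (((l : ℝ) + 1) ^ 2 * (8 + 2 * ‖t‖)) with hC
    have hC0 : 0 ≤ C := by positivity
    have hle : ∀ K L, d k l K ≤ d k l L + C * dist K L := by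
      intro K L
      have h1 := htri _ _ _ _ (hI K k) (hI K l) (hI L k) (hI L l)
      have h2 := integral_abs_secondDiff_sub_le K L t k
      have h3 := integral_abs_secondDiff_sub_le L K t l
      rw [dist_comm] at h3
      simp only [d]
      rw [hC, add_mul]
      linarith
    have : LipschitzWith ⟨C, hC0⟩ (d k l) := LipschitzWith.of_dist_le_mul fun K L => by
      rw [Real.dist_eq, abs_le]
      have h1 := hle K L
      have h2 := hle L K
      rw [dist_comm] at h2
      change -(C * dist K L) ≤ _ ∧ _ ≤ C * dist K L
      constructor <;> linarith
    exact this.continuous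
  have hcauchy : ∀ K, ∀ ε > 0, ∃ m, ∀ k ≥ m, ∀ l ≥ m, d k l K ≤ ε := by
    intro K ε hε
    have h1 := tendsto_integral_abs_secondDiff_sub K t (integrable_hess K t)
    simp only [sub_self, abs_zero, integral_zero] at h1
    obtain ⟨m, hm⟩ := eventually_atTop.1 (h1.eventually_lt_const (half_pos hε))
    refine ⟨m, fun k hk l hl => ?_⟩
    have h2 := htri _ _ _ _ (hI K k) (hI K l) (integrable_hess K t) (integrable_hess K t)
    simp only [sub_self, abs_zero, integral_zero] at h2
    have h3 := hm k hk
    have h4 := hm l hl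
    rw [hcomm] at h3
    change ∫ u in annulus V, |_| ≤ _
    linarith
  filter_upwards [eventually_residual_of_cauchy hd hcauchy] with K hK ε hε
  obtain ⟨m, hm⟩ := hK (ε / 4) (by positivity)
  obtain ⟨r, hr, hball⟩ := Metric.eventually_nhds_iff.1 hm
  set C := volume.real (annulus V) * (((m : ℝ) + 1) ^ 2 * (8 + 2 * ‖t‖)) with hC
  have hC0 : 0 ≤ C := by positivity
  refine ⟨min r (ε / (4 * (C + 1))), by positivity, fun K₁ K₂ h₁ h₂ => ?_⟩
  -- Near `K` the Cauchy estimate from index `m` on is uniform, so letting `l` tend to infinity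
  -- compares the second derivative with the `m`-th second difference. The final bound is `ε / 4 + ε
  -- / 2 + ε / 4`.
  have hlim : ∀ L : ConstantWidthOne V, dist L K < r →
      ∫ u in annulus V, |secondDiff (supportFn L.1) t m u - hess (supportFn L.1) u t t| ≤ ε / 4 :=
    fun L hL => le_of_tendsto (tendsto_integral_abs_secondDiff_sub L t (hI L m))
      (eventually_atTop.2 ⟨m, fun l hl => hball hL m le_rfl l hl⟩)
  have h3 := hlim K₁ (h₁.trans_le (min_le_left _ _))
  have h4 := hlim K₂ (h₂.trans_le (min_le_left _ _))
  have h5 := integral_abs_secondDiff_sub_le K₁ K₂ t m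
  have h6 : C * dist K₁ K₂ ≤ ε / 2 := by
    have h7 : dist K₁ K₂ ≤ 2 * (ε / (4 * (C + 1))) := by
      have := dist_triangle_right K₁ K₂ K
      linarith [h₁.trans_le (min_le_right _ _), h₂.trans_le (min_le_right _ _)]
    calc C * dist K₁ K₂ ≤ (C + 1) * (2 * (ε / (4 * (C + 1)))) := by gcongr; linarith
      _ = ε / 2 := by field_simp; norm_num
  have h8 := htri _ _ _ _ (integrable_hess K₁ t) (integrable_hess K₂ t) (hI K₁ m) (hI K₂ m)
  rw [hcomm] at h3
  linarith

end Measure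

/-! ### Smoothing support functions -/

section Smoothing

open scoped ContDiff

variable [FiniteDimensional ℝ V] [MeasurableSpace V] [BorelSpace V]

/-- Existence of radially symmetric smooth mollifiers. -/
theorem exists_radial_mollifier {ε : ℝ} (hε : 0 < ε) : ∃ φ : V → ℝ, ContDiff ℝ ∞ φ ∧
    HasCompactSupport φ ∧ (∀ z, 0 ≤ φ z) ∧ (∀ z, ε < ‖z‖ → φ z = 0) ∧
    (∀ z w, ‖z‖ = ‖w‖ → φ z = φ w) ∧ ∫ z, φ z = 1 := by
  set g : V → ℝ := fun z => expNegInvGlue (ε ^ 2 - ‖z‖ ^ 2) with hg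
  have hgs : ContDiff ℝ ∞ g :=
    expNegInvGlue.contDiff.comp (contDiff_const.sub (contDiff_norm_sq ℝ))
  have hg0 : ∀ z, 0 ≤ g z := fun z => expNegInvGlue.nonneg _
  have hgz : ∀ z, ε < ‖z‖ → g z = 0 := fun z hz => by
    refine expNegInvGlue.zero_of_nonpos ?_
    nlinarith
  have hgc : HasCompactSupport g := HasCompactSupport.intro (isCompact_closedBall (0 : V) ε)
    fun z hz => hgz z (by simpa using hz)
  have hgr : ∀ z w, ‖z‖ = ‖w‖ → g z = g w := fun z w h => by simp only [hg, h]
  have hpos : 0 < ∫ z, g z := by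
    refine hgs.continuous.integral_pos_of_hasCompactSupport_nonneg_nonzero hgc hg0 (x := 0) ?_
    exact (expNegInvGlue.pos_of_pos (by simp; positivity)).ne'
  refine ⟨fun z => g z / ∫ z, g z, hgs.div_const _, ?_, fun z => by positivity [hg0 z], ?_, ?_, ?_⟩
  · simp only [div_eq_mul_inv]
    exact hgc.mul_right
  · intro z hz
    simp only [hgz z hz, zero_div]
  · intro z w h
    simp only [hgr z w h]
  · rw [integral_div, div_self hpos.ne']

/-- The support function is averaged over a ball around `u` of radius proportional to `‖u‖`, which
preserves homogeneity. Radial symmetry of the mollifier turns the width into a constant `c` close to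
1, and division by `c` restores width 1. -/
theorem exists_smooth_approximation [Nontrivial V] (K : ConstantWidthOne V) {ε : ℝ} (hε : 0 < ε) :
    ∃ L : ConstantWidthOne V, dist L K < ε ∧ ContDiffOn ℝ ∞ (supportFn L.1) {0}ᶜ := by
  obtain ⟨R, hR0, hR⟩ := exists_lipschitz_supportFn K.1
  set h := supportFn K.1 with hh
  have hcont : Continuous h := continuous_supportFn K.1
  have h00 : h 0 = 0 := by simpa using supportFn_smul K.1 le_rfl (0 : V)
  set η : ℝ := min (1 / 2) (ε / (8 * (R + 1))) with hη
  have hη0 : 0 < η := lt_min (by norm_num) (by positivity)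
  have hη1 : η ≤ 1 / 2 := min_le_left _ _
  have hη2 : η ≤ ε / (8 * (R + 1)) := min_le_right _ _
  obtain ⟨φ, hφs, hφc, hφ0, hφz, hφr, hφ1⟩ := exists_radial_mollifier (V := V) hη0
  have hφn : ∀ z, φ (-z) = φ z := fun z => hφr _ _ (norm_neg z)
  have hint : ∀ f : V → ℝ, Continuous f → Integrable (fun z => f z * φ z) := fun f hf =>
    (hf.mul hφs.continuous).integrable_of_hasCompactSupport hφc.mul_left
  have hmono : ∀ f g : V → ℝ, Continuous f → Continuous g → (∀ z, ‖z‖ ≤ η → f z ≤ g z) →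
      ∫ z, f z * φ z ≤ ∫ z, g z * φ z := by
    intro f g hf hg hfg
    refine integral_mono (hint f hf) (hint g hg) fun z => ?_
    rcases le_or_gt ‖z‖ η with hz | hz
    · exact mul_le_mul_of_nonneg_right (hfg z hz) (hφ0 z)
    · simp only [hφz z hz, mul_zero, le_refl]
  have hconst : ∀ c : ℝ, ∫ z, c * φ z = c := fun c => by rw [integral_const_mul, hφ1, mul_one]
  set T : V → ℝ := fun u => ∫ z, h (u + ‖u‖ • z) * φ z with hT
  have hTsmul : ∀ c : ℝ, 0 < c → ∀ u, T (c • u) = c * T u := by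
    intro c hc u
    rw [hT]
    simp only
    rw [← integral_const_mul]
    congr 1
    funext z
    rw [norm_smul, Real.norm_of_nonneg hc.le, mul_smul, ← smul_add, hh, supportFn_smul _ hc.le,
      mul_assoc]
  -- Averages of a convex function against an even weight grow with the radius: `w + s z` is the
  -- combination of `w + t z` and `w - t z` with weights `a` and `b`.
  have hshift : ∀ (w : V) (s t : ℝ), 0 ≤ s → s ≤ t →
      ∫ z, h (w + s • z) * φ z ≤ ∫ z, h (w + t • z) * φ z := by
    intro w s t hs hst
    rcases hst.eq_or_lt with rfl | hlt
    · exact le_rfl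
    have ht : 0 < t := hs.trans_lt hlt
    have e1 : ∫ z, h (w + t • z) * φ z = ∫ z, h (w - t • z) * φ z := by
      rw [← integral_neg_eq_self]
      congr 1
      funext z
      rw [hφn, smul_neg, sub_eq_add_neg]
    set a := (1 + s / t) / 2
    set b := (1 - s / t) / 2
    have hst1 : s / t ≤ 1 := (div_le_one ht).2 hst
    have hst0 : 0 ≤ s / t := div_nonneg hs ht.le
    have ha : 0 ≤ a := by positivity
    have hb : 0 ≤ b := div_nonneg (by linarith) zero_le_two
    have h1 : ∫ z, h (w + s • z) * φ z
        ≤ ∫ z, (a * h (w + t • z) + b * h (w - t • z)) * φ z := by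
      refine hmono _ _ (by fun_prop) (by fun_prop) fun z _ => ?_
      have h2 := supportFn_add_le K.1 (a • (w + t • z)) (b • (w - t • z))
      rw [supportFn_smul _ ha, supportFn_smul _ hb] at h2
      have e : a • (w + t • z) + b • (w - t • z) = w + s • z := by
        have e3 : a + b = 1 := by simp only [a, b]; ring
        have e4 : a * t - b * t = s := by simp only [a, b]; field_simp; ring
        calc _ = (a + b) • w + (a * t - b * t) • z := by module
          _ = _ := by rw [e3, e4, one_smul]
      rwa [e] at h2
    have e2 : ∫ z, (a * h (w + t • z) + b * h (w - t • z)) * φ z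
        = a * (∫ z, h (w + t • z) * φ z) + b * ∫ z, h (w - t • z) * φ z := by
      rw [← integral_const_mul, ← integral_const_mul, ← integral_add
        ((hint (fun z => h (w + t • z)) (by fun_prop)).const_mul a)
        ((hint (fun z => h (w - t • z)) (by fun_prop)).const_mul b)]
      congr 1
      funext z
      ring
    rw [e2, ← e1, ← add_mul, show a + b = 1 by simp only [a, b]; ring, one_mul] at h1
    exact h1
  have hTadd : ∀ u v, T (u + v) ≤ T u + T v := by
    intro u v
    -- The averaging radius at `u + v` is `‖u + v‖`, not `‖u‖ + ‖v‖`; monotonicity in the radius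
    -- makes up for this.
    refine (hshift (u + v) ‖u + v‖ (‖u‖ + ‖v‖) (norm_nonneg _) (norm_add_le u v)).trans ?_
    rw [hT]
    simp only
    rw [← integral_add (hint (fun z => h (u + ‖u‖ • z)) (by fun_prop))
      (hint (fun z => h (v + ‖v‖ • z)) (by fun_prop))]
    simp only [← add_mul]
    refine hmono _ _ (by fun_prop) (by fun_prop) fun z _ => ?_
    have := supportFn_add_le K.1 (u + ‖u‖ • z) (v + ‖v‖ • z)
    convert this using 2
    module
  obtain ⟨e, he⟩ := exists_norm_eq V (zero_le_one (α := ℝ))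
  set c : ℝ := ∫ z, ‖e + z‖ * φ z with hc
  have hrot : ∀ v : V, ‖v‖ = 1 → ∫ z, ‖v + z‖ * φ z = c := by
    intro v hv
    -- This reflection takes `e` to `v` and preserves both the volume and `φ`, so the integral is
    -- the same for all unit vectors.
    set ρ := (ℝ ∙ (e - v))ᗮ.reflection
    have hρ : ρ e = v := Submodule.reflection_sub (he.trans hv.symm)
    rw [hc, ← (ρ.measurePreserving).integral_comp ρ.toHomeomorph.measurableEmbedding]
    congr 1
    funext z
    rw [← hρ, ← map_add, ρ.norm_map, hφr (ρ z) z (ρ.norm_map z)]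
  have hTneg : ∀ u, T u + T (-u) = c * ‖u‖ := by
    intro u
    have e1 : T (-u) = ∫ z, h (-(u + ‖u‖ • z)) * φ z := by
      rw [hT]
      simp only
      rw [← integral_neg_eq_self]
      congr 1
      funext z
      rw [hφn, norm_neg, smul_neg, neg_add]
    have e2 : T u + T (-u) = ∫ z, ‖u + ‖u‖ • z‖ * φ z := by
      rw [e1, hT]
      simp only
      rw [← integral_add (hint (fun z => h (u + ‖u‖ • z)) (by fun_prop))
        (hint (fun z => h (-(u + ‖u‖ • z))) (by fun_prop))]
      simp only [← add_mul, hh, K.2.supportFn_add_neg]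
    rw [e2]
    rcases eq_or_ne u 0 with rfl | hu
    · simp
    · have hp : 0 < ‖u‖ := norm_pos_iff.2 hu
      rw [← hrot (‖u‖⁻¹ • u) (norm_smul_inv_norm hu), mul_comm, ← integral_const_mul]
      congr 1
      funext z
      rw [← mul_assoc]
      congr 1
      rw [← norm_norm u, ← norm_smul, norm_norm, smul_add, smul_smul, mul_inv_cancel₀ hp.ne', one_smul]
  have hTclose : ∀ u, |T u - h u| ≤ R * η * ‖u‖ := by
    intro u
    have hup : T u ≤ h u + R * η * ‖u‖ := by
      rw [← hconst (h u + R * η * ‖u‖)]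
      refine hmono _ _ (by fun_prop) continuous_const fun z hz => ?_
      have h1 := (abs_le.1 (hR (u + ‖u‖ • z) u)).2
      rw [add_sub_cancel_left, norm_smul, norm_norm] at h1
      have h2 : R * (‖u‖ * ‖z‖) ≤ R * (‖u‖ * η) := by gcongr
      linarith
    have hlow : h u - R * η * ‖u‖ ≤ T u := by
      rw [← hconst (h u - R * η * ‖u‖)]
      refine hmono _ _ continuous_const (by fun_prop) fun z hz => ?_
      have h1 := (abs_le.1 (hR (u + ‖u‖ • z) u)).1
      rw [add_sub_cancel_left, norm_smul, norm_norm] at h1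
      have h2 : R * (‖u‖ * ‖z‖) ≤ R * (‖u‖ * η) := by gcongr
      linarith
    rw [abs_le]
    constructor <;> linarith
  have hcup : c ≤ 1 + η := by
    rw [← hconst (1 + η), hc]
    refine hmono _ _ (by fun_prop) continuous_const fun z hz => ?_
    have := norm_add_le e z
    linarith
  have hclow : 1 - η ≤ c := by
    rw [← hconst (1 - η), hc]
    refine hmono _ _ continuous_const (by fun_prop) fun z hz => ?_
    have := norm_sub_le_norm_add e z
    linarith
  have hc0 : 1 / 2 ≤ c := by linarith
  have hcpos : 0 < c := by linarith
  obtain ⟨L, hL⟩ := exists_constantWidthOne (fun u => T u / c)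
    (fun a ha u => by simp only [hTsmul a ha u, mul_div_assoc])
    (fun u v => by
      rw [← add_div]
      exact div_le_div_of_nonneg_right (hTadd u v) hcpos.le)
    (fun u => by rw [← add_div, hTneg, mul_comm, mul_div_assoc, div_self hcpos.ne', mul_one])
  refine ⟨L, ?_, ?_⟩
  · rw [Subtype.dist_eq]
    have hd : dist L.1 K.1 ≤ 4 * R * η := by
      refine dist_le_of_abs_supportFn_sub_le _ _ (by positivity) fun u => ?_
      rw [hL, ← hh]
      have e1 : T u / c - h u = ((T u - h u) + (1 - c) * h u) / c := by field_simp; ring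
      have h1 : |h u| ≤ R * ‖u‖ := by simpa [h00] using hR u 0
      have h2 : |(1 - c) * h u| ≤ η * (R * ‖u‖) := by
        rw [abs_mul]
        refine mul_le_mul ?_ h1 (abs_nonneg _) hη0.le
        rw [abs_le]
        constructor <;> linarith
      rw [e1, abs_div, abs_of_pos hcpos, div_le_iff₀ hcpos]
      refine (abs_add_le _ _).trans ?_
      have h3 := hTclose u
      have h4 : 4 * R * η * ‖u‖ * (1 / 2) ≤ 4 * R * η * ‖u‖ * c :=
        mul_le_mul_of_nonneg_left hc0 (by positivity)
      linarith
    have h5 : (R + 1) * η ≤ ε / 8 := by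
      rw [le_div_iff₀ (by positivity)] at hη2
      linarith
    nlinarith
  -- Away from 0, the averaged function is `‖u‖` times the convolution of `φ` and `h` at `‖u‖⁻¹ •
  -- u`.
  · have hFs : ContDiff ℝ ∞ (convolution φ h (ContinuousLinearMap.lsmul ℝ ℝ) volume) :=
      hφc.contDiff_convolution_left _ hφs hcont.locallyIntegrable
    have hTF : ∀ u ∈ ({0}ᶜ : Set V), supportFn L.1 u
        = ‖u‖ * (convolution φ h (ContinuousLinearMap.lsmul ℝ ℝ) volume) (‖u‖⁻¹ • u) / c := by
      intro u hu
      have hp : 0 < ‖u‖ := norm_pos_iff.2 hu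
      rw [hL]
      simp only
      congr 1
      rw [convolution_def, hT, ← integral_neg_eq_self, ← integral_const_mul]
      simp only
      congr 1
      funext z
      rw [hφn, ContinuousLinearMap.lsmul_apply, smul_eq_mul, mul_left_comm, mul_comm (φ z)]
      congr 1
      rw [hh, ← supportFn_smul _ hp.le, smul_sub, smul_smul, mul_inv_cancel₀ hp.ne', one_smul,
        smul_neg, sub_neg_eq_add]
    refine ContDiffOn.congr ?_ hTF
    have hn : ContDiffOn ℝ ∞ (fun u : V => ‖u‖) {0}ᶜ := fun u hu =>
      (contDiffAt_norm ℝ hu).contDiffWithinAt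
    have hni : ContDiffOn ℝ ∞ (fun u : V => ‖u‖⁻¹ • u) {0}ᶜ :=
      (hn.inv fun u hu => norm_ne_zero_iff.2 hu).smul contDiffOn_id
    exact (hn.mul (hFs.comp_contDiffOn hni)).div_const c

end Smoothing

/-! ### Calculus of second derivatives -/

section Hess

open scoped ContDiff

theorem hess_symm {f : V → ℝ} {u : V} (hf : ∀ᶠ w in 𝓝 u, DifferentiableAt ℝ f w)
    (hf2 : DifferentiableAt ℝ (fderiv ℝ f) u) (v w : V) : hess f u v w = hess f u w v :=
  second_derivative_symmetric_of_eventually_of_real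
    (hf.mono fun _ h => h.hasFDerivAt) hf2.hasFDerivAt v w

theorem fderiv_smul_of_homogeneous {f : V → ℝ} (hf : ∀ c : ℝ, 0 < c → ∀ u, f (c • u) = c * f u)
    {c : ℝ} (hc : 0 < c) (u : V) : fderiv ℝ f (c • u) = fderiv ℝ f u := by
  have h1 : fderiv ℝ (fun v => f (c • v)) u = c • fderiv ℝ f (c • u) := fderiv_comp_smul c
  have h2 : (fun v => f (c • v)) = c • f := funext fun v => hf c hc v
  rw [h2, fderiv_const_smul_field] at h1
  exact (smul_right_injective _ hc.ne' h1).symm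

theorem hess_smul_of_homogeneous {f : V → ℝ} (hf : ∀ c : ℝ, 0 < c → ∀ u, f (c • u) = c * f u)
    {c : ℝ} (hc : 0 < c) (u : V) : c • hess f (c • u) = hess f u := by
  have h1 : fderiv ℝ (fun v => fderiv ℝ f (c • v)) u = c • fderiv ℝ (fderiv ℝ f) (c • u) :=
    fderiv_comp_smul c
  have h2 : (fun v => fderiv ℝ f (c • v)) = fderiv ℝ f :=
    funext fun v => fderiv_smul_of_homogeneous hf hc v
  rw [h2] at h1
  exact h1.symm

theorem hess_self_of_homogeneous {f : V → ℝ} (hf : ∀ c : ℝ, 0 < c → ∀ u, f (c • u) = c * f u)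
    {u : V} (hf2 : DifferentiableAt ℝ (fderiv ℝ f) u) : hess f u u = 0 := by
  have h1 : HasDerivAt (fun s : ℝ => fderiv ℝ f (s • u)) (hess f u u) 1 := by
    have h2 : HasFDerivAt (fderiv ℝ f) (hess f u) ((1 : ℝ) • u) := by
      rw [one_smul]; exact hf2.hasFDerivAt
    refine h2.comp_hasDerivAt 1 ?_
    simpa using (hasDerivAt_id (1 : ℝ)).smul_const u
  have h2 : (fun s : ℝ => fderiv ℝ f (s • u)) =ᶠ[𝓝 1] fun _ => fderiv ℝ f u := by
    filter_upwards [lt_mem_nhds one_pos] with s hs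
    exact fderiv_smul_of_homogeneous hf hs u
  exact h1.unique ((hasDerivAt_const (1 : ℝ) (fderiv ℝ f u)).congr_of_eventuallyEq h2)

theorem hess_add {f g : V → ℝ} {u : V} (hf : ContDiffAt ℝ 2 f u) (hg : ContDiffAt ℝ 2 g u) :
    hess (fun v => f v + g v) u = hess f u + hess g u := by
  have h1 : fderiv ℝ (fun v => f v + g v) =ᶠ[𝓝 u] fun v => fderiv ℝ f v + fderiv ℝ g v := by
    filter_upwards [hf.eventually (by simp), hg.eventually (by simp)] with v hfv hgv
    exact fderiv_fun_add (hfv.differentiableAt two_ne_zero) (hgv.differentiableAt two_ne_zero)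
  have hf1 := (hf.fderiv_right (m := 1) le_rfl).differentiableAt one_ne_zero
  have hg1 := (hg.fderiv_right (m := 1) le_rfl).differentiableAt one_ne_zero
  rw [hess, h1.fderiv_eq, fderiv_fun_add hf1 hg1]
  rfl

theorem fderiv_comp_neg_eq (f : V → ℝ) (u : V) :
    fderiv ℝ (fun v => f (-v)) u = -fderiv ℝ f (-u) := by
  have := fderiv_comp_smul (f := f) (x := u) (-1 : ℝ)
  simpa only [neg_smul, one_smul] using this

theorem hess_comp_neg (f : V → ℝ) (u : V) : hess (fun v => f (-v)) u = hess f (-u) := by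
  have h1 : fderiv ℝ (fun v => f (-v)) = fun v => -fderiv ℝ f (-v) :=
    funext fun v => fderiv_comp_neg_eq f v
  have h2 := fderiv_comp_smul (f := fderiv ℝ f) (x := u) (-1 : ℝ)
  simp only [neg_smul, one_smul] at h2
  rw [hess, h1, fderiv_fun_neg, h2, neg_neg]
  rfl

theorem hess_neg (f : V → ℝ) (u : V) : hess (fun v => -f v) u = -hess f u := by
  have h1 : fderiv ℝ (fun v => -f v) = fun v => -fderiv ℝ f v := funext fun v => fderiv_fun_neg
  rw [hess, h1, fderiv_fun_neg]
  rfl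

theorem hasDerivAt_line {F : Type*} [NormedAddCommGroup F] [NormedSpace ℝ F] {f : V → F} {u w : V}
    {s : ℝ} (hf : DifferentiableAt ℝ f (u + s • w)) :
    HasDerivAt (fun σ : ℝ => f (u + σ • w)) (fderiv ℝ f (u + s • w) w) s := by
  refine hf.hasFDerivAt.comp_hasDerivAt s ?_
  simpa using ((hasDerivAt_id s).smul_const w).const_add u

theorem hasDerivAt_fderiv_line {f : V → ℝ} {u w : V} {s : ℝ}
    (hf : DifferentiableAt ℝ (fderiv ℝ f) (u + s • w)) :
    HasDerivAt (fun σ : ℝ => fderiv ℝ f (u + σ • w) w) (hess f (u + s • w) w w) s :=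
  ((ContinuousLinearMap.apply ℝ ℝ w).hasFDerivAt.comp_hasDerivAt s (hasDerivAt_line hf))

theorem eventually_line_mem {u w : V} {P : V → Prop} (h : ∀ᶠ v in 𝓝 u, P v) :
    ∀ᶠ s in 𝓝 (0 : ℝ), P (u + s • w) := by
  have : Tendsto (fun s : ℝ => u + s • w) (𝓝 0) (𝓝 u) := by
    have h : Continuous fun s : ℝ => u + s • w := by fun_prop
    simpa using h.tendsto 0
  exact this.eventually h

theorem hess_eq_of_hasDerivAt {f : V → ℝ} {u w : V} (hf : ContDiffAt ℝ 2 f u) {p : ℝ → ℝ} {c : ℝ}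
    (h1 : ∀ᶠ s in 𝓝 (0 : ℝ), HasDerivAt (fun σ : ℝ => f (u + σ • w)) (p s) s)
    (h2 : HasDerivAt p c 0) : hess f u w w = c := by
  have hd : ∀ᶠ s in 𝓝 (0 : ℝ), DifferentiableAt ℝ f (u + s • w) :=
    eventually_line_mem ((hf.eventually (by simp)).mono fun v h => h.differentiableAt two_ne_zero)
  have hf1 : DifferentiableAt ℝ (fderiv ℝ f) (u + (0 : ℝ) • w) := by
    rw [zero_smul, add_zero]
    exact (hf.fderiv_right (m := 1) le_rfl).differentiableAt one_ne_zero
  have h3 := hasDerivAt_fderiv_line (w := w) hf1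
  rw [zero_smul, add_zero] at h3
  have h4 : (fun σ : ℝ => fderiv ℝ f (u + σ • w) w) =ᶠ[𝓝 0] p := by
    filter_upwards [h1, hd] with s hs hs2
    exact (hasDerivAt_line hs2).unique hs
  exact h3.unique (h2.congr_of_eventuallyEq h4)

/-- The second derivative of a rapidly oscillating function. -/
theorem hess_oscillation {ψ Φ : V → ℝ} {u : V} (hψ : ContDiffAt ℝ 2 ψ u) (hΦ : ContDiffAt ℝ 2 Φ u)
    {N : ℝ} (hN : 0 < N) (θ : ℝ) (w : V) :
    hess (fun v => (N ^ 2)⁻¹ * (ψ v * Real.cos (N * Φ v + θ))) u w w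
      = -(ψ u * (fderiv ℝ Φ u w) ^ 2 * Real.cos (N * Φ u + θ))
        + ((N ^ 2)⁻¹ * (hess ψ u w w * Real.cos (N * Φ u + θ))
          - N⁻¹ * ((2 * (fderiv ℝ ψ u w * fderiv ℝ Φ u w) + ψ u * hess Φ u w w)
            * Real.sin (N * Φ u + θ))) := by
  have hGs : ContDiffAt ℝ 2 (fun v => (N ^ 2)⁻¹ * (ψ v * Real.cos (N * Φ v + θ))) u :=
    contDiffAt_const.mul (hψ.mul ((contDiffAt_const.mul hΦ).add contDiffAt_const).cos)
  have hd1 : ∀ f : V → ℝ, ContDiffAt ℝ 2 f u → ∀ᶠ s in 𝓝 (0 : ℝ),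
      HasDerivAt (fun σ : ℝ => f (u + σ • w)) (fderiv ℝ f (u + s • w) w) s := fun f hf => by
    filter_upwards [eventually_line_mem (w := w) ((hf.eventually (by simp)).mono
      fun v h => h.differentiableAt two_ne_zero)] with s hs
    exact hasDerivAt_line hs
  have hd2 : ∀ f : V → ℝ, ContDiffAt ℝ 2 f u →
      HasDerivAt (fun σ : ℝ => fderiv ℝ f (u + σ • w) w) (hess f u w w) 0 := fun f hf => by
    have hf1 : DifferentiableAt ℝ (fderiv ℝ f) (u + (0 : ℝ) • w) := by
      rw [zero_smul, add_zero]
      exact (hf.fderiv_right (m := 1) le_rfl).differentiableAt one_ne_zero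
    have h3 := hasDerivAt_fderiv_line (w := w) hf1
    rwa [zero_smul, add_zero] at h3
  refine hess_eq_of_hasDerivAt hGs (p := fun s => (N ^ 2)⁻¹ *
    (fderiv ℝ ψ (u + s • w) w * Real.cos (N * Φ (u + s • w) + θ) + ψ (u + s • w) *
      (-Real.sin (N * Φ (u + s • w) + θ) * (N * fderiv ℝ Φ (u + s • w) w)))) ?_ ?_
  · filter_upwards [hd1 ψ hψ, hd1 Φ hΦ] with s hs1 hs2
    exact (hs1.mul ((hs2.const_mul N).add_const θ).cos).const_mul _
  · have a1 := (hd1 ψ hψ).self_of_nhds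
    have a2 := (hd1 Φ hΦ).self_of_nhds
    have b1 := hd2 ψ hψ
    have b2 := hd2 Φ hΦ
    have c2 := (a2.const_mul N).add_const θ
    have key := ((b1.mul c2.cos).add (a1.mul (c2.sin.neg.mul (b2.const_mul N)))).const_mul (N ^ 2)⁻¹
    simp only [zero_smul, add_zero] at key
    refine key.congr_deriv ?_
    simp only [Pi.mul_apply, Pi.neg_apply, zero_smul, add_zero]
    field_simp
    ring

/-- A smooth positively homogeneous function is sublinear, if its second derivatives are nonnegative
in directions orthogonal to the radial direction. -/
theorem add_le_of_hess_nonneg {f : V → ℝ} (hf : ∀ c : ℝ, 0 < c → ∀ u, f (c • u) = c * f u)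
    (hs : ContDiffOn ℝ 2 f {0}ᶜ) (hneg : ∀ u, 0 ≤ f u + f (-u))
    (hpos : ∀ u w, ‖u‖ = 1 → inner ℝ w u = 0 → 0 ≤ hess f u w w) (a b : V) :
    f (a + b) ≤ f a + f b := by
  have hC : ∀ u : V, u ≠ 0 → ContDiffAt ℝ 2 f u := fun u hu =>
    hs.contDiffAt (isOpen_compl_singleton.mem_nhds hu)
  have hD1 : ∀ u : V, u ≠ 0 → DifferentiableAt ℝ (fderiv ℝ f) u := fun u hu =>
    ((hC u hu).fderiv_right (m := 1) le_rfl).differentiableAt one_ne_zero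
  have hD : ∀ u : V, u ≠ 0 → DifferentiableAt ℝ f u := fun u hu =>
    (hC u hu).differentiableAt two_ne_zero
  have hall : ∀ u w : V, u ≠ 0 → 0 ≤ hess f u w w := by
    intro u w hu
    have hp : 0 < ‖u‖ := norm_pos_iff.2 hu
    set v := ‖u‖⁻¹ • u with hv
    have hvn : ‖v‖ = 1 := norm_smul_inv_norm hu
    have hv0 := ne_zero_of_norm_eq_one hvn
    have h1 := hess_smul_of_homogeneous hf hp v
    rw [hv, smul_smul, mul_inv_cancel₀ hp.ne', one_smul, ← hv] at h1
    have h2 : 0 ≤ hess f v w w := by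
      -- By homogeneity the radial direction lies in the kernel of the second derivative, so only
      -- the tangential part of `w` matters.
      set w' := w - inner ℝ w v • v with hw'
      have h3 := hpos v w' hvn (by
        rw [hw', inner_sub_left, real_inner_smul_left, real_inner_self_eq_norm_sq, hvn]; ring)
      have e0 := hess_self_of_homogeneous hf (hD1 v hv0)
      have e1 : hess f v w' w' = hess f v w w := by
        have e2 : ∀ z, hess f v z v = 0 := fun z => by
          rw [hess_symm ((isOpen_ne.eventually_mem hv0).mono fun z hz => hD z hz) (hD1 v hv0), e0]
          rfl
        simp only [hw', map_sub, map_smul, e0, e2, smul_zero, sub_zero]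
      rwa [e1] at h3
    have h4 : hess f v w w = ‖u‖ * hess f u w w := by rw [← h1]; rfl
    rw [h4] at h2
    exact nonneg_of_mul_nonneg_right h2 hp
  have h00 : f 0 = 0 := by
    have := hf 2 two_pos 0
    rw [smul_zero] at this
    linarith
  -- The function need not be differentiable at 0. Segments through 0 are settled by homogeneity and
  -- `hneg`, the others by convexity along the segment.
  by_cases hseg : (0 : V) ∈ segment ℝ a b
  · obtain ⟨p, q, hp, hq, hpq, e⟩ := hseg
    rcases hp.eq_or_lt with rfl | hp
    · have : b = 0 := by
        rw [zero_add] at hpq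
        rwa [zero_smul, zero_add, hpq, one_smul] at e
      rw [this, add_zero, h00, add_zero]
    · have ea : a = (q / p) • (-b) := by
        have : p • a = q • (-b) := by rw [smul_neg]; exact eq_neg_of_add_eq_zero_left e
        rw [div_eq_inv_mul, mul_smul, ← this, smul_smul, inv_mul_cancel₀ hp.ne', one_smul]
      set c := q / p with hc
      rcases hq.eq_or_lt with rfl | hq
      · rw [zero_div] at hc
        rw [ea, hc, zero_smul, zero_add, h00, zero_add]
      have hc0 : 0 < c := div_pos hq hp
      have hb := hneg b
      rw [ea, hf c hc0]
      rcases lt_trichotomy c 1 with h | h | h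
      · have : c • -b + b = (1 - c) • b := by module
        rw [this, hf _ (by linarith)]
        nlinarith
      · rw [h, one_smul, neg_add_cancel, h00]
        linarith
      · have : c • -b + b = (c - 1) • (-b) := by module
        rw [this, hf _ (by linarith)]
        linarith
  · have hne : ∀ s ∈ Set.Icc (0 : ℝ) 1, a + s • (b - a) ≠ 0 := by
      intro s hs e
      refine hseg ⟨1 - s, s, by linarith [hs.2], hs.1, by ring, ?_⟩
      rw [← e]; module
    have hconv : ConvexOn ℝ (Set.Icc (0 : ℝ) 1) (fun s => f (a + s • (b - a))) := by
      refine convexOn_of_hasDerivWithinAt2_nonneg (convex_Icc 0 1)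
        (f' := fun s => fderiv ℝ f (a + s • (b - a)) (b - a))
        (f'' := fun s => hess f (a + s • (b - a)) (b - a) (b - a)) ?_ ?_ ?_ ?_
      · intro s hs
        exact (hasDerivAt_line (hD _ (hne s hs))).continuousAt.continuousWithinAt
      · intro s hs
        exact (hasDerivAt_line (hD _ (hne s (interior_subset hs)))).hasDerivWithinAt
      · intro s hs
        exact (hasDerivAt_fderiv_line (hD1 _ (hne s (interior_subset hs)))).hasDerivWithinAt
      · intro s hs
        exact hall _ _ (hne s (interior_subset hs))
    have h1 := hconv.2 (Set.left_mem_Icc.2 zero_le_one) (Set.right_mem_Icc.2 zero_le_one)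
      (show (0 : ℝ) ≤ 1 / 2 by norm_num) (show (0 : ℝ) ≤ 1 / 2 by norm_num) (by norm_num)
    simp only [smul_eq_mul, mul_zero, mul_one, zero_add, zero_smul, add_zero, one_smul,
      add_sub_cancel] at h1
    have e : a + (1 / 2 : ℝ) • (b - a) = (1 / 2 : ℝ) • (a + b) := by module
    rw [e, hf _ (by norm_num)] at h1
    linarith

end Hess

/-! ### The curvature determinant -/

section Det

variable [FiniteDimensional ℝ V]

/-- A symmetric operator with spectrum in `[0, 1]` is bounded below by its determinant. -/
theorem det_le_inner_of_symmetric {T : V →ₗ[ℝ] V} (hT : T.IsSymmetric)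
    (h0 : ∀ w, 0 ≤ inner ℝ (T w) w) (h1 : ∀ w, inner ℝ (T w) w ≤ ‖w‖ ^ 2) :
    0 ≤ LinearMap.det T ∧ LinearMap.det T ≤ 1 ∧
      ∀ w, LinearMap.det T * ‖w‖ ^ 2 ≤ inner ℝ (T w) w := by
  set lam := hT.eigenvalues rfl with hlam
  set v := hT.eigenvectorBasis rfl with hv
  have hTv : ∀ i, T (v i) = lam i • v i := fun i =>
    hT.apply_eigenvectorBasis rfl i
  have e : ∀ i, inner ℝ (T (v i)) (v i) = lam i := fun i => by
    rw [hTv, real_inner_smul_left, real_inner_self_eq_norm_sq, v.norm_eq_one]; ring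
  have l0 : ∀ i, 0 ≤ lam i := fun i => e i ▸ h0 (v i)
  have l1 : ∀ i, lam i ≤ 1 := fun i => by
    have := h1 (v i)
    rwa [e, v.norm_eq_one, one_pow] at this
  have hdet : LinearMap.det T = ∏ i, lam i := by
    simpa using hT.det_eq_prod_eigenvalues rfl
  -- The remaining factors lie in `[0, 1]`, so the product is at most any single factor.
  have hle : ∀ i, LinearMap.det T ≤ lam i := fun i => by
    rw [hdet, ← Finset.mul_prod_erase _ _ (Finset.mem_univ i)]
    exact mul_le_of_le_one_right (l0 i) (Finset.prod_le_one (fun j _ => l0 j) fun j _ => l1 j)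
  refine ⟨hdet ▸ Finset.prod_nonneg fun i _ => l0 i,
    hdet ▸ Finset.prod_le_one (fun i _ => l0 i) fun i _ => l1 i, fun w => ?_⟩
  have e1 : inner ℝ (T w) w = ∑ i, lam i * (inner ℝ w (v i)) ^ 2 := by
    rw [← v.sum_inner_mul_inner (T w) w]
    refine Finset.sum_congr rfl fun i _ => ?_
    rw [hT w (v i), hTv, inner_smul_right, real_inner_comm w (v i)]
    ring
  have e2 : ‖w‖ ^ 2 = ∑ i, (inner ℝ w (v i)) ^ 2 := by
    rw [← real_inner_self_eq_norm_sq, ← v.sum_inner_mul_inner w w]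
    refine Finset.sum_congr rfl fun i _ => ?_
    rw [real_inner_comm w (v i)]
    ring
  rw [e1, e2, Finset.mul_sum]
  exact Finset.sum_le_sum fun i _ => mul_le_mul_of_nonneg_right (hle i) (sq_nonneg _)

/-- The matrix, with respect to an orthonormal basis, of the bilinear form `‖u‖ A`, completed in the
direction of `u`. -/
def curvatureMatrix (A : V →L[ℝ] V →L[ℝ] ℝ) (u : V) :
    Matrix (Fin (Module.finrank ℝ V)) (Fin (Module.finrank ℝ V)) ℝ :=
  Matrix.of fun i j => ‖u‖ * A (stdOrthonormalBasis ℝ V j) (stdOrthonormalBasis ℝ V i)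
    + (‖u‖ ^ 2)⁻¹ * inner ℝ u (stdOrthonormalBasis ℝ V j) * inner ℝ u (stdOrthonormalBasis ℝ V i)

/-- The operator that corresponds to `curvatureMatrix`. -/
def curvatureOp (A : V →L[ℝ] V →L[ℝ] ℝ) (u : V) : V →ₗ[ℝ] V where
  toFun w := ‖u‖ • (InnerProductSpace.toDual ℝ V).symm (A w) + ((‖u‖ ^ 2)⁻¹ * inner ℝ u w) • u
  map_add' v w := by
    simp only [map_add, inner_add_right]; module
  map_smul' c w := by
    simp only [map_smulₛₗ, inner_smul_right, RingHom.id_apply, conj_trivial]; module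

theorem inner_curvatureOp (A : V →L[ℝ] V →L[ℝ] ℝ) (u v w : V) :
    inner ℝ (curvatureOp A u v) w = ‖u‖ * A v w + (‖u‖ ^ 2)⁻¹ * inner ℝ u v * inner ℝ u w := by
  change inner ℝ (_ • _ + _ • _) w = _
  rw [inner_add_left, real_inner_smul_left, real_inner_smul_left,
    InnerProductSpace.toDual_symm_apply]

theorem det_curvatureOp (A : V →L[ℝ] V →L[ℝ] ℝ) (u : V) :
    LinearMap.det (curvatureOp A u) = (curvatureMatrix A u).det := by
  rw [← LinearMap.det_toMatrix (stdOrthonormalBasis ℝ V).toBasis]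
  congr 1
  ext i j
  rw [LinearMap.toMatrix_apply, OrthonormalBasis.coe_toBasis, OrthonormalBasis.coe_toBasis_repr_apply,
    OrthonormalBasis.repr_apply_apply, real_inner_comm, inner_curvatureOp]
  rfl

/-- The completed operator fixes `u` and acts as `‖u‖ A` on the orthogonal complement, so its
spectrum stays in `[0, 1]` and `det_le_inner_of_symmetric` applies. For a support function the
determinant is the product of the principal radii of curvature. -/
theorem det_curvatureMatrix_bounds {A : V →L[ℝ] V →L[ℝ] ℝ} {u : V} (hu : u ≠ 0)
    (hs : ∀ v w, A v w = A w v) (h0 : ∀ w, 0 ≤ A w w) (hr : A u = 0)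
    (h1 : ∀ w, inner ℝ w u = 0 → A w w ≤ ‖w‖ ^ 2 / ‖u‖) :
    0 ≤ (curvatureMatrix A u).det ∧ (curvatureMatrix A u).det ≤ 1 ∧
      ∀ w, inner ℝ w u = 0 → (curvatureMatrix A u).det * ‖w‖ ^ 2 ≤ ‖u‖ * A w w := by
  have hp : 0 < ‖u‖ := norm_pos_iff.2 hu
  rw [← det_curvatureOp]
  have key := det_le_inner_of_symmetric (T := curvatureOp A u) ?_ ?_ ?_
  · refine ⟨key.1, key.2.1, fun w hw => ?_⟩
    have h := key.2.2 w
    rw [inner_curvatureOp, real_inner_comm, hw, mul_zero, add_zero] at h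
    exact h
  · intro v w
    rw [inner_curvatureOp, real_inner_comm (curvatureOp A u w) v, inner_curvatureOp, hs v w]
    ring
  · intro w
    rw [inner_curvatureOp, mul_assoc]
    have := h0 w
    have := mul_self_nonneg (inner ℝ u w)
    positivity
  · intro w
    set w' := w - ((‖u‖ ^ 2)⁻¹ * inner ℝ u w) • u with hw'
    have hw'u : inner ℝ w' u = 0 := by
      rw [hw', inner_sub_left, real_inner_smul_left, real_inner_self_eq_norm_sq, real_inner_comm u w]
      field_simp
      ring
    have e1 : A w' w' = A w w := by
      have e2 : ∀ z, A z u = 0 := fun z => by rw [hs, hr]; rfl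
      simp only [hw', map_sub, map_smul, hr, e2, smul_zero, sub_zero]
    have e3 : ‖w‖ ^ 2 = ‖w'‖ ^ 2 + (‖u‖ ^ 2)⁻¹ * inner ℝ u w * inner ℝ u w := by
      have : w = w' + ((‖u‖ ^ 2)⁻¹ * inner ℝ u w) • u := by rw [hw']; abel
      rw [this, norm_add_sq_real, inner_smul_right, hw'u, norm_smul, Real.norm_eq_abs, mul_pow,
        sq_abs, ← this]
      field_simp
      ring
    have h2 := h1 w' hw'u
    rw [e1, le_div_iff₀ hp] at h2
    rw [inner_curvatureOp, e3]
    linarith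

end Det

/-! ### Oscillating perturbations -/

section Perturbation

open scoped ContDiff

theorem supportFn_smul_of_pos (K : ConvexBody V) : ∀ c : ℝ, 0 < c → ∀ u,
    supportFn K (c • u) = c * supportFn K u := fun _ hc u => supportFn_smul K hc.le u

theorem hess_supportFn_nonneg (K : ConstantWidthOne V) {u : V} (hu : u ≠ 0)
    (hd : DifferentiableAt ℝ (fderiv ℝ (supportFn K.1)) u) (w : V) :
    0 ≤ hess (supportFn K.1) u w w :=
  ge_of_tendsto (tendsto_secondDiff w (eventually_differentiableAt_supportFn K hu) hd)
    (Eventually.of_forall fun k => secondDiff_nonneg K.1 w k u)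

theorem hess_supportFn_le (K : ConstantWidthOne V) {u : V} (hu : u ≠ 0)
    (hd : DifferentiableAt ℝ (fderiv ℝ (supportFn K.1)) u) (w : V) :
    hess (supportFn K.1) u w w ≤ ‖w‖ ^ 2 / ‖u‖ :=
  le_of_tendsto (tendsto_secondDiff w (eventually_differentiableAt_supportFn K hu) hd)
    (Eventually.of_forall fun k => secondDiff_le K w k hu)

theorem hess_supportFn_symm (K : ConstantWidthOne V) {u : V} (hu : u ≠ 0)
    (hd : DifferentiableAt ℝ (fderiv ℝ (supportFn K.1)) u) (v w : V) :
    hess (supportFn K.1) u v w = hess (supportFn K.1) u w v :=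
  hess_symm (eventually_differentiableAt_supportFn K hu) hd v w

theorem sq_apply_le_of_nonneg (B : V →L[ℝ] V →L[ℝ] ℝ) (hs : ∀ v w, B v w = B w v)
    (h0 : ∀ w, 0 ≤ B w w) (v w : V) : B v w ^ 2 ≤ B v v * B w w := by
  have h1 : ∀ s : ℝ, 0 ≤ B w w * (s * s) + 2 * B v w * s + B v v := fun s => by
    have := h0 (v + s • w)
    simp only [map_add, map_smul, add_apply, smul_apply, smul_eq_mul, hs w v] at this
    linarith
  have := discrim_le_zero h1
  rw [discrim] at this
  linarith

/-- On unit directions, the second derivative of `f` in tangential directions is bounded below. -/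
def StronglyConvexWith (f : V → ℝ) (δ : ℝ) : Prop :=
  ∀ u w : V, ‖u‖ = 1 → inner ℝ w u = 0 → δ * ‖w‖ ^ 2 ≤ hess f u w w

theorem differentiableAt_fderiv_of_contDiffOn {f : V → ℝ} (hf : ContDiffOn ℝ ∞ f {0}ᶜ) {u : V}
    (hu : u ≠ 0) : DifferentiableAt ℝ (fderiv ℝ f) u :=
  ((hf.contDiffAt (isOpen_compl_singleton.mem_nhds hu)).fderiv_right (m := 1)
    (by norm_cast)).differentiableAt one_ne_zero

theorem contDiffOn_norm_compl : ContDiffOn ℝ ∞ (fun u : V => ‖u‖) {0}ᶜ := fun _ hu =>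
  (contDiffAt_norm ℝ hu).contDiffWithinAt

theorem stronglyConvexWith_mix {K L : ConstantWidthOne V} {δ : ℝ} (hδ0 : 0 ≤ δ) (hδ1 : δ ≤ 1)
    (hs : ContDiffOn ℝ ∞ (supportFn L.1) {0}ᶜ)
    (hL : supportFn L.1 = fun u => (1 - δ) * supportFn K.1 u + δ / 2 * ‖u‖) :
    StronglyConvexWith (supportFn L.1) (δ / 3) := by
  intro u w hu hw
  have hu0 := ne_zero_of_norm_eq_one hu
  refine ge_of_tendsto (tendsto_secondDiff w (eventually_differentiableAt_supportFn L hu0)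
    (differentiableAt_fderiv_of_contDiffOn hs hu0)) ?_
  have hlim : Tendsto (fun k : ℕ => (((k : ℝ) + 1)⁻¹) ^ 2 * ‖w‖ ^ 2) atTop (𝓝 (0 ^ 2 * ‖w‖ ^ 2)) := by
    have h1 := tendsto_one_div_add_atTop_nhds_zero_nat (𝕜 := ℝ)
    simp only [one_div] at h1
    exact (h1.pow 2).mul_const _
  have h3 : ∀ᶠ k : ℕ in atTop, (((k : ℝ) + 1)⁻¹) ^ 2 * ‖w‖ ^ 2 < 3 :=
    hlim.eventually_lt_const (by norm_num)
  filter_upwards [h3] with k hk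
  set s : ℝ := ((k : ℝ) + 1)⁻¹ with hsdef
  have hs0 : 0 < s := by positivity
  -- This rests on `(1 + a / 3)² ≤ 1 + a` for `0 ≤ a ≤ 3`, hence the threshold 3 in `h3`. The norm
  -- then contributes at least `δ / 2 * (2 / 3) * ‖w‖²`, which is where `δ / 3` comes from.
  have hn : ∀ v : V, ‖v‖ = ‖w‖ → inner ℝ v u = 0 → 1 + s ^ 2 * ‖w‖ ^ 2 / 3 ≤ ‖u + s • v‖ := by
    intro v hv hvu
    refine le_of_sq_le_sq ?_ (norm_nonneg _)
    rw [norm_add_sq_real, inner_smul_right, real_inner_comm, hvu, norm_smul,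
      Real.norm_of_nonneg hs0.le, hu, hv]
    have : 0 ≤ s ^ 2 * ‖w‖ ^ 2 := by positivity
    nlinarith
  have n1 := hn w rfl hw
  have n2 := hn (-w) (norm_neg w) (by rw [inner_neg_left, hw, neg_zero])
  rw [smul_neg, ← sub_eq_add_neg] at n2
  have hK := secondDiff_nonneg K.1 w k u
  have e : secondDiff (supportFn L.1) w k u = (1 - δ) * secondDiff (supportFn K.1) w k u
      + δ / 2 * (((k : ℝ) + 1) ^ 2 * (‖u + s • w‖ + ‖u - s • w‖ - 2 * ‖u‖)) := by
    rw [secondDiff, secondDiff, hL]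
    ring
  have h4 : ((k : ℝ) + 1) ^ 2 * (2 * (s ^ 2 * ‖w‖ ^ 2 / 3))
      ≤ ((k : ℝ) + 1) ^ 2 * (‖u + s • w‖ + ‖u - s • w‖ - 2 * ‖u‖) := by
    gcongr
    rw [hu]
    linarith
  have e2 : ((k : ℝ) + 1) ^ 2 * (2 * (s ^ 2 * ‖w‖ ^ 2 / 3)) = 2 / 3 * ‖w‖ ^ 2 := by
    rw [hsdef]; field_simp
  rw [e2] at h4
  rw [e]
  have h5 := mul_le_mul_of_nonneg_left h4 (show 0 ≤ δ / 2 by linarith)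
  have h6 := mul_nonneg (sub_nonneg.2 hδ1) hK
  linarith

section

variable [FiniteDimensional ℝ V] [MeasurableSpace V] [BorelSpace V]

theorem exists_stronglyConvex_approximation [Nontrivial V] (K : ConstantWidthOne V) {ε : ℝ}
    (hε : 0 < ε) : ∃ L : ConstantWidthOne V, dist L K < ε ∧ ContDiffOn ℝ ∞ (supportFn L.1) {0}ᶜ ∧
      ∃ δ > 0, StronglyConvexWith (supportFn L.1) δ := by
  obtain ⟨K', h1, h2⟩ := exists_smooth_approximation K (half_pos hε)
  obtain ⟨δ, hδ0, hδ1, L, h3, hL⟩ := exists_mix_dist_lt K' (half_pos hε)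
  have hs : ContDiffOn ℝ ∞ (supportFn L.1) {0}ᶜ := by
    rw [hL]
    exact (contDiffOn_const.mul h2).add (contDiffOn_const.mul contDiffOn_norm_compl)
  refine ⟨L, ?_, hs, δ / 3, by positivity, stronglyConvexWith_mix hδ0.le hδ1.le hs hL⟩
  linarith [dist_triangle L K' K]

end

/-- Only the term in which both derivatives fall on the cosine is of order one. The others carry a
factor `N⁻¹` or better, with coefficients bounded on the compact annulus. -/
theorem exists_hess_oscillation_bound [FiniteDimensional ℝ V] {ψ Φ : V → ℝ}
    (hψ : ContDiffOn ℝ ∞ ψ {0}ᶜ) (hΦ : ContDiffOn ℝ ∞ Φ {0}ᶜ) :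
    ∃ C : ℝ, 0 ≤ C ∧ ∀ N : ℝ, 1 ≤ N → ∀ θ : ℝ, ∀ u ∈ annulus V, ∀ w : V,
      |hess (fun v => (N ^ 2)⁻¹ * (ψ v * Real.cos (N * Φ v + θ))) u w w
        + ψ u * (fderiv ℝ Φ u w) ^ 2 * Real.cos (N * Φ u + θ)| ≤ C / N * ‖w‖ ^ 2 := by
  have hsub : annulus V ⊆ {0}ᶜ := fun u hu => ne_zero_of_mem_annulus hu
  have hopen : IsOpen ({0}ᶜ : Set V) := isOpen_compl_singleton
  have hb : ∀ f : V → ℝ, ContDiffOn ℝ ∞ f {0}ᶜ → ∃ C : ℝ, ∀ u ∈ annulus V,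
      ‖f u‖ ≤ C ∧ ‖fderiv ℝ f u‖ ≤ C ∧ ‖hess f u‖ ≤ C := by
    intro f hf
    have h1 : ContDiffOn ℝ ∞ (fderiv ℝ f) {0}ᶜ := hf.fderiv_of_isOpen hopen (by simp)
    have h2 : ContDiffOn ℝ ∞ (hess f) {0}ᶜ := h1.fderiv_of_isOpen hopen (by simp)
    obtain ⟨C0, hC0⟩ := isCompact_annulus.exists_bound_of_continuousOn (hf.continuousOn.mono hsub)
    obtain ⟨C1, hC1⟩ := isCompact_annulus.exists_bound_of_continuousOn (h1.continuousOn.mono hsub)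
    have h3 : ContinuousOn (fun u => ‖hess f u‖) (annulus V) :=
      (continuous_norm (E := V →L[ℝ] V →L[ℝ] ℝ)).comp_continuousOn (h2.continuousOn.mono hsub)
    obtain ⟨C2, hC2⟩ := isCompact_annulus.exists_bound_of_continuousOn h3
    exact ⟨max C0 (max C1 C2), fun u hu => ⟨(hC0 u hu).trans (le_max_left _ _),
      (hC1 u hu).trans (le_max_of_le_right (le_max_left _ _)),
      ((le_abs_self _).trans (hC2 u hu)).trans (le_max_of_le_right (le_max_right _ _))⟩⟩
  obtain ⟨Cψ', hCψ'⟩ := hb ψ hψ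
  obtain ⟨CΦ', hCΦ'⟩ := hb Φ hΦ
  set Cψ := max Cψ' 0
  set CΦ := max CΦ' 0
  have hCψ0 : 0 ≤ Cψ := le_max_right _ _
  have hCΦ0 : 0 ≤ CΦ := le_max_right _ _
  refine ⟨Cψ + (2 * (Cψ * CΦ) + Cψ * CΦ), by positivity, fun N hN θ u hu w => ?_⟩
  have hN0 : 0 < N := by linarith
  have hu0 := ne_zero_of_mem_annulus hu
  have hat : ∀ f : V → ℝ, ContDiffOn ℝ ∞ f {0}ᶜ → ContDiffAt ℝ 2 f u := fun f hf =>
    (hf.contDiffAt (hopen.mem_nhds hu0)).of_le (by norm_cast)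
  rw [hess_oscillation (hat ψ hψ) (hat Φ hΦ) hN0 θ w]
  set c := Real.cos (N * Φ u + θ)
  set s := Real.sin (N * Φ u + θ)
  have hc : |c| ≤ 1 := Real.abs_cos_le_one _
  have hs : |s| ≤ 1 := Real.abs_sin_le_one _
  have b0 : |ψ u| ≤ Cψ := (hCψ' u hu).1.trans (le_max_left _ _)
  have b1 : |fderiv ℝ ψ u w| ≤ Cψ * ‖w‖ :=
    ((fderiv ℝ ψ u).le_opNorm w).trans (mul_le_mul_of_nonneg_right
      ((hCψ' u hu).2.1.trans (le_max_left _ _)) (norm_nonneg _))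
  have b2 : |hess ψ u w w| ≤ Cψ * ‖w‖ * ‖w‖ :=
    ((hess ψ u).le_opNorm₂ w w).trans (by gcongr; exact (hCψ' u hu).2.2.trans (le_max_left _ _))
  have b3 : |fderiv ℝ Φ u w| ≤ CΦ * ‖w‖ :=
    ((fderiv ℝ Φ u).le_opNorm w).trans (mul_le_mul_of_nonneg_right
      ((hCΦ' u hu).2.1.trans (le_max_left _ _)) (norm_nonneg _))
  have b4 : |hess Φ u w w| ≤ CΦ * ‖w‖ * ‖w‖ :=
    ((hess Φ u).le_opNorm₂ w w).trans (by gcongr; exact (hCΦ' u hu).2.2.trans (le_max_left _ _))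
  have t1 : |(N ^ 2)⁻¹ * (hess ψ u w w * c)| ≤ N⁻¹ * (Cψ * ‖w‖ * ‖w‖) := by
    rw [abs_mul, abs_mul, abs_of_pos (by positivity : 0 < (N ^ 2)⁻¹)]
    have : (N ^ 2)⁻¹ ≤ N⁻¹ := inv_anti₀ hN0 (by nlinarith)
    refine mul_le_mul this ?_ (by positivity) (by positivity)
    calc |hess ψ u w w| * |c| ≤ |hess ψ u w w| * 1 := by gcongr
      _ ≤ _ := by rw [mul_one]; exact b2
  have t2 : |N⁻¹ * ((2 * (fderiv ℝ ψ u w * fderiv ℝ Φ u w) + ψ u * hess Φ u w w) * s)|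
      ≤ N⁻¹ * (2 * (Cψ * ‖w‖ * (CΦ * ‖w‖)) + Cψ * (CΦ * ‖w‖ * ‖w‖)) := by
    rw [abs_mul, abs_mul, abs_of_pos (by positivity : 0 < N⁻¹)]
    refine mul_le_mul_of_nonneg_left ?_ (by positivity)
    calc _ ≤ |2 * (fderiv ℝ ψ u w * fderiv ℝ Φ u w) + ψ u * hess Φ u w w| * 1 := by gcongr
      _ ≤ |2 * (fderiv ℝ ψ u w * fderiv ℝ Φ u w)| + |ψ u * hess Φ u w w| := by
        rw [mul_one]; exact abs_add_le _ _
      _ ≤ _ := by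
        rw [abs_mul, abs_mul, abs_mul, abs_two]
        gcongr
  rw [show ∀ a b c : ℝ, -a + (b - c) + a = b - c by intros; ring]
  refine (abs_sub _ _).trans ((add_le_add t1 t2).trans (le_of_eq ?_))
  field_simp

variable [FiniteDimensional ℝ V]

/-- The amplitude of the perturbation, supported in the half-space of directions with positive inner
product with `e`. -/
def amplitude (f : V → ℝ) (e u : V) : ℝ :=
  -- For a support function the determinant switches the oscillation off where some principal radius
  -- vanishes and convexity leaves no room. The factor `‖u‖` makes the amplitude homogeneous of
  -- degree one; with `1 / 4`, the perturbations at `u` and `-u` together use at most half of the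
  -- available convexity, up to `O(1 / N)`.
  1 / 4 * (Real.smoothTransition (inner ℝ u e / ‖u‖) * (‖u‖ * (curvatureMatrix (hess f u) u).det))

theorem contDiffOn_det_curvatureMatrix {f : V → ℝ} (hf : ContDiffOn ℝ ∞ f {0}ᶜ) :
    ContDiffOn ℝ ∞ (fun u => (curvatureMatrix (hess f u) u).det) {0}ᶜ := by
  have hopen : IsOpen ({0}ᶜ : Set V) := isOpen_compl_singleton
  have h1 : ContDiffOn ℝ ∞ (fderiv ℝ f) {0}ᶜ := hf.fderiv_of_isOpen hopen (by simp)
  have h2 : ContDiffOn ℝ ∞ (hess f) {0}ᶜ := h1.fderiv_of_isOpen hopen (by simp)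
  have h3 : ∀ i j, ContDiffOn ℝ ∞ (fun u => curvatureMatrix (hess f u) u i j) {0}ᶜ := by
    intro i j
    simp only [curvatureMatrix, Matrix.of_apply]
    have hi : ∀ b : V, ContDiffOn ℝ ∞ (fun u : V => inner ℝ u b) {0}ᶜ := fun b =>
      (contDiff_id.inner ℝ contDiff_const).contDiffOn
    refine (contDiffOn_norm_compl.mul ((h2.clm_apply contDiffOn_const).clm_apply
      contDiffOn_const)).add (((ContDiffOn.inv (contDiffOn_norm_compl.pow 2) ?_).mul (hi _)).mul (hi _))
    intro u hu
    exact pow_ne_zero 2 (norm_ne_zero_iff.2 hu)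
  simp only [Matrix.det_apply]
  exact ContDiffOn.sum fun σ _ => (contDiffOn_prod fun i _ => h3 _ _).const_smul _

theorem contDiffOn_amplitude {f : V → ℝ} (hf : ContDiffOn ℝ ∞ f {0}ᶜ) (e : V) :
    ContDiffOn ℝ ∞ (amplitude f e) {0}ᶜ := by
  refine contDiffOn_const.mul (ContDiffOn.mul ?_
    (contDiffOn_norm_compl.mul (contDiffOn_det_curvatureMatrix hf)))
  refine Real.smoothTransition.contDiff.comp_contDiffOn ?_
  exact ((contDiff_id.inner ℝ contDiff_const).contDiffOn).div contDiffOn_norm_compl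
    fun u hu => norm_ne_zero_iff.2 hu

theorem curvatureMatrix_smul {f : V → ℝ} (hf : ∀ c : ℝ, 0 < c → ∀ u, f (c • u) = c * f u)
    {c : ℝ} (hc : 0 < c) (u : V) :
    curvatureMatrix (hess f (c • u)) (c • u) = curvatureMatrix (hess f u) u := by
  ext i j
  simp only [curvatureMatrix, Matrix.of_apply]
  rw [← hess_smul_of_homogeneous hf hc u, norm_smul, Real.norm_of_nonneg hc.le,
    real_inner_smul_left, real_inner_smul_left]
  simp only [smul_apply, smul_eq_mul]
  rcases eq_or_ne u 0 with rfl | hu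
  · simp
  · have : 0 < ‖u‖ := norm_pos_iff.2 hu
    field_simp

theorem amplitude_smul {f : V → ℝ} (hf : ∀ c : ℝ, 0 < c → ∀ u, f (c • u) = c * f u)
    (e : V) {c : ℝ} (hc : 0 < c) (u : V) : amplitude f e (c • u) = c * amplitude f e u := by
  rw [amplitude, amplitude, curvatureMatrix_smul hf hc, norm_smul, Real.norm_of_nonneg hc.le,
    real_inner_smul_left, mul_div_mul_left _ _ hc.ne']
  ring

theorem curvature_bounds (K : ConstantWidthOne V) {u : V} (hu : u ≠ 0)
    (hd : DifferentiableAt ℝ (fderiv ℝ (supportFn K.1)) u) :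
    0 ≤ (curvatureMatrix (hess (supportFn K.1) u) u).det ∧
      (curvatureMatrix (hess (supportFn K.1) u) u).det ≤ 1 ∧
      ∀ w, inner ℝ w u = 0 → (curvatureMatrix (hess (supportFn K.1) u) u).det * ‖w‖ ^ 2
        ≤ ‖u‖ * hess (supportFn K.1) u w w :=
  det_curvatureMatrix_bounds hu (hess_supportFn_symm K hu hd) (hess_supportFn_nonneg K hu hd)
    (hess_self_of_homogeneous (supportFn_smul_of_pos K.1) hd)
    (fun w _ => hess_supportFn_le K hu hd w)

theorem amplitude_nonneg (K : ConstantWidthOne V) (e : V) {u : V} (hu : u ≠ 0)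
    (hd : DifferentiableAt ℝ (fderiv ℝ (supportFn K.1)) u) :
    0 ≤ amplitude (supportFn K.1) e u := by
  have h1 := (curvature_bounds K hu hd).1
  have h2 := Real.smoothTransition.nonneg (inner ℝ u e / ‖u‖)
  unfold amplitude
  positivity

theorem amplitude_le (K : ConstantWidthOne V) (e : V) {u : V} (hu : u ≠ 0)
    (hd : DifferentiableAt ℝ (fderiv ℝ (supportFn K.1)) u) :
    amplitude (supportFn K.1) e u ≤ 1 / 4 * (‖u‖ * (curvatureMatrix (hess (supportFn K.1) u) u).det) := by
  have h1 := (curvature_bounds K hu hd).1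
  unfold amplitude
  refine mul_le_mul_of_nonneg_left ?_ (by norm_num)
  exact mul_le_of_le_one_left (by positivity) (Real.smoothTransition.le_one _)

/-- The amplitude is small enough for the perturbation to preserve convexity. -/
theorem amplitude_mul_sq_le (K : ConstantWidthOne V) (hs : ContDiffOn ℝ ∞ (supportFn K.1) {0}ᶜ)
    (e : V) {t u w : V} (ht : ‖t‖ = 1) (hu : ‖u‖ = 1) (hw : inner ℝ w u = 0) :
    amplitude (supportFn K.1) e u * (hess (supportFn K.1) (-u) w t) ^ 2
        ≤ 1 / 4 * hess (supportFn K.1) u w w ∧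
      amplitude (supportFn K.1) e u * (hess (supportFn K.1) (-u) w t) ^ 2
        ≤ 1 / 4 * hess (supportFn K.1) (-u) w w := by
  have hu0 := ne_zero_of_norm_eq_one hu
  have hn0 : -u ≠ 0 := neg_ne_zero.2 hu0
  have hd := differentiableAt_fderiv_of_contDiffOn hs hu0
  have hdn := differentiableAt_fderiv_of_contDiffOn hs hn0
  have h1 := sq_apply_le_of_nonneg _ (hess_supportFn_symm K hn0 hdn)
    (hess_supportFn_nonneg K hn0 hdn) w t
  have h2 := hess_supportFn_le K hn0 hdn t
  have h3 := hess_supportFn_le K hn0 hdn w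
  have h4 := hess_supportFn_nonneg K hn0 hdn w
  rw [norm_neg, hu, div_one] at h2 h3
  rw [ht, one_pow] at h2
  have h5 : hess (supportFn K.1) (-u) w t ^ 2 ≤ hess (supportFn K.1) (-u) w w :=
    h1.trans (mul_le_of_le_one_right h4 h2)
  obtain ⟨d0, d1, d2⟩ := curvature_bounds K hu0 hd
  have h6 := amplitude_le K e hu0 hd
  have h7 := d2 w hw
  rw [hu, one_mul] at h6 h7
  -- At `u` the determinant in the amplitude supplies the second derivative; at `-u` the squared
  -- derivative of the phase does, by Cauchy-Schwarz (`h5`). One amplitude thus suits both points.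
  constructor
  · calc _ ≤ 1 / 4 * (curvatureMatrix (hess (supportFn K.1) u) u).det * ‖w‖ ^ 2 :=
          mul_le_mul h6 (h5.trans h3) (sq_nonneg _) (by positivity)
      _ ≤ _ := by rw [mul_assoc]; gcongr
  · exact mul_le_mul (h6.trans (by linarith)) h5 (sq_nonneg _) (by norm_num)

end Perturbation

/-! ### Bodies of constant width perturbed by an oscillation -/

section PerturbedBody

open scoped ContDiff

variable [FiniteDimensional ℝ V]

/-- The phase of the oscillation: the derivative of the reflected function in direction `t`. -/
def phase (f : V → ℝ) (t v : V) : ℝ := fderiv ℝ (fun x => f (-x)) v t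

/-- The oscillation added to the support function. -/
def oscillation (f : V → ℝ) (e t : V) (N θ : ℝ) (v : V) : ℝ :=
  (N ^ 2)⁻¹ * (amplitude f e v * Real.cos (N * phase f t v + θ))

omit [FiniteDimensional ℝ V] in
theorem contDiffOn_comp_neg {f : V → ℝ} (hf : ContDiffOn ℝ ∞ f {0}ᶜ) :
    ContDiffOn ℝ ∞ (fun x => f (-x)) {0}ᶜ :=
  hf.comp contDiff_neg.contDiffOn fun _ hx => neg_ne_zero.2 hx

omit [FiniteDimensional ℝ V] in
theorem contDiffOn_phase {f : V → ℝ} (hf : ContDiffOn ℝ ∞ f {0}ᶜ) (t : V) :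
    ContDiffOn ℝ ∞ (phase f t) {0}ᶜ :=
  ((contDiffOn_comp_neg hf).fderiv_of_isOpen isOpen_compl_singleton (by simp)).clm_apply
    contDiffOn_const

omit [FiniteDimensional ℝ V] in
-- This couples opposite points: an oscillation at `u` with this phase has a strength governed by
-- the curvature at `-u`.
theorem fderiv_phase {f : V → ℝ} (hf : ContDiffOn ℝ ∞ f {0}ᶜ) (t : V) {u : V} (hu : u ≠ 0) (w : V) :
    fderiv ℝ (phase f t) u w = hess f (-u) w t := by
  have h1 := (differentiableAt_fderiv_of_contDiffOn (contDiffOn_comp_neg hf) hu).hasFDerivAt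
  have h2 := (ContinuousLinearMap.apply ℝ ℝ t).hasFDerivAt.comp u h1
  have h3 : HasFDerivAt (phase f t) _ u := h2
  rw [h3.fderiv, ← hess_comp_neg]
  rfl

omit [FiniteDimensional ℝ V] in
theorem phase_smul {f : V → ℝ} (hf : ∀ c : ℝ, 0 < c → ∀ u, f (c • u) = c * f u) (t : V) {c : ℝ}
    (hc : 0 < c) (u : V) : phase f t (c • u) = phase f t u := by
  rw [phase, fderiv_smul_of_homogeneous (fun c hc u => by rw [← smul_neg, hf c hc]) hc u, phase]

theorem contDiffOn_oscillation {f : V → ℝ} (hf : ContDiffOn ℝ ∞ f {0}ᶜ) (e t : V) (N θ : ℝ) :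
    ContDiffOn ℝ ∞ (oscillation f e t N θ) {0}ᶜ :=
  contDiffOn_const.mul ((contDiffOn_amplitude hf e).mul
    (((contDiffOn_const.mul (contDiffOn_phase hf t)).add contDiffOn_const).cos))

theorem oscillation_smul {f : V → ℝ} (hf : ∀ c : ℝ, 0 < c → ∀ u, f (c • u) = c * f u)
    (e t : V) (N θ : ℝ) {c : ℝ} (hc : 0 < c) (u : V) :
    oscillation f e t N θ (c • u) = c * oscillation f e t N θ u := by
  rw [oscillation, oscillation, amplitude_smul hf e hc, phase_smul hf t hc]
  ring

theorem exists_hess_supportFn_oscillation_bound (K : ConstantWidthOne V)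
    (hs : ContDiffOn ℝ ∞ (supportFn K.1) {0}ᶜ) (e t : V) :
    ∃ C : ℝ, 0 ≤ C ∧ ∀ N : ℝ, 1 ≤ N → ∀ θ : ℝ, ∀ u ∈ annulus V, ∀ w : V,
      |hess (oscillation (supportFn K.1) e t N θ) u w w
        + amplitude (supportFn K.1) e u * (hess (supportFn K.1) (-u) w t) ^ 2
          * Real.cos (N * phase (supportFn K.1) t u + θ)| ≤ C / N * ‖w‖ ^ 2 := by
  obtain ⟨C, hC0, hC⟩ := exists_hess_oscillation_bound (contDiffOn_amplitude hs e)
    (contDiffOn_phase hs t)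
  refine ⟨C, hC0, fun N hN θ u hu w => ?_⟩
  rw [← fderiv_phase hs t (ne_zero_of_mem_annulus hu)]
  exact hC N hN θ u hu w

theorem abs_oscillation_le (K : ConstantWidthOne V)
    (hs : ContDiffOn ℝ ∞ (supportFn K.1) {0}ᶜ) (e t : V) {N : ℝ} (hN : 1 ≤ N) (θ : ℝ) (u : V) :
    |oscillation (supportFn K.1) e t N θ u| ≤ N⁻¹ * (1 / 4 * ‖u‖) := by
  rcases eq_or_ne u 0 with rfl | hu
  · simp [oscillation, amplitude]
  have hd := differentiableAt_fderiv_of_contDiffOn hs hu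
  have h1 := amplitude_le K e hu hd
  have h0 := amplitude_nonneg K e hu hd
  have h2 := (curvature_bounds K hu hd).2.1
  have h3 : ‖u‖ * (curvatureMatrix (hess (supportFn K.1) u) u).det ≤ ‖u‖ :=
    mul_le_of_le_one_right (norm_nonneg _) h2
  have h4 : (N ^ 2)⁻¹ ≤ N⁻¹ := inv_anti₀ (by linarith) (by nlinarith)
  rw [oscillation, abs_mul, abs_mul, abs_of_nonneg h0, abs_of_pos (by positivity)]
  refine mul_le_mul h4 ?_ (by positivity) (by positivity)
  calc _ ≤ amplitude (supportFn K.1) e u * 1 := by gcongr; exact Real.abs_cos_le_one _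
    _ ≤ _ := by linarith

/-- Subtracting the reflected oscillation preserves the width. In tangential directions the main
terms at `u` and `-u` use at most half of the second derivative of the support function; the error
`2 * C / N * ‖w‖²` is at most `δ / 2 * ‖w‖²`, within the other half by strong convexity. -/
theorem exists_perturbed_body (K : ConstantWidthOne V) (hs : ContDiffOn ℝ ∞ (supportFn K.1) {0}ᶜ)
    {e t : V} (ht : ‖t‖ = 1) {δ C N : ℝ} (hK : StronglyConvexWith (supportFn K.1) δ) (hN : 1 ≤ N)
    (hCN : 4 * C ≤ δ * N)
    (hC : ∀ θ : ℝ, ∀ u ∈ annulus V, ∀ w : V,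
      |hess (oscillation (supportFn K.1) e t N θ) u w w
        + amplitude (supportFn K.1) e u * (hess (supportFn K.1) (-u) w t) ^ 2
          * Real.cos (N * phase (supportFn K.1) t u + θ)| ≤ C / N * ‖w‖ ^ 2) (θ : ℝ) :
    ∃ L : ConstantWidthOne V, dist L K ≤ N⁻¹ ∧ ∀ u ≠ 0, hess (supportFn L.1) u =
      hess (supportFn K.1) u + (hess (oscillation (supportFn K.1) e t N θ) u
        + -hess (oscillation (supportFn K.1) e t N θ) (-u)) := by
  set f := supportFn K.1 with hf
  set G := oscillation f e t N θ with hG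
  have hN0 : 0 < N := by linarith
  have hfs := supportFn_smul_of_pos K.1
  have hGc := contDiffOn_oscillation hs e t N θ
  have hGn : ContDiffOn ℝ ∞ (fun x => -G (-x)) {0}ᶜ := (contDiffOn_comp_neg hGc).neg
  have hat : ∀ g : V → ℝ, ContDiffOn ℝ ∞ g {0}ᶜ → ∀ u ≠ 0, ContDiffAt ℝ 2 g u := fun g hg u hu =>
    (hg.contDiffAt (isOpen_compl_singleton.mem_nhds hu)).of_le (by norm_cast)
  set h : V → ℝ := fun v => f v + (G v + -G (-v)) with hh
  have hhess : ∀ u ≠ 0, hess h u = hess f u + (hess G u + -hess G (-u)) := by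
    intro u hu
    rw [hh, hess_add (hat _ hs u hu) (hat _ (hGc.add hGn) u hu),
      hess_add (hat _ hGc u hu) (hat _ hGn u hu), hess_neg, hess_comp_neg]
  have hhn : ∀ u, h u + h (-u) = ‖u‖ := fun u => by
    have := K.2.supportFn_add_neg u
    simp only [hh, neg_neg, hf]
    linarith
  have hhs : ∀ c : ℝ, 0 < c → ∀ u, h (c • u) = c * h u := fun c hc u => by
    simp only [hh, hG]
    rw [← smul_neg, oscillation_smul hfs e t N θ hc, oscillation_smul hfs e t N θ hc, hf,
      hfs c hc]
    ring
  have hpos : ∀ u w, ‖u‖ = 1 → inner ℝ w u = 0 → 0 ≤ hess h u w w := by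
    intro u w hu hw
    have hu0 := ne_zero_of_norm_eq_one hu
    have hun : ‖-u‖ = 1 := by rw [norm_neg, hu]
    have hmem : ∀ v : V, ‖v‖ = 1 → v ∈ annulus V := fun v hv => ⟨hv.ge, hv.le.trans one_le_two⟩
    have hb : ∀ v : V, ‖v‖ = 1 → |hess G v w w| ≤ amplitude f e v * (hess f (-v) w t) ^ 2
        + C / N * ‖w‖ ^ 2 := fun v hv => by
      have h0 := amplitude_nonneg K e (ne_zero_of_norm_eq_one hv)
        (differentiableAt_fderiv_of_contDiffOn hs (ne_zero_of_norm_eq_one hv))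
      have h1 := hC θ v (hmem v hv) w
      have h2 : |amplitude f e v * (hess f (-v) w t) ^ 2 * Real.cos (N * phase f t v + θ)|
          ≤ amplitude f e v * (hess f (-v) w t) ^ 2 := by
        rw [abs_mul, abs_of_nonneg (mul_nonneg h0 (sq_nonneg _))]
        exact mul_le_of_le_one_right (mul_nonneg h0 (sq_nonneg _)) (Real.abs_cos_le_one _)
      rw [abs_le] at h1 h2 ⊢
      constructor <;> linarith
    have h1 := hb u hu
    have h2 := hb (-u) hun
    have h3 := (amplitude_mul_sq_le K hs e ht hu hw).1
    have h4 := (amplitude_mul_sq_le K hs e ht hun (by rw [inner_neg_right, hw, neg_zero])).2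
    have h5 := hK u w hu hw
    rw [neg_neg] at h2 h4
    rw [hhess u hu0]
    simp only [add_apply, neg_apply]
    have h6 : 4 * (C / N) ≤ δ := by
      rw [← mul_div_assoc, div_le_iff₀ hN0]; exact hCN
    have h7 := mul_le_mul_of_nonneg_right h6 (sq_nonneg ‖w‖)
    rw [abs_le] at h1 h2
    linarith
  obtain ⟨L, hL⟩ := exists_constantWidthOne h hhs (add_le_of_hess_nonneg hhs
    ((hs.add (hGc.add hGn)).of_le (by norm_cast)) (fun u => by rw [hhn]; positivity) hpos) hhn
  refine ⟨L, ?_, fun u hu => by rw [hL, hhess u hu]⟩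
  refine dist_le_of_abs_supportFn_sub_le _ _ (by positivity) fun u => ?_
  rw [hL]
  have h1 := abs_oscillation_le K hs e t hN θ u
  have h2 := abs_oscillation_le K hs e t hN θ (-u)
  rw [norm_neg] at h2
  have h3 : h u - supportFn K.1 u = G u + -G (-u) := by simp only [hh, hf]; ring
  rw [h3]
  refine (abs_add_le _ _).trans ?_
  rw [abs_neg]
  have : 0 ≤ N⁻¹ * ‖u‖ := by positivity
  have h4 := add_le_add h1 h2
  refine h4.trans ?_
  linarith

theorem integrable_amplitude_mul_sq [MeasurableSpace V] [BorelSpace V] (K : ConstantWidthOne V)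
    (hs : ContDiffOn ℝ ∞ (supportFn K.1) {0}ᶜ) (e t : V) :
    Integrable (fun u => amplitude (supportFn K.1) e u * (hess (supportFn K.1) (-u) t t) ^ 2)
      (volume.restrict (annulus V)) := by
  refine ContinuousOn.integrableOn_compact isCompact_annulus ?_
  refine ContinuousOn.mono ?_ (s := {0}ᶜ) fun u hu => ne_zero_of_mem_annulus hu
  refine ((contDiffOn_amplitude hs e).continuousOn).mul (ContinuousOn.pow ?_ 2)
  have h3 : ContDiffOn ℝ ∞ (fderiv ℝ (phase (supportFn K.1) t)) {0}ᶜ :=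
    (contDiffOn_phase hs t).fderiv_of_isOpen isOpen_compl_singleton (by simp)
  exact ((h3.clm_apply contDiffOn_const).continuousOn).congr
    fun u hu => (fderiv_phase hs t hu t).symm

/-- If the radii of curvature of `K` are positive on a large set of pairs of opposite points, then
bodies arbitrarily close to `K` have support functions whose second derivatives are far in mean. -/
theorem exists_oscillating_perturbations [MeasurableSpace V] [BorelSpace V] (K : ConstantWidthOne V)
    (hs : ContDiffOn ℝ ∞ (supportFn K.1) {0}ᶜ) {δ : ℝ} (hδ : 0 < δ)
    (hK : StronglyConvexWith (supportFn K.1) δ) (e : V) {t : V} (ht : ‖t‖ = 1) {η : ℝ}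
    (hη : 0 < η) : ∃ K₁ K₂ : ConstantWidthOne V, dist K₁ K < η ∧ dist K₂ K < η ∧
      ∫ u in annulus V, amplitude (supportFn K.1) e u * (hess (supportFn K.1) (-u) t t) ^ 2
        ≤ (∫ u in annulus V, |hess (supportFn K₁.1) u t t - hess (supportFn K.1) u t t|)
          + (∫ u in annulus V, |hess (supportFn K₂.1) u t t - hess (supportFn K.1) u t t|) + η := by
  obtain ⟨C, hC0, hC⟩ := exists_hess_supportFn_oscillation_bound K hs e t
  set m := volume.real (annulus V)
  -- The bounds on `N` serve, in this order, the oscillation estimate, convexity, the distance to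
  -- `K`, and the error term integrated over the annulus.
  obtain ⟨N, hN1, hN2, hN3, hN4⟩ : ∃ N : ℝ, 1 ≤ N ∧ 4 * C / δ ≤ N ∧ η⁻¹ < N ∧
      m * (4 * C) / η ≤ N :=
    ((eventually_ge_atTop (1 : ℝ)).and ((eventually_ge_atTop _).and
      ((eventually_gt_atTop _).and (eventually_ge_atTop _)))).exists
  have hN0 : 0 < N := by linarith
  rw [div_le_iff₀ hδ] at hN2
  rw [div_le_iff₀ hη] at hN4
  have hN5 : N⁻¹ < η := inv_lt_of_inv_lt₀ hη hN3
  -- The phase shifts 0 and `π / 2` produce a cosine and a sine, which cannot be small at the same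
  -- point; no averaging over the oscillation is needed.
  obtain ⟨K₁, hd1, h1⟩ := exists_perturbed_body K hs ht hK hN1 (by linarith) (hC N hN1) 0
  obtain ⟨K₂, hd2, h2⟩ := exists_perturbed_body K hs ht hK hN1 (by linarith) (hC N hN1) (Real.pi / 2)
  refine ⟨K₁, K₂, hd1.trans_lt hN5, hd2.trans_lt hN5, ?_⟩
  set f := supportFn K.1 with hf
  set W : V → ℝ := fun u => amplitude f e u * (hess f (-u) t t) ^ 2 with hW
  have hI := integrable_hess (t := t)
  have hD : ∀ L : ConstantWidthOne V, Integrable (fun u => |hess (supportFn L.1) u t t - hess f u t t|)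
      (volume.restrict (annulus V)) := fun L => ((hI L).sub (hI K)).abs
  have hWi : Integrable W (volume.restrict (annulus V)) := integrable_amplitude_mul_sq K hs e t
  have key : ∀ u ∈ annulus V, W u ≤ |hess (supportFn K₁.1) u t t - hess f u t t|
      + |hess (supportFn K₂.1) u t t - hess f u t t| + 4 * C / N := by
    intro u hu
    have hu0 := ne_zero_of_mem_annulus hu
    have hun : -u ∈ annulus V := by simpa [annulus] using hu
    rcases le_or_gt (inner ℝ u e) 0 with hle | hgt
    · have : W u = 0 := by
        simp only [hW, amplitude]
        rw [Real.smoothTransition.zero_of_nonpos (div_nonpos_of_nonpos_of_nonneg hle (norm_nonneg _))]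
        ring
      rw [this]; positivity
    -- Where the oscillation at `u` is active, the reflected one has zero amplitude and cannot
    -- cancel it.
    have h0 : amplitude f e (-u) = 0 := by
      rw [amplitude, inner_neg_left, Real.smoothTransition.zero_of_nonpos
        (div_nonpos_of_nonpos_of_nonneg (by linarith) (norm_nonneg _))]
      ring
    have hW0 : 0 ≤ W u := mul_nonneg (amplitude_nonneg K e hu0
      (differentiableAt_fderiv_of_contDiffOn hs hu0)) (sq_nonneg _)
    have hb : ∀ (L : ConstantWidthOne V) (θ : ℝ), (∀ u ≠ 0, hess (supportFn L.1) u =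
        hess f u + (hess (oscillation f e t N θ) u + -hess (oscillation f e t N θ) (-u))) →
        W u * |Real.cos (N * phase f t u + θ)| ≤ |hess (supportFn L.1) u t t - hess f u t t|
          + 2 * C / N := by
      intro L θ hL
      have b1 := hC N hN1 θ u hu t
      have b2 := hC N hN1 θ (-u) hun t
      rw [h0, zero_mul, zero_mul, add_zero, ht] at b2
      rw [ht] at b1
      rw [hL u hu0]
      simp only [add_apply, neg_apply]
      have e1 : W u * |Real.cos (N * phase f t u + θ)| = |W u * Real.cos (N * phase f t u + θ)| := by
        rw [abs_mul, abs_of_nonneg hW0]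
      have e2 : W u * Real.cos (N * phase f t u + θ)
          = (hess (oscillation f e t N θ) u t t + W u * Real.cos (N * phase f t u + θ))
            + (-(hess f u t t + (hess (oscillation f e t N θ) u t t +
                -hess (oscillation f e t N θ) (-u) t t) - hess f u t t)
              + -hess (oscillation f e t N θ) (-u) t t) := by ring
      rw [e1, e2]
      refine (abs_add_le _ _).trans ?_
      have b3 := abs_add_le (-(hess f u t t + (hess (oscillation f e t N θ) u t t +
                -hess (oscillation f e t N θ) (-u) t t) - hess f u t t))
                (-hess (oscillation f e t N θ) (-u) t t)
      rw [abs_neg, abs_neg] at b3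
      have b4 : 2 * C / N = C / N * 1 ^ 2 + C / N * 1 ^ 2 := by ring
      linarith
    have c1 := hb K₁ 0 h1
    have c2 := hb K₂ (Real.pi / 2) h2
    rw [add_zero] at c1
    rw [Real.cos_add_pi_div_two, abs_neg] at c2
    set x := N * phase f t u
    have c3 : 1 ≤ |Real.cos x| + |Real.sin x| := by
      have := Real.sin_sq_add_cos_sq x
      nlinarith [abs_nonneg (Real.cos x), abs_nonneg (Real.sin x), sq_abs (Real.cos x),
        sq_abs (Real.sin x)]
    have c4 := mul_le_mul_of_nonneg_left c3 hW0
    have c5 : 4 * C / N = 2 * C / N + 2 * C / N := by ring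
    linarith
  have hint : ∫ u in annulus V, W u ≤ ∫ u in annulus V, (|hess (supportFn K₁.1) u t t - hess f u t t|
      + |hess (supportFn K₂.1) u t t - hess f u t t| + 4 * C / N) :=
    setIntegral_mono_on hWi (Integrable.add ((hD K₁).add (hD K₂)) (integrable_const _))
      isClosed_annulus.measurableSet key
  have hD2 : Integrable (fun u => |hess (supportFn K₁.1) u t t - hess f u t t|
      + |hess (supportFn K₂.1) u t t - hess f u t t|) (volume.restrict (annulus V)) :=
    (hD K₁).add (hD K₂)
  rw [integral_add hD2 (integrable_const _), integral_add (hD K₁) (hD K₂),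
    setIntegral_const, smul_eq_mul] at hint
  refine hint.trans (add_le_add le_rfl ?_)
  rw [← mul_div_assoc, div_le_iff₀ hN0]
  linarith

end PerturbedBody

/-! ### The typical behaviour of the second derivatives -/

section Typical

open scoped ContDiff

variable [FiniteDimensional ℝ V] [MeasurableSpace V] [BorelSpace V]

theorem measurePreserving_neg_annulus : MeasurePreserving (fun u : V => -u)
    (volume.restrict (annulus V)) (volume.restrict (annulus V)) := by
  have h := (Measure.measurePreserving_neg (volume : Measure V)).restrict_preimage
    (isClosed_annulus (V := V)).measurableSet
  have e : (Neg.neg ⁻¹' annulus V : Set V) = annulus V := by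
    ext u; simp [annulus]
  rwa [e] at h

theorem integral_annulus_comp_neg (g : V → ℝ) :
    ∫ u in annulus V, g (-u) = ∫ u in annulus V, g u :=
  measurePreserving_neg_annulus.integral_comp (MeasurableEquiv.neg V).measurableEmbedding g

theorem exists_seq_tendsto_ae_of_integral {α : Type*} [MeasurableSpace α] {μ : Measure α}
    {F : ℕ → α → ℝ} (hF : ∀ k, Integrable (F k) μ)
    (h : Tendsto (fun k => ∫ x, |F k x| ∂μ) atTop (𝓝 0)) :
    ∃ ns : ℕ → ℕ, StrictMono ns ∧ ∀ᵐ x ∂μ, Tendsto (fun k => F (ns k) x) atTop (𝓝 0) := by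
  have h1 : Tendsto (fun k => eLpNorm (F k - 0) 1 μ) atTop (𝓝 0) := by
    have h2 : ∀ k, eLpNorm (F k - 0) 1 μ = ENNReal.ofReal (∫ x, |F k x| ∂μ) := fun k => by
      rw [sub_zero, eLpNorm_one_eq_lintegral_enorm, ← ofReal_integral_norm_eq_lintegral_enorm (hF k)]
      rfl
    simp only [h2]
    simpa using ENNReal.tendsto_ofReal h
  have h3 := tendstoInMeasure_of_tendsto_eLpNorm one_ne_zero
    (fun k => (hF k).aestronglyMeasurable) aestronglyMeasurable_zero h1
  exact h3.exists_seq_tendsto_ae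

/-- By continuity at `K`, all bodies near `K` have second derivatives close in mean, including the
oscillating perturbations of a nearby regular `L`; so the integral that measures their deviation
must be small. The constant 3 is two distances of at most `ε` and an error below `ε`. -/
theorem exists_good_approximation [Nontrivial V] {K : ConstantWidthOne V} (T : Finset V)
    (hK : ∀ t ∈ T, ∀ ε > 0, ∃ η > 0, ∀ K₁ K₂ : ConstantWidthOne V,
      dist K₁ K < η → dist K₂ K < η →
      ∫ u in annulus V, |hess (supportFn K₁.1) u t t - hess (supportFn K₂.1) u t t| ≤ ε)
    {ε : ℝ} (hε : 0 < ε) :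
    ∃ L : ConstantWidthOne V, ContDiffOn ℝ ∞ (supportFn L.1) {0}ᶜ ∧ ∀ t ∈ T,
      ∫ u in annulus V, |hess (supportFn L.1) u t t - hess (supportFn K.1) u t t| ≤ ε ∧
      (‖t‖ = 1 → ∀ e, ∫ u in annulus V,
        amplitude (supportFn L.1) e u * (hess (supportFn L.1) (-u) t t) ^ 2 ≤ 3 * ε) := by
  have h1 : ∀ᶠ η in 𝓝[>] (0 : ℝ), ∀ t ∈ T, ∀ K₁ K₂ : ConstantWidthOne V,
      dist K₁ K < η → dist K₂ K < η →
      ∫ u in annulus V, |hess (supportFn K₁.1) u t t - hess (supportFn K₂.1) u t t| ≤ ε := by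
    rw [Filter.eventually_all_finset]
    intro t ht
    obtain ⟨η, hη, h⟩ := hK t ht ε hε
    filter_upwards [Ioo_mem_nhdsGT hη] with s hs K₁ K₂ d1 d2
    exact h K₁ K₂ (d1.trans hs.2) (d2.trans hs.2)
  obtain ⟨η, hη, hη0, hηε⟩ := (h1.and (Ioo_mem_nhdsGT hε)).exists
  obtain ⟨L, hL, hs, δ, hδ, hc⟩ := exists_stronglyConvex_approximation K (half_pos hη0)
  have hLη : dist L K < η := hL.trans (half_lt_self hη0)
  refine ⟨L, hs, fun t ht => ⟨hη t ht L K hLη (by rwa [dist_self]), fun ht1 e => ?_⟩⟩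
  obtain ⟨K₁, K₂, d1, d2, hI⟩ := exists_oscillating_perturbations L hs hδ hc e ht1 (half_pos hη0)
  have e1 := hη t ht K₁ L (by linarith [dist_triangle K₁ L K]) hLη
  have e2 := hη t ht K₂ L (by linarith [dist_triangle K₂ L K]) hLη
  linarith

omit [FiniteDimensional ℝ V] [MeasurableSpace V] [BorelSpace V] in
theorem tendsto_of_polarization {B : ℕ → V →L[ℝ] V →L[ℝ] ℝ} {A : V →L[ℝ] V →L[ℝ] ℝ} {v w : V}
    (hB : ∀ k, B k v w = B k w v) (hA : A v w = A w v)
    (h1 : Tendsto (fun k => B k v v) atTop (𝓝 (A v v)))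
    (h2 : Tendsto (fun k => B k w w) atTop (𝓝 (A w w)))
    (h3 : Tendsto (fun k => B k (v + w) (v + w)) atTop (𝓝 (A (v + w) (v + w)))) :
    Tendsto (fun k => B k v w) atTop (𝓝 (A v w)) := by
  have e : ∀ C : V →L[ℝ] V →L[ℝ] ℝ, C v w = C w v →
      C v w = 1 / 2 * (C (v + w) (v + w) - C v v - C w w) := fun C hC => by
    simp only [map_add, add_apply, ← hC]; ring
  rw [e A hA]
  simp only [fun k => e (B k) (hB k)]
  exact ((h3.sub h1).sub h2).const_mul _

omit [FiniteDimensional ℝ V] [MeasurableSpace V] [BorelSpace V] in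
theorem isStationary_of_hess_eq_zero {K : ConstantWidthOne V} {u : V} (hu : u ≠ 0)
    (hd : DifferentiableAt ℝ (supportPt K.1) (-u))
    (h : ∀ v w, hess (supportFn K.1) (-u) v w = 0) : IsStationary K u := by
  have h1 := hd.hasFDerivAt
  have h2 : fderiv ℝ (supportPt K.1) (-u) = 0 := by
    ext v
    refine ext_inner_right ℝ fun w => ?_
    rw [← hess_supportFn K (neg_ne_zero.2 hu) h1, h]
    simp
  rw [h2] at h1
  have h3 := h1.comp u (hasFDerivAt_id u).neg
  rw [ContinuousLinearMap.zero_comp] at h3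
  exact h3

omit [FiniteDimensional ℝ V] [MeasurableSpace V] [BorelSpace V] in
theorem exists_inner_pos {ι : Type*} [Fintype ι] (b : OrthonormalBasis ι ℝ V) {u : V} (hu : u ≠ 0) :
    ∃ i, 0 < inner ℝ u (b i) ∨ 0 < inner ℝ u (-b i) := by
  by_contra! h
  refine hu (b.repr.map_eq_zero_iff.1 (PiLp.ext fun i => ?_))
  rw [b.repr_apply_apply, real_inner_comm, PiLp.zero_apply]
  have := (h i).2
  rw [inner_neg_right] at this
  linarith [(h i).1]

/-- For a typical body and almost every direction, either some principal radius of curvature in this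
direction vanishes, or all of them vanish in the opposite direction. -/
theorem eventually_residual_ae_det_eq_zero_or_isStationary [Nontrivial V] :
    ∀ᶠ K in residual (ConstantWidthOne V), ∀ᵐ u ∂(volume.restrict (annulus V)),
      (curvatureMatrix (hess (supportFn K.1) u) u).det = 0 ∨ IsStationary K u := by
  classical
  set b := stdOrthonormalBasis ℝ V with hb
  -- The sums of basis vectors are included for polarization, so that all matrix entries converge.
  let T : Finset V := Finset.univ.image b ∪
    Finset.univ.image (fun p : Fin (Module.finrank ℝ V) × Fin (Module.finrank ℝ V) => b p.1 + b p.2)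
  have hT1 : ∀ i, b i ∈ T := fun i =>
    Finset.mem_union_left _ (Finset.mem_image_of_mem _ (Finset.mem_univ _))
  have hT2 : ∀ i j, b i + b j ∈ T := fun i j =>
    Finset.mem_union_right _ (Finset.mem_image.2 ⟨(i, j), Finset.mem_univ _, rfl⟩)
  -- Every nonzero vector has positive inner product with one of these, so the half-spaces of the
  -- cutoffs cover all directions.
  let E : Finset V := Finset.univ.image b ∪ Finset.univ.image (fun i => -b i)
  have hres : ∀ᶠ K in residual (ConstantWidthOne V), ∀ t ∈ T, ∀ ε > 0, ∃ η > 0,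
      ∀ K₁ K₂ : ConstantWidthOne V, dist K₁ K < η → dist K₂ K < η →
      ∫ u in annulus V, |hess (supportFn K₁.1) u t t - hess (supportFn K₂.1) u t t| ≤ ε := by
    rw [Filter.eventually_all_finset]
    exact fun t _ => eventually_residual_continuousAt_hess t
  filter_upwards [hres] with K hK
  choose L hLs hL using fun k : ℕ => exists_good_approximation T hK
    (ε := ((k : ℝ) + 1)⁻¹) (by positivity)
  let D : ℕ → V → V → ℝ := fun k t u => |hess (supportFn (L k).1) u t t - hess (supportFn K.1) u t t|
  let W : ℕ → V → V → V → ℝ := fun k e t u =>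
    amplitude (supportFn (L k).1) e u * (hess (supportFn (L k).1) (-u) t t) ^ 2
  have hDi : ∀ k t, Integrable (D k t) (volume.restrict (annulus V)) := fun k t =>
    ((integrable_hess (L k) t).sub (integrable_hess K t)).abs
  have hDn : ∀ k t, Integrable (fun u => D k t (-u)) (volume.restrict (annulus V)) := fun k t =>
    measurePreserving_neg_annulus.integrable_comp_of_integrable (hDi k t)
  have hWi : ∀ k e t, Integrable (W k e t) (volume.restrict (annulus V)) := fun k e t =>
    integrable_amplitude_mul_sq (L k) (hLs k) e t
  have hD0 : ∀ t ∈ T, Tendsto (fun k => ∫ u in annulus V, D k t u) atTop (𝓝 0) := fun t ht => by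
    refine squeeze_zero (fun k => integral_nonneg fun u => abs_nonneg _) (fun k => (hL k t ht).1) ?_
    simpa using tendsto_one_div_add_atTop_nhds_zero_nat (𝕜 := ℝ)
  have hW0 : ∀ k e t, ∀ u ∈ annulus V, 0 ≤ W k e t u := fun k e t u hu =>
    mul_nonneg (amplitude_nonneg (L k) e (ne_zero_of_mem_annulus hu)
      (differentiableAt_fderiv_of_contDiffOn (hLs k) (ne_zero_of_mem_annulus hu))) (sq_nonneg _)
  have hWt : ∀ e, ∀ i, Tendsto (fun k => ∫ u in annulus V, W k e (b i) u) atTop (𝓝 0) := fun e i => by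
    refine squeeze_zero (fun k => setIntegral_nonneg isClosed_annulus.measurableSet (hW0 k e _))
      (fun k => (hL k (b i) (hT1 i)).2 (b.norm_eq_one i) e) ?_
    have h1 := tendsto_one_div_add_atTop_nhds_zero_nat (𝕜 := ℝ)
    simp only [one_div] at h1
    simpa using h1.const_mul (3 : ℝ)
  -- All quantities that must tend to 0, at `u` and at `-u`, are gathered in one sum, so that a
  -- single subsequence works almost everywhere.
  let F : ℕ → V → ℝ := fun k u => (∑ t ∈ T, (D k t u + D k t (-u)))
    + ∑ e ∈ E, ∑ i, W k e (b i) u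
  have hDa : ∀ k t, Integrable (fun u => D k t u + D k t (-u)) (volume.restrict (annulus V)) :=
    fun k t => (hDi k t).add (hDn k t)
  have hF1i : ∀ k, Integrable (fun u => ∑ t ∈ T, (D k t u + D k t (-u)))
      (volume.restrict (annulus V)) := fun k =>
    integrable_finsetSum _ fun t _ => (hDi k t).add (hDn k t)
  have hF2i : ∀ k, Integrable (fun u => ∑ e ∈ E, ∑ i, W k e (b i) u)
      (volume.restrict (annulus V)) := fun k =>
    integrable_finsetSum _ fun e _ => integrable_finsetSum _ fun i _ => hWi k e _
  have hFi : ∀ k, Integrable (F k) (volume.restrict (annulus V)) := fun k => (hF1i k).add (hF2i k)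
  have hF0 : ∀ k, ∀ u ∈ annulus V, 0 ≤ F k u := fun k u hu =>
    add_nonneg (Finset.sum_nonneg fun t _ => add_nonneg (abs_nonneg _) (abs_nonneg _))
      (Finset.sum_nonneg fun e _ => Finset.sum_nonneg fun i _ => hW0 k e _ u hu)
  have hFt : Tendsto (fun k => ∫ u in annulus V, |F k u|) atTop (𝓝 0) := by
    have e1 : ∀ k, ∫ u in annulus V, |F k u| = (∑ t ∈ T, ((∫ u in annulus V, D k t u)
        + ∫ u in annulus V, D k t u)) + ∑ e ∈ E, ∑ i, ∫ u in annulus V, W k e (b i) u := fun k => by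
      rw [setIntegral_congr_fun isClosed_annulus.measurableSet
        (fun u hu => abs_of_nonneg (hF0 k u hu))]
      rw [integral_add (hF1i k) (hF2i k), integral_finsetSum _ fun t _ => hDa k t,
        integral_finsetSum _ fun e _ => integrable_finsetSum _ fun i _ => hWi k e _]
      congr 1
      · refine Finset.sum_congr rfl fun t _ => ?_
        rw [integral_add (hDi k t) (hDn k t), integral_annulus_comp_neg (D k t)]
      · exact Finset.sum_congr rfl fun e _ => integral_finsetSum _ fun i _ => hWi k e _
    simp only [e1]
    have e2 := (tendsto_finsetSum T fun t ht => (hD0 t ht).add (hD0 t ht)).add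
      (tendsto_finsetSum E fun e _ => tendsto_finsetSum Finset.univ fun i _ => hWt e i)
    simpa using e2
  obtain ⟨ns, -, hns⟩ := exists_seq_tendsto_ae_of_integral hFi hFt
  filter_upwards [hns, ae_restrict_annulus_mem, ae_differentiableAt_fderiv_supportFn K,
    ae_differentiableAt_supportPt K,
    measurePreserving_neg_annulus.quasiMeasurePreserving.ae (ae_differentiableAt_fderiv_supportFn K),
    measurePreserving_neg_annulus.quasiMeasurePreserving.ae (ae_differentiableAt_supportPt K)]
    with u hu hmem hd1 hd2 hdn1 hdn2
  have hu0 := ne_zero_of_mem_annulus hmem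
  have hn0 : -u ≠ 0 := neg_ne_zero.2 hu0
  have hS0 : ∀ k, 0 ≤ ∑ e ∈ E, ∑ i, W k e (b i) u := fun k =>
    Finset.sum_nonneg fun e _ => Finset.sum_nonneg fun i _ => hW0 k e _ u hmem
  have hS1 : ∀ k, 0 ≤ ∑ t ∈ T, (D k t u + D k t (-u)) := fun k =>
    Finset.sum_nonneg fun t _ => add_nonneg (abs_nonneg _) (abs_nonneg _)
  have hDu : ∀ t ∈ T, ∀ k, D k t u + D k t (-u) ≤ F k u := fun t ht k =>
    (Finset.single_le_sum (f := fun t => D k t u + D k t (-u))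
      (fun t _ => add_nonneg (abs_nonneg _) (abs_nonneg _)) ht).trans
      (le_add_of_nonneg_right (hS0 k))
  have hWu : ∀ e ∈ E, ∀ i k, W k e (b i) u ≤ F k u := fun e he i k =>
    ((Finset.single_le_sum (f := fun i => W k e (b i) u) (fun i _ => hW0 k e _ u hmem)
      (Finset.mem_univ i)).trans (Finset.single_le_sum (f := fun e => ∑ i, W k e (b i) u)
      (fun e _ => Finset.sum_nonneg fun i _ => hW0 k e _ u hmem) he)).trans
      (le_add_of_nonneg_left (hS1 k))
  have c1 : ∀ t ∈ T, Tendsto (fun k => hess (supportFn (L (ns k)).1) u t t) atTop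
      (𝓝 (hess (supportFn K.1) u t t)) := fun t ht => by
    rw [tendsto_iff_dist_tendsto_zero]
    exact squeeze_zero (fun k => dist_nonneg) (fun k => (le_add_of_nonneg_right
      (abs_nonneg _)).trans (hDu t ht (ns k))) hu
  have c2 : ∀ t ∈ T, Tendsto (fun k => hess (supportFn (L (ns k)).1) (-u) t t) atTop
      (𝓝 (hess (supportFn K.1) (-u) t t)) := fun t ht => by
    rw [tendsto_iff_dist_tendsto_zero]
    exact squeeze_zero (fun k => dist_nonneg) (fun k => (le_add_of_nonneg_left
      (abs_nonneg _)).trans (hDu t ht (ns k))) hu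
  have c3 : ∀ i j, Tendsto (fun k => hess (supportFn (L (ns k)).1) u (b i) (b j)) atTop
      (𝓝 (hess (supportFn K.1) u (b i) (b j))) := fun i j =>
    tendsto_of_polarization (fun k => hess_supportFn_symm _ hu0
      (differentiableAt_fderiv_of_contDiffOn (hLs _) hu0) _ _)
      (hess_supportFn_symm _ hu0 hd1 _ _) (c1 _ (hT1 i)) (c1 _ (hT1 j)) (c1 _ (hT2 i j))
  have c4 : Tendsto (fun k => (curvatureMatrix (hess (supportFn (L (ns k)).1) u) u).det) atTop
      (𝓝 (curvatureMatrix (hess (supportFn K.1) u) u).det) := by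
    refine (continuous_id.matrix_det.tendsto _).comp ?_
    refine tendsto_pi_nhds.2 fun i => tendsto_pi_nhds.2 fun j => ?_
    exact ((c3 j i).const_mul _).add_const _
  refine or_iff_not_imp_left.2 fun hdet => ?_
  obtain ⟨e, heE, he⟩ : ∃ e ∈ E, 0 < inner ℝ u e := by
    obtain ⟨i, hi | hi⟩ := exists_inner_pos b hu0
    · exact ⟨_, Finset.mem_union_left _ (Finset.mem_image_of_mem _ (Finset.mem_univ i)), hi⟩
    · exact ⟨_, Finset.mem_union_right _ (Finset.mem_image.2 ⟨i, Finset.mem_univ i, rfl⟩), hi⟩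
  have c5 : Tendsto (fun k => amplitude (supportFn (L (ns k)).1) e u) atTop
      (𝓝 (amplitude (supportFn K.1) e u)) := ((c4.const_mul _).const_mul _).const_mul _
  have hamp : amplitude (supportFn K.1) e u ≠ 0 := by
    have h1 := Real.smoothTransition.pos_of_pos (div_pos he (norm_pos_iff.2 hu0))
    have h2 := norm_pos_iff.2 hu0
    rw [amplitude]
    exact mul_ne_zero (by norm_num) (mul_ne_zero h1.ne' (mul_ne_zero h2.ne' hdet))
  have c6 : ∀ i, hess (supportFn K.1) (-u) (b i) (b i) = 0 := fun i => by
    have h1 : Tendsto (fun k => W (ns k) e (b i) u) atTop (𝓝 0) :=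
      squeeze_zero (fun k => hW0 _ _ _ u hmem) (fun k => hWu e heE i _) hu
    have h2 := tendsto_nhds_unique h1 (c5.mul ((c2 _ (hT1 i)).pow 2))
    exact pow_eq_zero_iff two_ne_zero |>.1 ((mul_eq_zero.1 h2.symm).resolve_left hamp)
  -- By Cauchy-Schwarz for a nonnegative form, a zero on the diagonal annihilates its row.
  have c7 : ∀ i w, hess (supportFn K.1) (-u) (b i) w = 0 := fun i w => by
    have h1 := sq_apply_le_of_nonneg _ (hess_supportFn_symm K hn0 hdn1)
      (hess_supportFn_nonneg K hn0 hdn1) (b i) w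
    rw [c6, zero_mul] at h1
    exact pow_eq_zero_iff two_ne_zero |>.1 (le_antisymm h1 (sq_nonneg _))
  refine isStationary_of_hess_eq_zero hu0 hdn2 fun v w => ?_
  have h1 : (hess (supportFn K.1) (-u) : V →ₗ[ℝ] V →L[ℝ] ℝ) = 0 :=
    b.toBasis.ext fun i => by
      ext w
      rw [OrthonormalBasis.coe_toBasis]
      exact c7 i w
  exact DFunLike.congr_fun (DFunLike.congr_fun h1 v) w

end Typical

/-! ### Projections along a direction -/

section Splitting

/-- The decomposition of a vector into its parts orthogonal and parallel to the unit vector `e`. -/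
def splitting {e : V} (he : ‖e‖ = 1) : V ≃ₗ[ℝ] (ℝ ∙ e)ᗮ × ℝ where
  toFun x := (⟨x - inner ℝ e x • e, by
    rw [Submodule.mem_orthogonal_singleton_iff_inner_right, inner_sub_right, inner_smul_right,
      real_inner_self_eq_norm_sq, he]
    ring⟩, inner ℝ e x)
  map_add' x y := by
    ext
    · simp only [inner_add_right, Prod.fst_add, Submodule.coe_add]; module
    · simp [inner_add_right]
  map_smul' c x := by
    ext
    · simp only [inner_smul_right, RingHom.id_apply, Prod.smul_fst, Submodule.coe_smul]; module
    · simp [inner_smul_right]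
  invFun p := (p.1 : V) + p.2 • e
  left_inv x := by simp
  right_inv p := by
    have h1 : inner ℝ e (p.1 : V) = 0 :=
      (Submodule.mem_orthogonal_singleton_iff_inner_right).1 p.1.2
    have h2 : inner ℝ e ((p.1 : V) + p.2 • e) = p.2 := by
      rw [inner_add_right, h1, inner_smul_right, real_inner_self_eq_norm_sq, he]; ring
    ext
    · simp only [h2]; abel
    · simp only [h2]

theorem splitting_symm_apply {e : V} (he : ‖e‖ = 1) (p : (ℝ ∙ e)ᗮ × ℝ) :
    (splitting he).symm p = (p.1 : V) + p.2 • e := rfl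

theorem coe_splitting_fst {e : V} (he : ‖e‖ = 1) (x : V) :
    (((splitting he x).1 : (ℝ ∙ e)ᗮ) : V) = x - inner ℝ e x • e := rfl

theorem splitting_fst_add_smul {e : V} (he : ‖e‖ = 1) (x : V) (s : ℝ) :
    (splitting he (x + s • e)).1 = (splitting he x).1 := by
  ext
  rw [coe_splitting_fst, coe_splitting_fst, inner_add_right, inner_smul_right,
    real_inner_self_eq_norm_sq, he]
  module

theorem norm_splitting_fst_le {e : V} (he : ‖e‖ = 1) (x : V) : ‖(splitting he x).1‖ ≤ ‖x‖ := by
  change ‖x - inner ℝ e x • e‖ ≤ ‖x‖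
  refine le_of_sq_le_sq ?_ (norm_nonneg _)
  rw [norm_sub_sq_real, inner_smul_right, norm_smul, he, real_inner_comm, mul_one,
    Real.norm_eq_abs, sq_abs]
  nlinarith [sq_nonneg (inner ℝ e x)]

theorem lipschitzWith_splitting_fst {e : V} (he : ‖e‖ = 1) :
    LipschitzWith 1 fun x => (splitting he x).1 :=
  LipschitzWith.of_dist_le_mul fun x y => by
    rw [dist_eq_norm, dist_eq_norm, NNReal.coe_one, one_mul, ← Prod.fst_sub, ← map_sub]
    exact norm_splitting_fst_le he _

theorem finrank_orthogonal_add_one [FiniteDimensional ℝ V] {e : V} (he : ‖e‖ = 1) :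
    Module.finrank ℝ (ℝ ∙ e)ᗮ + 1 = Module.finrank ℝ V := by
  have h1 := Submodule.finrank_add_finrank_orthogonal (ℝ ∙ e)
  rw [finrank_span_singleton (ne_zero_of_norm_eq_one he)] at h1
  omega

variable [FiniteDimensional ℝ V] [MeasurableSpace V] [BorelSpace V]

/-- If the union of the unit segments in direction `e` with lower endpoints in `X` has measure zero,
then so has the projection of `X` in direction `e`. -/
theorem volume_projection_eq_zero {e : V} (he : ‖e‖ = 1) {X Y : Set V} (hY : volume Y = 0)
    (hXY : ∀ x ∈ X, ∀ r ∈ Set.Icc (1 : ℝ) 2, x + r • e ∈ Y) :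
    volume ((fun x => (splitting he x).1) '' X) = 0 := by
  set T : V ≃L[ℝ] (ℝ ∙ e)ᗮ × ℝ := (splitting he).toContinuousLinearEquiv
  have hac : ((volume : Measure (ℝ ∙ e)ᗮ).prod (volume : Measure ℝ)) ≪ (volume : Measure V).map T :=
    haveI : ((volume : Measure V).map T).IsAddHaarMeasure := T.isAddHaarMeasure_map _
    Measure.absolutelyContinuous_isAddHaarMeasure _ _
  have h1 : ∀ᵐ z ∂((volume : Measure (ℝ ∙ e)ᗮ).prod (volume : Measure ℝ)),
      (splitting he).symm z ∉ Y := by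
    refine hac.ae_le (T.toHomeomorph.measurableEmbedding.ae_map_iff.2 ?_)
    filter_upwards [measure_eq_zero_iff_ae_notMem.1 hY] with x hx
    have : (splitting he).symm (T.toHomeomorph x) = x := (splitting he).symm_apply_apply x
    rwa [this]
  have h2 := Measure.ae_ae_of_ae_prod h1
  refine measure_mono_null ?_ h2
  rintro _ ⟨x, hx, rfl⟩ hae
  -- Almost every point of the line over the projection of `x` avoids `Y`, but a whole unit segment
  -- of it lies in `Y`.
  have h3 : ∀ᵐ s ∂(volume : Measure ℝ), s ∉ Set.Icc (inner ℝ e x + 1) (inner ℝ e x + 2) := by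
    filter_upwards [hae] with s hs hmem
    refine hs ?_
    have := hXY x hx (s - inner ℝ e x) ⟨by linarith [hmem.1], by linarith [hmem.2]⟩
    rw [splitting_symm_apply, coe_splitting_fst]
    convert this using 1
    module
  rw [ae_iff] at h3
  simp only [not_not] at h3
  have h4 : volume (Set.Icc (inner ℝ e x + 1) (inner ℝ e x + 2)) = 0 := h3
  rw [Real.volume_Icc] at h4
  norm_num at h4

theorem hausdorffMeasure_eq_zero_iff {W : Type*} [NormedAddCommGroup W] [InnerProductSpace ℝ W]
    [FiniteDimensional ℝ W] [MeasurableSpace W] [BorelSpace W] (s : Set W) :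
    Measure.hausdorffMeasure (Module.finrank ℝ W) s = 0 ↔ volume s = 0 :=
  ⟨fun h => Measure.absolutelyContinuous_isAddHaarMeasure _ _ h,
    fun h => Measure.absolutelyContinuous_isAddHaarMeasure _ _ h⟩

end Splitting

/-! ### The set of support points in non-stationary directions -/

section Negligible

variable {K : ConstantWidthOne V}

theorem IsStationary.smul {u : V} (h : IsStationary K u) (hu : u ≠ 0) {c : ℝ} (hc : 0 < c) :
    IsStationary K (c • u) := by
  have h1 : HasFDerivAt (fun w : V => c⁻¹ • w) (c⁻¹ • ContinuousLinearMap.id ℝ V) (c • u) :=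
    (hasFDerivAt_id _).const_smul _
  have h2 : HasFDerivAt (fun w => supportPt K.1 (-w)) (0 : V →L[ℝ] V) (c⁻¹ • c • u) := by
    rwa [inv_smul_smul₀ hc.ne']
  have h3 := h2.comp (c • u) h1
  rw [ContinuousLinearMap.zero_comp] at h3
  refine h3.congr_of_eventuallyEq ?_
  filter_upwards [isOpen_compl_singleton.mem_nhds (smul_ne_zero hc.ne' hu)] with w hw
  change supportPt K.1 (-w) = supportPt K.1 (-(c⁻¹ • w))
  rw [← smul_neg, supportPt_smul K (neg_ne_zero.2 hw) (inv_pos.2 hc)]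

theorem hasFDerivAt_norm_of_ne_zero {u : V} (hu : u ≠ 0) :
    HasFDerivAt (fun v : V => ‖v‖) (‖u‖⁻¹ • innerSL ℝ u) u := by
  have h1 := (hasStrictFDerivAt_norm_sq u).hasFDerivAt.sqrt (by simpa using hu)
  simp only [Real.sqrt_sq (norm_nonneg _)] at h1
  convert h1 using 1
  have : ‖u‖ ≠ 0 := norm_ne_zero_iff.2 hu
  ext w
  simp only [smul_apply, smul_eq_mul, nsmul_eq_mul]
  field_simp
  norm_num

/-- Two support points with outer normal vectors close to `e` are separated by their projections. -/
theorem norm_supportPt_sub_le_projection {e u v : V} (he : ‖e‖ = 1) (hu : ‖u‖ = 1) (hv : ‖v‖ = 1)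
    {c : ℝ} (hc : 0 < c) (hcu : c ≤ inner ℝ u e) (hcv : c ≤ inner ℝ v e) :
    ‖supportPt K.1 u - supportPt K.1 v‖ ≤ (1 + c⁻¹) *
      ‖(splitting he (supportPt K.1 u)).1 - (splitting he (supportPt K.1 v)).1‖ := by
  set d := supportPt K.1 u - supportPt K.1 v with hd
  rw [← Prod.fst_sub, ← map_sub, ← hd]
  have hn : ‖(splitting he d).1‖ = ‖d - inner ℝ e d • e‖ := rfl
  rw [hn]
  set p := d - inner ℝ e d • e with hp
  set s := inner ℝ e d with hs
  have hdps : d = p + s • e := by rw [hp]; abel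
  have h1 : 0 ≤ inner ℝ d u := inner_supportPt_sub_nonneg K.1 u (supportPt_mem _ _)
  have h2 : 0 ≤ inner ℝ (-d) v := by
    rw [hd, neg_sub]; exact inner_supportPt_sub_nonneg K.1 v (supportPt_mem _ _)
  rw [inner_neg_left] at h2
  rw [hdps, inner_add_left, real_inner_smul_left, real_inner_comm] at h1 h2
  rw [real_inner_comm] at hcu hcv
  have b1 : inner ℝ u p ≤ ‖p‖ := by
    have := real_inner_le_norm u p; rwa [hu, one_mul] at this
  have b2 : -‖p‖ ≤ inner ℝ v p := by
    have := (abs_le.1 (abs_real_inner_le_norm v p)).1; rwa [hv, one_mul] at this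
  have hp0 := norm_nonneg p
  -- For `s ≥ 0` this uses `⟪d, v⟫ ≤ 0`, for `s ≤ 0` it uses `⟪d, u⟫ ≥ 0`.
  have habs : c * |s| ≤ ‖p‖ := by
    rcases le_total 0 s with h | h
    · rw [abs_of_nonneg h]; nlinarith
    · rw [abs_of_nonpos h]; nlinarith
  have habs2 : |s| ≤ c⁻¹ * ‖p‖ := by
    rw [inv_mul_eq_div, le_div_iff₀ hc]; linarith
  calc ‖d‖ = ‖p + s • e‖ := by rw [← hdps]
    _ ≤ ‖p‖ + ‖s • e‖ := norm_add_le _ _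
    _ = ‖p‖ + |s| := by rw [norm_smul, he, mul_one, Real.norm_eq_abs]
    _ ≤ _ := by linarith

theorem hausdorffMeasure_eq_zero_of_projection {X : Type*} {Y : Type*} [EMetricSpace X]
    [MeasurableSpace X] [BorelSpace X] [EMetricSpace Y] [MeasurableSpace Y] [BorelSpace Y]
    {s : Set X} {f : X → Y} {C : ℝ≥0} (hf : ∀ x ∈ s, ∀ y ∈ s, edist x y ≤ C * edist (f x) (f y))
    {d : ℝ} (hd : 0 ≤ d) (h : Measure.hausdorffMeasure d (f '' s) = 0) :
    Measure.hausdorffMeasure d s = 0 := by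
  have h1 : AntilipschitzWith C (s.domRestrict f) := fun x y => hf x x.2 y y.2
  have h2 := h1.le_hausdorffMeasure_image hd Set.univ
  rw [Set.image_univ, Set.range_domRestrict, h, mul_zero, nonpos_iff_eq_zero] at h2
  have h3 := (isometry_subtype_coe (s := s)).hausdorffMeasure_image (Or.inl hd) Set.univ
  rw [Set.image_univ, Subtype.range_coe, h2] at h3
  exact h3

variable [FiniteDimensional ℝ V] [MeasurableSpace V] [BorelSpace V]

omit [MeasurableSpace V] [BorelSpace V] in
-- A kernel vector of the completed curvature operator is orthogonal to `u`, hence killed by the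
-- derivative of the norm; it is then also killed by `A`.
theorem det_fderiv_supportPt_add_eq_zero {u e : V} {A : V →L[ℝ] V} (hu : u ≠ 0)
    (hA : HasFDerivAt (supportPt K.1) A u)
    (hdet : (curvatureMatrix (hess (supportFn K.1) u) u).det = 0) :
    (A + (‖u‖⁻¹ • innerSL ℝ u).smulRight e).det = 0 := by
  have hd : DifferentiableAt ℝ (fderiv ℝ (supportFn K.1)) u :=
    (hasFDerivAt_fderiv_supportFn K hu hA).differentiableAt
  have hun : 0 < ‖u‖ := norm_pos_iff.2 hu
  rw [← det_curvatureOp, LinearMap.det_eq_zero_iff_ker_ne_bot] at hdet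
  obtain ⟨w, hw, hw0⟩ := (Submodule.ne_bot_iff _).1 hdet
  have h1 : ∀ z, ‖u‖ * inner ℝ (A w) z + (‖u‖ ^ 2)⁻¹ * inner ℝ u w * inner ℝ u z = 0 := fun z => by
    rw [← hess_supportFn K hu hA, ← inner_curvatureOp, LinearMap.mem_ker.1 hw, inner_zero_left]
  have h2 : inner ℝ (A w) u = 0 := by
    rw [← hess_supportFn K hu hA, hess_supportFn_symm K hu hd,
      hess_self_of_homogeneous (supportFn_smul_of_pos K.1) hd]
    rfl
  have h3 : inner ℝ u w = 0 := by
    have := h1 u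
    rw [h2, real_inner_self_eq_norm_sq] at this
    field_simp at this
    linarith
  have h4 : A w = 0 := by
    refine ext_inner_right ℝ fun z => ?_
    have := h1 z
    rw [h3, mul_zero, zero_mul, add_zero] at this
    rw [inner_zero_left]
    exact (mul_eq_zero.1 this).resolve_left hun.ne'
  change LinearMap.det _ = 0
  rw [LinearMap.det_eq_zero_iff_ker_ne_bot, Submodule.ne_bot_iff]
  refine ⟨w, ?_, hw0⟩
  rw [LinearMap.mem_ker]
  simp [h3, h4]

/-- Sard's lemma applies on `D`, where the derivative is singular, and the Lipschitz map sends the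
null set `Z` to a null set. The support point is constant along rays; the term `‖u‖ • e` restores
the lost dimension, so that volume in `V` can be used. -/
theorem volume_image_supportPt_add_eq_zero (e : V)
    (h : ∀ᵐ u ∂(volume.restrict (annulus V)),
      (curvatureMatrix (hess (supportFn K.1) u) u).det = 0 ∨ IsStationary K u) :
    volume ((fun u => supportPt K.1 u + ‖u‖ • e) '' {u ∈ annulus V | ¬ IsStationary K u}) = 0 := by
  set Ψ : V → V := fun u => supportPt K.1 u + ‖u‖ • e with hΨ
  set D : Set V := {u ∈ annulus V | DifferentiableAt ℝ (supportPt K.1) u ∧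
    (curvatureMatrix (hess (supportFn K.1) u) u).det = 0}
  set Z : Set V := {u ∈ annulus V | ¬ (DifferentiableAt ℝ (supportPt K.1) u ∧
    ((curvatureMatrix (hess (supportFn K.1) u) u).det = 0 ∨ IsStationary K u))}
  have hD : volume (Ψ '' D) = 0 := by
    refine addHaar_image_eq_zero_of_det_fderivWithin_eq_zero (μ := volume)
      (f' := fun u => fderiv ℝ (supportPt K.1) u + (‖u‖⁻¹ • innerSL ℝ u).smulRight e) ?_ ?_
    · intro u hu
      exact (hu.2.1.hasFDerivAt.add ((hasFDerivAt_norm_of_ne_zero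
        (ne_zero_of_mem_annulus hu.1)).smul_const e)).hasFDerivWithinAt
    · intro u hu
      exact det_fderiv_supportPt_add_eq_zero (ne_zero_of_mem_annulus hu.1) hu.2.1.hasFDerivAt hu.2.2
  have hZ0 : volume Z = 0 := by
    have h1 := (ae_differentiableAt_supportPt K).and h
    rw [ae_restrict_iff' isClosed_annulus.measurableSet] at h1
    refine measure_mono_null ?_ h1
    intro u hu hu'
    exact hu.2 (hu' hu.1)
  have hZ : volume (Ψ '' Z) = 0 := by
    rw [← hausdorffMeasure_eq_zero_iff] at hZ0 ⊢
    have hl : LipschitzOnWith (4 + ‖e‖₊) Ψ Z := by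
      refine LipschitzOnWith.add ?_ ?_
      · refine (lipschitzOnWith_supportPt K).mono fun u hu => ?_
        have := hu.1.1
        simp only [Set.mem_ofPred_eq]
        linarith
      · refine LipschitzOnWith.of_dist_le_mul fun u _ v _ => ?_
        rw [dist_eq_norm, dist_eq_norm, ← sub_smul, norm_smul, mul_comm]
        exact mul_le_mul_of_nonneg_left (abs_norm_sub_norm_le u v) (norm_nonneg _)
    have := hl.hausdorffMeasure_image_le (d := Module.finrank ℝ V) (Nat.cast_nonneg _)
    rw [hZ0, mul_zero] at this
    exact le_antisymm this zero_le
  refine measure_mono_null ?_ (measure_union_null hD hZ)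
  rw [← Set.image_union]
  refine Set.image_mono fun u hu => ?_
  by_cases h1 : DifferentiableAt ℝ (supportPt K.1) u ∧
    ((curvatureMatrix (hess (supportFn K.1) u) u).det = 0 ∨ IsStationary K u)
  · exact Or.inl ⟨hu.1, h1.1, h1.2.resolve_right hu.2⟩
  · exact Or.inr ⟨hu.1, h1⟩

/-- The support points in non-stationary directions form a null set in the boundary. -/
theorem hausdorffMeasure_nonstationary_eq_zero [Nontrivial V]
    (h : ∀ᵐ u ∂(volume.restrict (annulus V)),
      (curvatureMatrix (hess (supportFn K.1) u) u).det = 0 ∨ IsStationary K u) :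
    Measure.hausdorffMeasure ((Module.finrank ℝ V : ℝ) - 1)
      (supportPt K.1 '' {u | ‖u‖ = 1 ∧ ¬ IsStationary K u}) = 0 := by
  have hr : (0 : ℝ) ≤ (Module.finrank ℝ V : ℝ) - 1 := by
    have : 1 ≤ Module.finrank ℝ V := Module.finrank_pos
    have : (1 : ℝ) ≤ Module.finrank ℝ V := by exact_mod_cast this
    linarith
  -- The multiples `r • u` with `r` in `[1, 2]` sweep out a segment in direction `e` over each
  -- support point. Fubini turns the null volume into a null projection, and on normals with `⟪u, e⟫
  -- ≥ c` the projection has a Lipschitz inverse.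
  have key : ∀ e : V, ‖e‖ = 1 → ∀ m : ℕ, Measure.hausdorffMeasure ((Module.finrank ℝ V : ℝ) - 1)
      (supportPt K.1 '' {u | (‖u‖ = 1 ∧ ¬ IsStationary K u) ∧ ((m : ℝ) + 1)⁻¹ ≤ inner ℝ u e})
        = 0 := by
    intro e he m
    set c : ℝ := ((m : ℝ) + 1)⁻¹ with hc
    have hc0 : 0 < c := by positivity
    refine hausdorffMeasure_eq_zero_of_projection (f := fun x => (splitting he x).1)
      (C := (1 + c⁻¹).toNNReal) ?_ hr ?_
    · rintro _ ⟨u, ⟨⟨hu, -⟩, hcu⟩, rfl⟩ _ ⟨v, ⟨⟨hv, -⟩, hcv⟩, rfl⟩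
      rw [edist_dist, edist_dist, ← ENNReal.ofReal_coe_nnreal, ← ENNReal.ofReal_mul (by positivity),
        Real.coe_toNNReal _ (by positivity), dist_eq_norm, dist_eq_norm]
      exact ENNReal.ofReal_le_ofReal (norm_supportPt_sub_le_projection he hu hv hc0 hcu hcv)
    · have hfr : (Module.finrank ℝ V : ℝ) - 1 = (Module.finrank ℝ (ℝ ∙ e)ᗮ : ℕ) := by
        rw [← finrank_orthogonal_add_one he]; push_cast; ring
      rw [hfr, hausdorffMeasure_eq_zero_iff]
      refine volume_projection_eq_zero he (volume_image_supportPt_add_eq_zero (K := K) e h) ?_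
      rintro _ ⟨u, ⟨⟨hu, hst⟩, -⟩, rfl⟩ r ⟨hr1, hr2⟩
      have hr0 : 0 < r := by linarith
      have hu0 := ne_zero_of_norm_eq_one hu
      have hn : ‖r • u‖ = r := by rw [norm_smul, hu, mul_one, Real.norm_of_nonneg hr0.le]
      refine ⟨r • u, ⟨⟨by rw [hn]; exact hr1, by rw [hn]; exact hr2⟩, fun hs => hst ?_⟩, ?_⟩
      · have := hs.smul (smul_ne_zero hr0.ne' hu0) (inv_pos.2 hr0)
        rwa [inv_smul_smul₀ hr0.ne'] at this
      · change supportPt K.1 (r • u) + ‖r • u‖ • e = _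
        rw [hn, supportPt_smul K hu0 hr0]
  set b := stdOrthonormalBasis ℝ V
  refine measure_mono_null (t := ⋃ (i) (m : ℕ),
    (supportPt K.1 '' {u | (‖u‖ = 1 ∧ ¬ IsStationary K u) ∧ ((m : ℝ) + 1)⁻¹ ≤ inner ℝ u (b i)}) ∪
    (supportPt K.1 '' {u | (‖u‖ = 1 ∧ ¬ IsStationary K u) ∧ ((m : ℝ) + 1)⁻¹ ≤ inner ℝ u (-b i)}))
    ?_ ?_
  · rintro _ ⟨u, hu, rfl⟩
    obtain ⟨i, hi | hi⟩ := exists_inner_pos b (ne_zero_of_norm_eq_one hu.1)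
    · obtain ⟨m, hm⟩ := exists_nat_one_div_lt hi
      rw [one_div] at hm
      exact Set.mem_iUnion₂.2 ⟨i, m, Or.inl ⟨u, ⟨hu, hm.le⟩, rfl⟩⟩
    · obtain ⟨m, hm⟩ := exists_nat_one_div_lt hi
      rw [one_div] at hm
      exact Set.mem_iUnion₂.2 ⟨i, m, Or.inr ⟨u, ⟨hu, hm.le⟩, rfl⟩⟩
  · refine measure_iUnion_null fun i => measure_iUnion_null fun m => measure_union_null
      (key _ (b.norm_eq_one i) m) (key _ (by rw [norm_neg]; exact b.norm_eq_one i) m)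

end Negligible

/-! ### Conclusion -/

section Conclusion

variable [FiniteDimensional ℝ V] [Nontrivial V] {K : ConstantWidthOne V}

omit [FiniteDimensional ℝ V] [Nontrivial V] in
theorem mem_frontier_of_top {u z : V} (hz : z ∈ (K.1 : Set V))
    (h : ∀ s : ℝ, 0 < s → z + s • u ∉ (K.1 : Set V)) : z ∈ frontier (K.1 : Set V) := by
  rw [frontier, K.1.isClosed.closure_eq]
  refine ⟨hz, fun hint => ?_⟩
  have hc : Tendsto (fun s : ℝ => z + s • u) (𝓝[>] 0) (𝓝 z) := by
    have : Continuous fun s : ℝ => z + s • u := by fun_prop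
    simpa using (this.tendsto 0).mono_left nhdsWithin_le_nhds
  obtain ⟨s, hs1, hs2⟩ := ((hc.eventually (mem_interior_iff_mem_nhds.1 hint)).and
    self_mem_nhdsWithin).exists
  exact h s hs2 hs1

variable [MeasurableSpace V] [BorelSpace V]

/-- The support points in the directions close to `u` form a set of positive measure. -/
theorem IsSmooth.hausdorffMeasure_image_supportPt_ne_zero (hK : IsSmooth K) {u : V} (hu : ‖u‖ = 1)
    {N : Set V} (hN : N ∈ 𝓝 u) :
    Measure.hausdorffMeasure ((Module.finrank ℝ V : ℝ) - 1)
      (supportPt K.1 '' {w | ‖w‖ = 1 ∧ w ∈ N}) ≠ 0 := by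
  intro h0
  have hfr : (Module.finrank ℝ V : ℝ) - 1 = (Module.finrank ℝ (ℝ ∙ u)ᗮ : ℕ) := by
    rw [← finrank_orthogonal_add_one hu]; push_cast; ring
  rw [hfr] at h0
  have h1 := (lipschitzWith_splitting_fst hu).hausdorffMeasure_image_le
    (d := (Module.finrank ℝ (ℝ ∙ u)ᗮ : ℕ)) (Nat.cast_nonneg _)
    (supportPt K.1 '' {w | ‖w‖ = 1 ∧ w ∈ N})
  rw [h0, mul_zero, nonpos_iff_eq_zero, hausdorffMeasure_eq_zero_iff] at h1
  obtain ⟨ε, hε, hball⟩ := Metric.eventually_nhds_iff.1 (hK.eventually_normal_mem hu hN)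
  obtain ⟨δ, hδ, hδt⟩ := exists_top_point K hu hε
  set x := supportPt K.1 u
  refine (Metric.measure_ball_pos volume ((splitting hu x).1) hδ).ne' (measure_mono_null ?_ h1)
  -- The projections fill a ball: over each `p` near the projection of `x`, the line parallel to `u`
  -- has a top point of `K` close to `x`, and its normals lie in `N` by smoothness.
  intro p hp
  set v : V := ((p - (splitting hu x).1 : (ℝ ∙ u)ᗮ) : V) with hv
  have hvu : inner ℝ v u = 0 :=
    Submodule.mem_orthogonal_singleton_iff_inner_left.1 (p - (splitting hu x).1).2
  have hvn : ‖v‖ < δ := by rwa [mem_ball_iff_norm] at hp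
  obtain ⟨l, hl1, hl2, hl3⟩ := hδt v hvu hvn
  have hfront : x + v + l • u ∈ frontier (K.1 : Set V) := by
    refine mem_frontier_of_top (u := u) hl1 fun s hs => ?_
    rw [add_assoc, ← add_smul]
    exact hl2 _ (by linarith)
  obtain ⟨w, hw, hxw⟩ := exists_eq_supportPt_of_mem_frontier K hfront
  refine ⟨x + v + l • u, ⟨w, ⟨hw, hball ?_ w hw hxw⟩, hxw.symm⟩, ?_⟩
  · rw [dist_eq_norm, add_assoc, add_sub_cancel_left]
    exact hl3
  · change (splitting hu (x + v + l • u)).1 = p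
    rw [splitting_fst_add_smul, map_add, Prod.fst_add]
    ext
    rw [Submodule.coe_add, coe_splitting_fst hu v, real_inner_comm, hvu, zero_smul, sub_zero, hv,
      ← Submodule.coe_add, add_sub_cancel]

/-- Countable sets are null for Hausdorff measure of positive dimension, which is where `n ≥ 2`
enters. Together with `h0`, a countable set of stationary directions would leave a boundary patch of
measure zero. -/
theorem IsSmooth.not_countable_stationary (hK : IsSmooth K) (hn : 2 ≤ Module.finrank ℝ V)
    (h0 : Measure.hausdorffMeasure ((Module.finrank ℝ V : ℝ) - 1)
      (supportPt K.1 '' {u | ‖u‖ = 1 ∧ ¬ IsStationary K u}) = 0)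
    {u : V} (hu : ‖u‖ = 1) {N : Set V} (hN : N ∈ 𝓝 u) :
    ¬ {w | ‖w‖ = 1 ∧ w ∈ N ∧ IsStationary K w}.Countable := by
  intro hc
  have hpos : (0 : ℝ) < (Module.finrank ℝ V : ℝ) - 1 := by
    have : (2 : ℝ) ≤ Module.finrank ℝ V := by exact_mod_cast hn
    linarith
  have := Measure.nullSingletonClass_hausdorff V hpos
  have h1 := (hc.image (supportPt K.1)).measure_zero
    (Measure.hausdorffMeasure ((Module.finrank ℝ V : ℝ) - 1))
  refine hK.hausdorffMeasure_image_supportPt_ne_zero hu hN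
    (measure_mono_null ?_ (measure_union_null h1 h0))
  rintro _ ⟨w, ⟨hw, hwN⟩, rfl⟩
  by_cases hs : IsStationary K w
  · exact Or.inl ⟨w, ⟨hw, hwN, hs⟩, rfl⟩
  · exact Or.inr ⟨w, ⟨hw, hs⟩, rfl⟩

/-- The properties of a typical convex body of constant width in a Euclidean space of dimension at
least two. -/
theorem eventually_residual_radii (hn : 2 ≤ Module.finrank ℝ V) :
    ∀ᶠ K in residual (ConstantWidthOne V),
      (∀ᵐ x ∂(Measure.hausdorffMeasure ((Module.finrank ℝ V : ℝ) - 1) : Measure V),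
        x ∈ frontier (K.1 : Set V) → AllRadiiOfCurvatureEq (K.1 : Set V) x 1) ∧
      ¬ {x | AllRadiiOfCurvatureEq (K.1 : Set V) x 0}.Countable ∧
      frontier (K.1 : Set V) ⊆ closure {x | AllRadiiOfCurvatureEq (K.1 : Set V) x 0} := by
  filter_upwards [eventually_residual_isSmooth, eventually_residual_ae_det_eq_zero_or_isStationary]
    with K hK hae
  have h0 := hausdorffMeasure_nonstationary_eq_zero hae
  refine ⟨?_, fun hc => ?_, fun x hx => ?_⟩
  · refine measure_mono_null ?_ h0
    intro x hx
    by_contra hcon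
    refine hx fun hxf => ?_
    obtain ⟨u, hu, rfl⟩ := exists_eq_supportPt_of_mem_frontier K hxf
    exact allRadiiOfCurvatureEq_one hK hu (by_contra fun hs => hcon ⟨u, ⟨hu, hs⟩, rfl⟩)
  · obtain ⟨u, hu⟩ := exists_norm_eq V zero_le_one
    refine hK.not_countable_stationary hn h0 hu univ_mem
      (Set.MapsTo.countable_of_injOn (f := fun w => supportPt K.1 (-w)) ?_ ?_ hc)
    · exact fun w hw => allRadiiOfCurvatureEq_zero hK hw.1 hw.2.2
    · exact fun w hw w' hw' h => neg_injective
        (hK _ _ (by rw [norm_neg]; exact hw.1) (by rw [norm_neg]; exact hw'.1) h)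
  · obtain ⟨u, hu, rfl⟩ := exists_eq_supportPt_of_mem_frontier K hx
    rw [mem_closure_iff_nhds]
    intro s hs
    have hcont : ContinuousAt (fun w => supportPt K.1 (-w)) (-u) := by
      have h1 : ContinuousAt (supportPt K.1) (-(-u)) := by
        rw [neg_neg]
        exact (lipschitzOnWith_supportPt K).continuousOn.continuousAt
          ((isOpen_lt continuous_const continuous_norm).mem_nhds (by
            simp only [Set.mem_ofPred_eq, hu]; norm_num))
      exact h1.comp continuous_neg.continuousAt
    have hs' : (fun w => supportPt K.1 (-w)) ⁻¹' s ∈ 𝓝 (-u) :=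
      hcont (by simpa only [neg_neg] using hs)
    -- The search takes place near `-u`, since the points with vanishing radii are the `supportPt K
    -- (-w)` with `w` stationary.
    have hne := hK.not_countable_stationary hn h0 (u := -u) (by rwa [norm_neg]) hs'
    obtain ⟨w, hw1, hw2, hw3⟩ := (Set.not_subsingleton_iff.1
      fun h => hne h.finite.countable).nonempty
    exact ⟨supportPt K.1 (-w), hw2, allRadiiOfCurvatureEq_zero hK hw1 hw3⟩

end Conclusion

end ConstantWidth

end

/-- For a typical convex body `K` of constant width `1` in `ℝⁿ`, `n ≥ 2`, all radii of curvature
are `1` at almost all boundary points, and the set of boundary points at which all radii of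
curvature are `0` is uncountable and dense in the boundary. -/
theorem mainTheorem1 (n : ℕ) (hn : 2 ≤ n) :
    ∀ᶠ K : ConstantWidth.ConstantWidthOne (EuclideanSpace ℝ (Fin n)) in residual _,
      (∀ᵐ x ∂(Measure.hausdorffMeasure ((n : ℝ) - 1) : Measure (EuclideanSpace ℝ (Fin n))),
        x ∈ frontier (K.1 : Set (EuclideanSpace ℝ (Fin n))) →
          ConstantWidth.AllRadiiOfCurvatureEq (K.1 : Set (EuclideanSpace ℝ (Fin n))) x 1) ∧
      ¬ {x | ConstantWidth.AllRadiiOfCurvatureEq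
          (K.1 : Set (EuclideanSpace ℝ (Fin n))) x 0}.Countable ∧
      frontier (K.1 : Set (EuclideanSpace ℝ (Fin n))) ⊆
        closure {x | ConstantWidth.AllRadiiOfCurvatureEq
          (K.1 : Set (EuclideanSpace ℝ (Fin n))) x 0} := by
  have : Nontrivial (EuclideanSpace ℝ (Fin n)) := by
    refine Module.nontrivial_of_finrank_pos (R := ℝ) ?_
    rw [finrank_euclideanSpace_fin]
    omega
  have h := ConstantWidth.eventually_residual_radii (V := EuclideanSpace ℝ (Fin n))
    (by rwa [finrank_euclideanSpace_fin])
  rwa [finrank_euclideanSpace_fin] at h
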